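/- Let $g$ be a probability density on $[0,\infty)$ with mean $1$, let $G(x)=\int_0^x g(y)\,dy$, $M=\sup\{x\ge 0: G(x)<1\}\in(0,\infty]$, and let $h=g/(1-G)$ be the hazard rate on $[0,M)$. Write $\langle f,\mu\rangle=\int_{[0,M)} f\,d\mu$, and let $\nu_*$ be the measure on $[0,M)$ with Lebesgue density $1-G$. Càdlàg functions with values in measures refer to the topology of weak convergence. Let $\lambda\in(0,\infty)$, $E(t)=\lambda t$, let $X_0\ge 0$ and let $\nu_0$ be a sub-probability measure on $[0,M)$ with $1-\langle 1,\nu_0\rangle=[1-X_0]^+$. A càdlàg function $(X,\nu)$ on $[0,\infty)$, with values in $[0,\infty)\times\{\text{sub-probability measures on }[0,M)\}$ and with value $(X_0,\nu_0)$ at time $0$, solves the fluid equations associated with $(E,X_0,\nu_0)$ if for every $t\ge 0$: $\int_0^t\langle h,\nu_s\rangle ds<\infty$; for every $\varphi\in C^1_c([0,M)\times[0,\infty))$, $$\langle\varphi(\cdot,t),\nu_t\rangle=\langle\varphi(\cdot,0),\nu_0\rangle+\int_0^t\langle\varphi_s(\cdot,s)+\varphi_x(\cdot,s)-h\,\varphi(\cdot,s),\nu_s\rangle\,ds+\int_0^t\varphi(0,s)\,dK(s),$$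 where $K(t)=\langle 1,\nu_t\rangle-\langle 1,\nu_0\rangle+\int_0^t\langle h,\nu_s\rangle ds$; $X(t)=X_0+E(t)-\int_0^t\langle h,\nu_s\rangle ds$; and $1-\langle 1,\nu_t\rangle=[1-X(t)]^+$. Suppose that these equations have a unique solution $(X,\nu)$. Then the following hold. (1) If $X_0=0$, then $\langle 1,\nu_t\rangle=X(t)\wedge 1$ for all $t\ge0$, and $\langle 1,\nu_t\rangle$ is nondecreasing in $t$ and converges to $\lambda\wedge 1$ as $t\to\infty$. If in addition $\lambda\le 1$, then $X(t)=\langle 1,\nu_t\rangle$ for all $t\ge0$, and for every nonnegative bounded continuous function $f$ on $[0,M)$, $\langle f,\nu_t\rangle$ is nondecreasing in $t$ and converges to $\lambda\langle f,\nu_*\rangle$. (2) If $g$ is directly Riemann integrable on $[0,\infty)$ and $\lambda\ge 1$, then (for any initial data as above, not only $X_0=0$) for every bounded continuous function $f$ on $[0,M)$, $$\lim_{t\to\infty}\langle f,\nu_t\rangle=\langle f,\nu_*\rangle=\int_{[0,M)}f(x)(1-G(x))\,dx;$$ in other words, $\nu_t$ converges weakly to $\nu_*$ as $t\to\infty$.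 -/

import Mathlib

open Set Filter Topology MeasureTheory

noncomputable section

/-- The distribution function `G(x) = ∫₀ˣ g(y) dy`, for `x ≥ 0`, of the service time with
density `g` on `[0,∞)`. -/
def serviceCDF (g : ℝ → ℝ) (x : ℝ) : ℝ := ∫ y in (0 : ℝ)..x, g y

/-- `g` is the density of a probability distribution on `[0,∞)` with mean `1`. Only the values
of `g` on `[0,∞)` matter. -/
structure IsServiceDensity (g : ℝ → ℝ) : Prop where
  measurable : Measurable g
  nonneg : ∀ x, 0 ≤ x → 0 ≤ g x
  integrable : IntegrableOn g (Ici 0)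
  total_mass : ∫ x in Ici (0 : ℝ), g x = 1
  integrable_mean : IntegrableOn (fun x => x * g x) (Ici 0)
  mean_one : ∫ x in Ici (0 : ℝ), x * g x = 1

/-- The right end point `M = sup {x ∈ [0,∞) : G(x) < 1}`, possibly `∞`. -/
def serviceEndpoint (g : ℝ → ℝ) : EReal :=
  sSup ((fun x : ℝ => (x : EReal)) '' {x : ℝ | 0 ≤ x ∧ serviceCDF g x < 1})

/-- The interval `[0,M)` as a set of real numbers. -/
def ageSet (g : ℝ → ℝ) : Set ℝ := {x : ℝ | 0 ≤ x ∧ (x : EReal) < serviceEndpoint g}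

/-- The interval `[0,M)` of ages, as a space. -/
abbrev AgeSpace (g : ℝ → ℝ) : Type := ↥(ageSet g)

/-- The hazard rate `h = g / (1 - G)` (used on `[0,M)` only). -/
def hazardRate (g : ℝ → ℝ) (x : ℝ) : ℝ := g x / (1 - serviceCDF g x)

/-- `f : [0,∞) → S` is right-continuous with left limits. Values at negative times are ignored. -/
def IsCadlag {S : Type*} [TopologicalSpace S] (f : ℝ → S) : Prop :=
  (∀ t, 0 ≤ t → ContinuousWithinAt f (Ici t) t) ∧
    ∀ t, 0 < t → ∃ l, Tendsto f (𝓝[<] t) (𝓝 l)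

/-- Test functions in `C¹_c([0,M) × [0,∞))`, given as restrictions of `C¹` functions
on the plane whose compact support lies in `(-∞,M) × ℝ`. -/
structure IsTestFunction (g : ℝ → ℝ) (φ : ℝ × ℝ → ℝ) : Prop where
  contDiff : ContDiff ℝ 1 φ
  hasCompactSupport : HasCompactSupport φ
  tsupport_subset : ∀ p ∈ tsupport φ, (p.1 : EReal) < serviceEndpoint g

open scoped Classical in
/-- The Lebesgue--Stieltjes measure `dK` on `(0,∞)` of a nondecreasing càdlàg function `K` on
`[0,∞)` (and `0` if `K` is not nondecreasing). -/
def stieltjesMeasure (K : ℝ → ℝ) : Measure ℝ :=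
  if hK : Monotone (fun t => K (max t 0)) then hK.stieltjesFunction.measure else 0

/-- The space `𝒮₀` of input data `(E, X₀, ν₀)` of the fluid equations: `E` is a nondecreasing
càdlàg function on `[0,∞)` with `E(0) = 0`, `X₀ ≥ 0`, `ν₀` is a sub-probability measure on
`[0,M)`, and `1 - ⟨1, ν₀⟩ = [1 - X₀]⁺`. -/
structure IsFluidInput (g : ℝ → ℝ) (E : ℝ → ℝ) (X₀ : ℝ) (ν₀ : FiniteMeasure (AgeSpace g)) :
    Prop where
  E_zero : E 0 = 0
  E_mono : MonotoneOn E (Ici 0)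
  E_cadlag : IsCadlag E
  X_nonneg : 0 ≤ X₀
  mass_le_one : (ν₀.mass : ℝ) ≤ 1
  nonidling : 1 - (ν₀.mass : ℝ) = max (1 - X₀) 0

/-- The cumulative departures `D(t) = ∫₀ᵗ ⟨h, ν_s⟩ ds`. -/
def fluidDepartures (g : ℝ → ℝ) (ν : ℝ → FiniteMeasure (AgeSpace g)) (t : ℝ) : ℝ :=
  ∫ s in (0 : ℝ)..t, ∫ x, hazardRate g x ∂(ν s : Measure (AgeSpace g))

/-- The cumulative entries into service `K(t) = ⟨1, ν_t⟩ - ⟨1, ν₀⟩ + ∫₀ᵗ ⟨h, ν_s⟩ ds`. -/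
def fluidEntries (g : ℝ → ℝ) (ν : ℝ → FiniteMeasure (AgeSpace g)) (t : ℝ) : ℝ :=
  ((ν t).mass : ℝ) - ((ν 0).mass : ℝ) + fluidDepartures g ν t

/-- `(X, ν)` solves the fluid equations associated with the input data `(E, X₀, ν₀)` and the
hazard rate `h` of `g`. Time is `[0,∞)`; the values of `X` and `ν` at negative times are
ignored. The topology on measures is the weak one. -/
structure SolvesFluidEquations (g : ℝ → ℝ) (E : ℝ → ℝ) (X₀ : ℝ)
    (ν₀ : FiniteMeasure (AgeSpace g)) (X : ℝ → ℝ) (ν : ℝ → FiniteMeasure (AgeSpace g)) :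
    Prop where
  X_cadlag : IsCadlag X
  ν_cadlag : IsCadlag ν
  X_nonneg : ∀ t, 0 ≤ t → 0 ≤ X t
  mass_le_one : ∀ t, 0 ≤ t → ((ν t).mass : ℝ) ≤ 1
  X_init : X 0 = X₀
  ν_init : ν 0 = ν₀
  departures_finite : ∀ t, 0 ≤ t →
    ∫⁻ s in Icc 0 t, ∫⁻ x, ENNReal.ofReal (hazardRate g x) ∂(ν s : Measure (AgeSpace g)) < ⊤
  transport : ∀ φ : ℝ × ℝ → ℝ, IsTestFunction g φ → ∀ t, 0 ≤ t →
    ∫ x, φ (x, t) ∂(ν t : Measure (AgeSpace g)) =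
      ∫ x, φ (x, 0) ∂(ν₀ : Measure (AgeSpace g))
      + (∫ s in (0 : ℝ)..t, ∫ x : AgeSpace g, deriv (fun r => φ (x, r)) s ∂(ν s : Measure _))
      + (∫ s in (0 : ℝ)..t, ∫ x : AgeSpace g, deriv (fun y => φ (y, s)) x ∂(ν s : Measure _))
      - (∫ s in (0 : ℝ)..t, ∫ x : AgeSpace g, hazardRate g x * φ (x, s) ∂(ν s : Measure _))
      + ∫ s in Ioc 0 t, φ (0, s) ∂(stieltjesMeasure (fluidEntries g ν))
  balance : ∀ t, 0 ≤ t → X t = X₀ + E t - fluidDepartures g ν t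
  nonidling : ∀ t, 0 ≤ t → 1 - ((ν t).mass : ℝ) = max (1 - X t) 0

/-- `(X, ν)` is the unique solution of the fluid equations with the given input data. -/
def IsUniqueFluidSolution (g : ℝ → ℝ) (E : ℝ → ℝ) (X₀ : ℝ)
    (ν₀ : FiniteMeasure (AgeSpace g)) (X : ℝ → ℝ) (ν : ℝ → FiniteMeasure (AgeSpace g)) : Prop :=
  SolvesFluidEquations g E X₀ ν₀ X ν ∧
    ∀ (X' : ℝ → ℝ) (ν' : ℝ → FiniteMeasure (AgeSpace g)),
      SolvesFluidEquations g E X₀ ν₀ X' ν' → ∀ t, 0 ≤ t → X' t = X t ∧ ν' t = ν t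

/-- Upper Riemann sum on `[0,∞)` with mesh `δ` of a nonnegative function. -/
def upperRiemannSum (z : ℝ → ℝ) (δ : ℝ) : ENNReal :=
  ∑' n : ℕ, ENNReal.ofReal δ * ⨆ y ∈ Ico (n * δ) ((n + 1) * δ), ENNReal.ofReal (z y)

/-- Lower Riemann sum on `[0,∞)` with mesh `δ` of a nonnegative function. -/
def lowerRiemannSum (z : ℝ → ℝ) (δ : ℝ) : ENNReal :=
  ∑' n : ℕ, ENNReal.ofReal δ * ⨅ y ∈ Ico (n * δ) ((n + 1) * δ), ENNReal.ofReal (z y)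

/-- A nonnegative function on `[0,∞)` is directly Riemann integrable if its upper Riemann sums
over the whole half-line are finite and the upper and the lower sums have the same finite limit
as the mesh tends to `0`. -/
def DirectlyRiemannIntegrable (z : ℝ → ℝ) : Prop :=
  (∀ y, 0 ≤ y → 0 ≤ z y) ∧ (∀ δ, 0 < δ → upperRiemannSum z δ < ⊤) ∧
    ∃ I : ENNReal, I < ⊤ ∧ Tendsto (upperRiemannSum z) (𝓝[>] 0) (𝓝 I) ∧
      Tendsto (lowerRiemannSum z) (𝓝[>] 0) (𝓝 I)

/-- Lebesgue measure on `[0,M)`. -/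
def lebesgueAge (g : ℝ → ℝ) : Measure (AgeSpace g) :=
  Measure.comap (fun x : AgeSpace g => (x : ℝ)) volume

/-- The measure on `[0,M)` with Lebesgue density `1 - G`. -/
def equilibriumMeasure (g : ℝ → ℝ) : Measure (AgeSpace g) :=
  (lebesgueAge g).withDensity
    fun x => ENNReal.ofReal (1 - serviceCDF g x)

theorem IsServiceDensity.one_sub_cdf {g : ℝ → ℝ} (hg : IsServiceDensity g) {x : ℝ} (hx : 0 ≤ x) :
    1 - serviceCDF g x = ∫ y in Ioi x, g y := by
  have h0 := hg.total_mass
  rw [integral_Ici_eq_integral_Ioi] at h0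
  have hi : IntegrableOn g (Ioi 0) := hg.integrable.mono_set Ioi_subset_Ici_self
  have := intervalIntegral.integral_Ioi_sub_Ioi hi hx
  rw [serviceCDF, ← this, h0]
  ring

/-- The mean being `1`, the measure with density `1 - G` is finite. -/
theorem IsServiceDensity.isFiniteMeasure_equilibrium {g : ℝ → ℝ} (hg : IsServiceDensity g) :
    IsFiniteMeasure (equilibriumMeasure g) := by
  have hm : MeasurableSet (ageSet g) :=
    measurableSet_Ici.inter (measurable_coe_real_ereal measurableSet_Iio)
  refine isFiniteMeasure_withDensity (ne_of_lt ?_)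
  have h1 : ∫⁻ x : AgeSpace g, ENNReal.ofReal (1 - serviceCDF g x) ∂(lebesgueAge g) =
      ∫⁻ x in ageSet g,
        ENNReal.ofReal (1 - serviceCDF g x) :=
    lintegral_subtype_comap hm fun x => ENNReal.ofReal (1 - serviceCDF g x)
  have h2 : ∫⁻ x in ageSet g,
        ENNReal.ofReal (1 - serviceCDF g x) ≤
      ∫⁻ x in Ici (0 : ℝ), ENNReal.ofReal (1 - serviceCDF g x) :=
    lintegral_mono_set fun x hx => hx.1
  have hae : ∀ᵐ x ∂(volume.restrict (Ici (0 : ℝ))), 0 ≤ x :=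
    (ae_restrict_iff' measurableSet_Ici).2 (ae_of_all _ fun x hx => hx)
  let μ : Measure ℝ := (volume.restrict (Ici (0 : ℝ))).withDensity fun y => ENNReal.ofReal (g y)
  have hμ : ∀ x : ℝ, 0 ≤ x → ENNReal.ofReal (1 - serviceCDF g x) = μ {y | x < y} := by
    intro x hx
    have hs : (Ioi x) ∩ Ici 0 = Ioi x :=
      inter_eq_left.2 fun y hy => hx.trans (le_of_lt hy)
    rw [hg.one_sub_cdf hx]
    change _ = μ (Ioi x)
    rw [withDensity_apply _ measurableSet_Ioi, Measure.restrict_restrict measurableSet_Ioi, hs]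
    refine ofReal_integral_eq_lintegral_ofReal
      (hg.integrable.mono_set fun y hy => hx.trans (le_of_lt hy)) ?_
    exact (ae_restrict_iff' measurableSet_Ioi).2
      (ae_of_all _ fun y hy => hg.nonneg y (hx.trans (le_of_lt hy)))
  have hacμ : ∀ᵐ y ∂μ, (0 : ℝ) ≤ y := (withDensity_absolutelyContinuous _ _).ae_le hae
  have h3 : ∫⁻ x in Ici (0 : ℝ), ENNReal.ofReal (1 - serviceCDF g x) =
      ∫⁻ y, ENNReal.ofReal y ∂μ := by
    rw [lintegral_eq_lintegral_meas_lt μ hacμ aemeasurable_id,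
      setLIntegral_congr (Ioi_ae_eq_Ici (μ := volume) (a := (0 : ℝ))).symm]
    exact setLIntegral_congr_fun measurableSet_Ioi fun x hx => hμ x (le_of_lt hx)
  have h4 : ∫⁻ y, ENNReal.ofReal y ∂μ = ∫⁻ y in Ici (0 : ℝ), ENNReal.ofReal (y * g y) := by
    refine (lintegral_withDensity_eq_lintegral_mul (volume.restrict (Ici (0 : ℝ)))
      hg.measurable.ennreal_ofReal ENNReal.measurable_ofReal).trans ?_
    refine setLIntegral_congr_fun measurableSet_Ici fun y hy => ?_
    simp only [Pi.mul_apply]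
    rw [ENNReal.ofReal_mul hy, mul_comm]
  rw [h1]
  refine h2.trans_lt ?_
  rw [h3, h4]
  exact hg.integrable_mean.lintegral_lt_top

/-- The finite measure `ν_*` on `[0,M)` with Lebesgue density `1 - G`. -/
def equilibrium (g : ℝ → ℝ) (hg : IsServiceDensity g) : FiniteMeasure (AgeSpace g) :=
  ⟨equilibriumMeasure g, hg.isFiniteMeasure_equilibrium⟩

end

/-! Write `S = 1 - G` and let `*` denote convolution with the service law. The weight `w = 1/S`
solves `w' = h w`, so after weighting by `1/S` the killing term drops out of the transport equation
and mass is carried unchanged along the lines `x - t = const`. This yields the explicit formula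
(`lintegral_eq`) `⟨f, ν_t⟩ = ∫ f(x+t) S(x+t)/S(x) ν₀(dx) + ∫_{(0,t]} f(t-s) S(t-s) dK(s)`. The
difficulty is that `1/S` is not `C¹`. It is approximated by `C¹` weights (`exists_approx`), and the
error is controlled because the ages, integrated over time along characteristics, are dominated by
Lebesgue measure up to a finite factor (`lintegral_occupation_mul_le`).

Taking `f = 1` and `f = h` gives renewal equations. The mass satisfies `⟨1, ν_t⟩ = survivors(t) + K
- K * g` (`mass_eq`). With the queue `Q = [X-1]⁺ = λt + [X₀-1]⁺ - K` and `I(t) = ∫₀ᵗ S`, which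
increases to the mean service time `1`, one gets `X = survivors + [X₀-1]⁺ S + λ I + Q * g` (`X_eq`).

For an empty start the first two terms vanish. While `λ I ≤ 1` this gives `Q ≤ Q * g`, hence `Q = 0`
and `X = λ I`. Once `λ I ≥ 1`, `X ≥ λ I` keeps all servers busy. So the mass is `min (λ I) 1`. If `λ
≤ 1` there is never a queue, `K(t) = λ t`, and `ν_t` has density `λ S` on `[0,t]`, which settles
(1).

For `λ ≥ 1` and any start, `X ≥ λ I` forces the mass to tend to `1`, so `K - K * g → 1`. Blackwell's
theorem in the form `tendsto_increment`, proved through the Choquet–Deny theorem, gives `K(t+a) -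
K(t) → a`. Lower Riemann sums then bound `⟨f, ν_t⟩` asymptotically from below by `⟨f, ν_*⟩` for `f ≥
0`. Since the masses also converge to `⟨1, ν_*⟩ = 1`, no mass is left over, and weak convergence
follows. -/

section

/-! ### Compactness for Lipschitz functions and the Choquet–Deny theorem. -/

/-- A pointwise bounded sequence of uniformly Lipschitz functions on the line has a pointwise
convergent subsequence. -/
theorem exists_subseq_tendsto_of_lipschitzWith {f : ℕ → ℝ → ℝ} {C : NNReal} {B : ℝ}
    (hf : ∀ n, LipschitzWith C (f n)) (h0 : ∀ n, |f n 0| ≤ B) :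
    ∃ φ : ℕ → ℕ, StrictMono φ ∧ ∃ p : ℝ → ℝ, LipschitzWith C p ∧
      ∀ x, Tendsto (fun n => f (φ n) x) atTop (𝓝 (p x)) := by
  have hd : ∀ n x y, |f n x - f n y| ≤ C * |x - y| := fun n x y => by
    simpa [Real.dist_eq] using (hf n).dist_le_mul x y
  -- Tychonoff over the countable set of rationals replaces the diagonal argument; the uniform
  -- Lipschitz bound then extends convergence to all reals.
  have hcomp : IsCompact (Set.pi univ fun q : ℚ => Icc (-(B + C * |(q : ℝ)|)) (B + C * |(q : ℝ)|)) :=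
    isCompact_univ_pi fun _ => isCompact_Icc
  obtain ⟨p₀, -, φ, hφ, hlim⟩ := hcomp.tendsto_subseq (x := fun n (q : ℚ) => f n q) (fun n => by
    intro q _
    have h1 := hd n q 0
    have h2 := h0 n
    rw [sub_zero] at h1
    refine abs_le.1 ?_
    calc |f n q| = |(f n q - f n 0) + f n 0| := by ring_nf
      _ ≤ |f n q - f n 0| + |f n 0| := abs_add_le _ _
      _ ≤ B + C * |(q : ℝ)| := by linarith)
  rw [tendsto_pi_nhds] at hlim
  have hconv : ∀ x : ℝ, ∃ l, Tendsto (fun n => f (φ n) x) atTop (𝓝 l) := by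
    intro x
    refine cauchySeq_tendsto_of_complete (Metric.cauchySeq_iff.2 fun ε hε => ?_)
    -- Using `C + 1` instead of `C` keeps the denominator positive when `C = 0`.
    have hpos : 0 < ε / (3 * (C + 1)) := by positivity
    obtain ⟨q, hq1, hq2⟩ := exists_rat_btwn (lt_add_of_pos_right x hpos)
    obtain ⟨N, hN⟩ := Metric.cauchySeq_iff.1 (hlim q).cauchySeq (ε / 3) (by positivity)
    refine ⟨N, fun m hm n hn => ?_⟩
    have h1 := hN m hm n hn
    simp only [Function.comp, Real.dist_eq] at h1 ⊢
    have h2 : ∀ k, |f k x - f k q| ≤ ε / 3 := fun k => by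
      refine (hd k x q).trans ?_
      have : |x - q| ≤ ε / (3 * (C + 1)) := by rw [abs_le]; constructor <;> linarith
      calc (C : ℝ) * |x - q| ≤ (C + 1) * (ε / (3 * (C + 1))) := by gcongr; linarith
        _ = ε / 3 := by field_simp
    have h3 := h2 (φ m)
    have h4 := h2 (φ n)
    rw [abs_le] at h3 h4
    rw [abs_lt] at h1 ⊢
    constructor <;> linarith
  choose p hp using hconv
  refine ⟨φ, hφ, p, LipschitzWith.of_dist_le_mul fun x y => ?_, hp⟩
  exact le_of_tendsto ((hp x).dist (hp y)) (Eventually.of_forall fun n => (hf _).dist_le_mul x y)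

/-- A bounded Lipschitz function which is invariant under convolution with a probability measure
decreases along the points of the support of this measure. -/
theorem sub_le_zero_of_convolution_invariant {μ : Measure ℝ} [IsProbabilityMeasure μ] {w : ℝ → ℝ}
    {C : NNReal} {B : ℝ} (hL : LipschitzWith C w) (hB : ∀ x, |w x| ≤ B)
    (hw : ∀ x, ∫ s, w (x - s) ∂μ = w x) {a : ℝ} (ha : a ∈ μ.support) (x : ℝ) :
    w x - w (x - a) ≤ 0 := by
  set u : ℝ → ℝ := fun x => w x - w (x - a) with hu
  have hub : BddAbove (range u) := ⟨2 * B, by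
    rintro _ ⟨y, rfl⟩
    have h1 := hB y
    have h2 := hB (y - a)
    rw [abs_le] at h1 h2
    simp only [hu]; linarith⟩
  set S := sSup (range u) with hS
  have huS : ∀ y, u y ≤ S := fun y => le_csSup hub ⟨y, rfl⟩
  refine (huS x).trans ?_
  obtain ⟨v, -, hv, hvr⟩ := exists_seq_tendsto_sSup (range_nonempty u) hub
  choose y hy using hvr
  -- The supremum `S` of `u` need not be attained. Recentring `w` at a maximizing sequence and
  -- passing to a limit gives a function `p` with the same properties whose increment does attain
  -- `S`, at `0`.
  obtain ⟨φ, hφ, p, hpL, hp⟩ := exists_subseq_tendsto_of_lipschitzWith (C := C) (B := B)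
    (f := fun n z => w (y n + z))
    (fun n => LipschitzWith.of_dist_le_mul fun z z' => by
      simpa [dist_add_left] using hL.dist_le_mul (y n + z) (y n + z')) (fun n => hB _)
  have hpB : ∀ z, |p z| ≤ B := fun z =>
    le_of_tendsto (hp z).abs (Eventually.of_forall fun n => hB _)
  have hpc : Continuous p := hpL.continuous
  have hpu : ∀ z, p z - p (z - a) ≤ S := fun z => by
    refine le_of_tendsto ((hp z).sub (hp (z - a))) (Eventually.of_forall fun n => ?_)
    have := huS (y (φ n) + z)
    simpa [hu, add_sub_assoc] using this
  have hp0 : p 0 - p (0 - a) = S := by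
    refine tendsto_nhds_unique ((hp 0).sub (hp (0 - a))) ?_
    have h1 : Tendsto (fun n => v (φ n)) atTop (𝓝 S) := hv.comp hφ.tendsto_atTop
    refine h1.congr fun n => ?_
    rw [← hy]
    simp [hu, sub_eq_add_neg]
  have hpμ : ∀ z, ∫ s, p (z - s) ∂μ = p z := fun z => by
    refine tendsto_nhds_unique (tendsto_integral_of_dominated_convergence (fun _ => B)
      (F := fun n s => w (y (φ n) + (z - s))) (fun n => ?_) (integrable_const _)
      (fun n => Eventually.of_forall fun s => ?_)
      (Eventually.of_forall fun s => hp (z - s))) ?_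
    · exact (hL.continuous.comp (by fun_prop)).aestronglyMeasurable
    · simpa using hB _
    · refine (hp z).congr fun n => ?_
      rw [← hw]
      simp [add_sub_assoc]
  have hpi : ∀ z, Integrable (fun s => p (z - s)) μ := fun z =>
    Integrable.of_bound (hpc.comp (by fun_prop)).aestronglyMeasurable B
      (Eventually.of_forall fun s => by simpa using hpB _)
  -- Maximum principle: the increment at `z` is the `μ`-average of the increments at `z - s`, none
  -- of which exceeds `S`. If the average equals `S`, then by continuity so does the increment at `z
  -- - s` for each `s` in the support.
  have hstep : ∀ z, p z - p (z - a) = S → p (z - a) - p (z - a - a) = S := by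
    intro z hz
    by_contra hne
    have hlt : p (z - a) - p (z - a - a) < S := lt_of_le_of_ne (hpu _) hne
    have hi : Integrable (fun s => S - (p (z - s) - p (z - s - a))) μ := by
      refine (integrable_const S).sub ((hpi z).sub ?_)
      refine (hpi (z - a)).congr (Eventually.of_forall fun s => ?_)
      simp only; congr 1; ring
    have h0 : ∫ s, (S - (p (z - s) - p (z - s - a))) ∂μ = 0 := by
      have h1 : ∀ s, p (z - s - a) = p ((z - a) - s) := fun s => by congr 1; ring
      simp_rw [h1]
      have h2 : Integrable (fun s => p (z - s) - p (z - a - s)) μ := (hpi z).sub (hpi (z - a))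
      rw [integral_sub (integrable_const S) h2, integral_sub (hpi z) (hpi (z - a)),
        hpμ, hpμ, hz]
      simp
    rw [integral_eq_zero_iff_of_nonneg (fun s => sub_nonneg.2 (hpu _)) hi] at h0
    have hcont : Continuous fun s => S - (p (z - s) - p (z - s - a)) := by fun_prop
    have hopen : {s | 0 < S - (p (z - s) - p (z - s - a))} ∈ 𝓝 a :=
      (isOpen_lt continuous_const hcont).mem_nhds (by simpa using hlt)
    have h3 := (Measure.mem_support_iff_forall a).1 ha _ hopen
    refine h3.ne' (measure_mono_null ?_ h0)
    intro s hs
    simp only [mem_ofPred_eq] at hs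
    simp only [mem_compl_iff, mem_ofPred_eq, Pi.zero_apply]
    exact hs.ne'
  have hall : ∀ n : ℕ, p (0 - n * a) - p (0 - n * a - a) = S := by
    intro n
    induction n with
    | zero => simpa using hp0
    | succ n ih =>
      have := hstep _ ih
      have e : (0 : ℝ) - ((n + 1 : ℕ) : ℝ) * a = 0 - n * a - a := by push_cast; ring
      rw [e]; exact this
  -- The maximal increments telescope to `n * S`, while `p` is bounded; hence `S ≤ 0`.
  have htel : ∀ n : ℕ, p 0 - p (0 - n * a) = n * S := by
    intro n
    induction n with
    | zero => simp
    | succ n ih =>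
      have e : (0 : ℝ) - ((n + 1 : ℕ) : ℝ) * a = 0 - n * a - a := by push_cast; ring
      rw [e]
      have := hall n
      push_cast
      linarith
  by_contra hpos
  push Not at hpos
  obtain ⟨n, hn⟩ := exists_nat_gt (2 * B / S)
  rw [div_lt_iff₀ hpos] at hn
  have h1 := htel n
  have h2 := hpB 0
  have h3 := hpB (0 - n * a)
  rw [abs_le] at h2 h3
  linarith

/-- **Choquet--Deny**: a bounded Lipschitz function on the line which is invariant under
convolution with an absolutely continuous probability measure is constant. -/
theorem eq_of_convolution_invariant {μ : Measure ℝ} [IsProbabilityMeasure μ] (hμ : μ ≪ volume)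
    {w : ℝ → ℝ} {C : NNReal} {B : ℝ} (hL : LipschitzWith C w) (hB : ∀ x, |w x| ≤ B)
    (hw : ∀ x, ∫ s, w (x - s) ∂μ = w x) (x y : ℝ) : w x = w y := by
  -- The group of periods of `w`. It contains the support of `μ`, and it is closed, so it is either
  -- the whole line or cyclic.
  let H : AddSubgroup ℝ :=
    { carrier := {a | ∀ x, w (x + a) = w x}
      zero_mem' := fun x => by simp
      add_mem' := fun {a b} ha hb x => by
        rw [← add_assoc, hb, ha]
      neg_mem' := fun {a} ha x => by
        have := ha (x + -a)
        simpa using this.symm }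
  have hsupp : μ.support ⊆ H := by
    intro a ha z
    have h1 := sub_le_zero_of_convolution_invariant hL hB hw ha (z + a)
    -- The same inequality for `-w` turns monotonicity along `a` into periodicity.
    have h2 := sub_le_zero_of_convolution_invariant (w := fun x => -w x) hL.neg
      (fun x => by simpa using hB x) (fun x => by rw [integral_neg, hw]) ha (z + a)
    simp only [add_sub_cancel_right] at h1 h2
    linarith
  rcases H.dense_or_cyclic with hd | ⟨a, ha⟩
  · have hc : IsClosed (H : Set ℝ) := by
      have : (H : Set ℝ) = ⋂ x, {a | w (x + a) = w x} := by
        ext a; simp only [mem_iInter, mem_ofPred_eq]; rfl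
      rw [this]
      have := hL.continuous
      exact isClosed_iInter fun x => isClosed_eq (by fun_prop) continuous_const
    have huniv : (H : Set ℝ) = univ := by rw [← hc.closure_eq, hd.closure_eq]
    have hxy : (x - y) ∈ (H : Set ℝ) := huniv ▸ mem_univ _
    have := hxy y
    simpa using this
  -- A cyclic group is countable, hence null for the absolutely continuous `μ`, although it carries
  -- all of `μ`.
  · exfalso
    have hcount : (H : Set ℝ).Countable := by
      rw [ha]
      have : ((AddSubgroup.closure {a} : AddSubgroup ℝ) : Set ℝ) ⊆ range fun n : ℤ => n • a := by
        intro b hb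
        obtain ⟨n, hn⟩ := AddSubgroup.mem_closure_singleton.1 hb
        exact ⟨n, hn⟩
      exact (countable_range _).mono this
    have h0 : μ H = 0 := hμ (hcount.measure_zero _)
    have h1 : μ (H : Set ℝ)ᶜ = 0 :=
      measure_mono_null (compl_subset_compl.2 hsupp) Measure.measure_compl_support
    have : μ univ ≤ 0 := by
      rw [← union_compl_self (H : Set ℝ)]
      exact (measure_union_le _ _).trans (by rw [h0, h1, add_zero])
    simp at this

/-- A Lipschitz function with `q = q * μ` vanishes if it does at `0` and `μ` has mean `1`. -/
theorem eq_zero_of_convolution_invariant {μ : Measure ℝ} [IsProbabilityMeasure μ]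
    (hμ : μ ≪ volume) (hi : Integrable (fun s => s) μ) (hm : ∫ s, s ∂μ = 1)
    {q : ℝ → ℝ} {C : NNReal} (hL : LipschitzWith C q) (h0 : q 0 = 0)
    (hq : ∀ x, ∫ s, (q x - q (x - s)) ∂μ = 0) (x : ℝ) : q x = 0 := by
  have hqc := hL.continuous
  have hd : ∀ x y, |q x - q y| ≤ C * |x - y| := fun x y => by
    simpa [Real.dist_eq] using hL.dist_le_mul x y
  have hint : ∀ x, Integrable (fun s => q x - q (x - s)) μ := fun x => by
    refine (hi.norm.const_mul (C : ℝ)).mono' (by fun_prop) (Eventually.of_forall fun s => ?_)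
    simpa using hd x (x - s)
  have hint' : ∀ x, Integrable (fun s => q (x - s)) μ := fun x => by
    refine ((integrable_const (q x)).sub (hint x)).congr (Eventually.of_forall fun s => ?_)
    simp
  -- Although `q` may be unbounded, its increment `q (x + a) - q x` is bounded by `C * |a|` and
  -- invariant, hence constant in `x`. So `q` is additive, and by continuity linear.
  have hadd : ∀ a x, q (x + a) = q x + q a := by
    intro a x
    have hw := eq_of_convolution_invariant hμ (w := fun x => q (x + a) - q x) (C := C + C)
      (B := C * |a|) ((hL.comp (LipschitzWith.of_dist_le_mul (K := 1) fun x y => by simp)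
        |>.weaken (by simp)).sub hL) (fun x => by simpa using hd (x + a) x) (fun x => by
        have h1 := hq (x + a)
        have h2 := hq x
        rw [integral_sub (integrable_const _) (hint' _)] at h1 h2
        have e : ∀ s, q (x - s + a) = q (x + a - s) := fun s => by congr 1; ring
        simp_rw [e]
        rw [integral_sub (hint' _) (hint' _)]
        simp at h1 h2
        linarith) x 0
    simp only [zero_add, h0, sub_zero] at hw
    linarith
  let f : ℝ →+ ℝ := AddMonoidHom.mk' q fun x y => hadd y x
  have hlin : ∀ x, q x = x * q 1 := fun x => by
    have := map_real_smul f hqc x 1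
    simpa [f] using this
  -- For linear `q` the invariance at `0` says that the slope times the mean of `μ` is zero.
  have h1 := hq 0
  have e : ∀ s, q 0 - q (0 - s) = s * q 1 := fun s => by rw [h0, hlin (0 - s)]; ring
  simp_rw [e] at h1
  rw [integral_mul_const, hm, one_mul] at h1
  rw [hlin, h1, mul_zero]

end

/-! ### Blackwell's renewal theorem. -/

/-- A monotone function with bounded increments over steps of length `a₀` has at most linear
growth. -/
theorem Monotone.sub_le_of_step {k : ℝ → ℝ} (hk : Monotone k) {a₀ C : ℝ} (ha₀ : 0 < a₀)
    (hC : ∀ t, k (t + a₀) - k t ≤ C) (t : ℝ) {s : ℝ} (hs : 0 ≤ s) :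
    k t - k (t - s) ≤ C * (s / a₀ + 1) := by
  have hC0 : 0 ≤ C := (sub_nonneg.2 (hk (by linarith))).trans (hC 0)
  have hn : ∀ n : ℕ, k t - k (t - n * a₀) ≤ n * C := by
    intro n
    induction n with
    | zero => simp
    | succ n ih =>
      have := hC (t - (n + 1 : ℕ) * a₀)
      have e : t - (n + 1 : ℕ) * a₀ + a₀ = t - n * a₀ := by push_cast; ring
      rw [e] at this
      push_cast at *
      linarith
  have h1 : s ≤ ⌈s / a₀⌉₊ * a₀ := by
    rw [← div_le_iff₀ ha₀]; exact Nat.le_ceil _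
  have h2 : (⌈s / a₀⌉₊ : ℝ) ≤ s / a₀ + 1 := (Nat.ceil_lt_add_one (by positivity)).le
  calc k t - k (t - s) ≤ k t - k (t - ⌈s / a₀⌉₊ * a₀) := by
        have := hk (show t - ⌈s / a₀⌉₊ * a₀ ≤ t - s by linarith)
        linarith
    _ ≤ ⌈s / a₀⌉₊ * C := hn _
    _ ≤ C * (s / a₀ + 1) := by rw [mul_comm]; gcongr

section Blackwell

variable {μ : Measure ℝ} [IsProbabilityMeasure μ] {k : ℝ → ℝ} {a₀ C : ℝ}

/-- The function `k` may jump, so the compactness argument is applied to its integral over a sliding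
window. Moving the window by `h` exchanges two pieces of length `h` at distance `δ ≤ a₀`, on which
`k` differs by at most `C`. -/
theorem lipschitzWith_window (hk : Monotone k) (hC : ∀ t, k (t + a₀) - k t ≤ C)
    {δ : ℝ} (hδ : 0 < δ) (hδa : δ ≤ a₀) :
    LipschitzWith C.toNNReal fun t => ∫ v in (0 : ℝ)..δ, k (t + v) := by
  have hC0 : 0 ≤ C := (sub_nonneg.2 (hk (by linarith))).trans (hC 0)
  have hii : ∀ t a b, IntervalIntegrable (fun v => k (t + v)) volume a b := fun t a b =>
    (hk.comp fun x y h => by gcongr : Monotone fun v => k (t + v)).intervalIntegrable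
  have key : ∀ t h, 0 ≤ h → 0 ≤ (∫ v in (0 : ℝ)..δ, k (t + h + v)) - (∫ v in (0 : ℝ)..δ, k (t + v)) ∧
      (∫ v in (0 : ℝ)..δ, k (t + h + v)) - (∫ v in (0 : ℝ)..δ, k (t + v)) ≤ C * h := by
    intro t h hh
    constructor
    · rw [sub_nonneg]
      exact intervalIntegral.integral_mono_on hδ.le (hii _ _ _) (hii _ _ _)
        fun v _ => hk (by linarith)
    · have e1 : (∫ v in (0 : ℝ)..δ, k (t + h + v)) = ∫ v in h..(δ + h), k (t + v) := by
        have := intervalIntegral.integral_comp_add_right (a := 0) (b := δ)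
          (fun v => k (t + v)) h
        rw [zero_add] at this
        rw [← this]
        congr 1; ext v; congr 1; ring
      have e2 : (∫ v in (0 : ℝ)..h, k (t + (v + δ))) = ∫ v in δ..(h + δ), k (t + v) := by
        have := intervalIntegral.integral_comp_add_right (a := 0) (b := h)
          (fun v => k (t + v)) δ
        rw [zero_add] at this
        exact this
      have e3 := intervalIntegral.integral_interval_sub_interval_comm (hii t h (δ + h)) (hii t 0 δ)
        (hii t h 0)
      -- The overlap of the two windows cancels; what is left compares `[δ, δ + h]` with `[0, h]`.
      have e4 : (∫ v in h..(δ + h), k (t + v)) - (∫ v in (0 : ℝ)..δ, k (t + v)) =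
          ∫ v in (0 : ℝ)..h, (k (t + (v + δ)) - k (t + v)) := by
        rw [intervalIntegral.integral_sub _ (hii _ _ _), e2, e3,
          intervalIntegral.integral_symm 0 h, intervalIntegral.integral_symm δ (δ + h),
          add_comm δ h]
        · ring
        · exact (hk.comp fun x y h => by gcongr :
            Monotone fun v => k (t + (v + δ))).intervalIntegrable
      rw [e1, e4]
      calc _ ≤ ∫ v in (0 : ℝ)..h, C := by
            refine intervalIntegral.integral_mono_on hh (IntervalIntegrable.sub ?_ (hii _ _ _))
              (by simp) fun v _ => ?_
            · exact (hk.comp fun x y h => by gcongr :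
                Monotone fun v => k (t + (v + δ))).intervalIntegrable
            · refine le_trans ?_ (hC (t + v))
              have := hk (show t + (v + δ) ≤ t + v + a₀ by linarith)
              linarith
        _ = C * h := by simp [mul_comm]
  refine LipschitzWith.of_dist_le_mul fun x y => ?_
  rw [Real.dist_eq, Real.dist_eq, Real.coe_toNNReal _ hC0]
  rcases le_total x y with hxy | hxy
  · have := key x (y - x) (by linarith)
    rw [add_sub_cancel] at this
    rw [abs_sub_comm, abs_of_nonneg this.1, abs_sub_comm, abs_of_nonneg (by linarith)]
    exact this.2
  · have := key y (x - y) (by linarith)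
    rw [add_sub_cancel] at this
    rw [abs_of_nonneg this.1, abs_of_nonneg (by linarith)]
    exact this.2

/-- By Fubini the smoothed expression is the window integral of the original one. The linear growth
bound `Monotone.sub_le_of_step` and the finite mean of `μ` provide a dominating function for both
the exchange and the limit. -/
theorem tendsto_integral_window_sub (hi : Integrable (fun s => s) μ)
    (h0 : ∀ᵐ s ∂μ, 0 ≤ s) (hk : Monotone k) (ha₀ : 0 < a₀)
    (hC : ∀ t, k (t + a₀) - k t ≤ C)
    (hlim : Tendsto (fun t => ∫ s, (k t - k (t - s)) ∂μ) atTop (𝓝 1))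
    {δ : ℝ} (hδ : 0 < δ) :
    Tendsto (fun t => ∫ s, ((∫ v in (0 : ℝ)..δ, k (t + v)) - ∫ v in (0 : ℝ)..δ, k (t - s + v)) ∂μ)
      atTop (𝓝 δ) := by
  have hkm := hk.measurable
  have hii : ∀ t a b, IntervalIntegrable (fun v => k (t + v)) volume a b := fun t a b =>
    (hk.comp fun x y h => by gcongr : Monotone fun v => k (t + v)).intervalIntegrable
  have hb : ∀ᵐ s ∂μ, ∀ t, ‖k t - k (t - s)‖ ≤ C * (s / a₀ + 1) := by
    filter_upwards [h0] with s hs t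
    rw [Real.norm_of_nonneg (sub_nonneg.2 (hk (by linarith)))]
    exact hk.sub_le_of_step ha₀ hC t hs
  have hbi : Integrable (fun s => C * (s / a₀ + 1)) μ :=
    ((hi.div_const _).add (integrable_const _)).const_mul _
  have hswap : ∀ t, ∫ s, ((∫ v in (0 : ℝ)..δ, k (t + v)) - ∫ v in (0 : ℝ)..δ, k (t - s + v)) ∂μ =
      ∫ v in (0 : ℝ)..δ, ∫ s, (k (t + v) - k (t + v - s)) ∂μ := by
    intro t
    have e : ∫ v in (0 : ℝ)..δ, ∫ s, (k (t + v) - k (t + v - s)) ∂μ =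
        ∫ v in Ioc 0 δ, ∫ s, (k (t + v) - k (t + v - s)) ∂μ :=
      intervalIntegral.integral_of_le hδ.le
    rw [e, integral_integral_swap]
    · congr 1; ext s
      rw [← intervalIntegral.integral_of_le hδ.le, ← intervalIntegral.integral_sub (hii _ _ _)
        (hii _ _ _)]
      congr 1; ext v; congr 2; ring
    · refine (hbi.comp_snd (volume.restrict (Ioc 0 δ))).mono' ?_ ?_
      · exact Measurable.aestronglyMeasurable (by fun_prop)
      · have : ∀ᵐ p ∂(volume.restrict (Ioc 0 δ)).prod μ, ∀ t, ‖k t - k (t - p.2)‖ ≤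
            C * (p.2 / a₀ + 1) := Measure.quasiMeasurePreserving_snd.ae hb
        filter_upwards [this] with p hp
        exact hp _
  simp_rw [hswap]
  have hconst : ∫ v in (0 : ℝ)..δ, (1 : ℝ) = δ := by simp
  nth_rewrite 2 [← hconst]
  refine intervalIntegral.tendsto_integral_filter_of_dominated_convergence
    (fun _ => ∫ s, C * (s / a₀ + 1) ∂μ) (Eventually.of_forall fun t => ?_)
    (Eventually.of_forall fun t => Eventually.of_forall fun v _ => ?_) (by simp)
    (Eventually.of_forall fun v _ => ?_)
  · refine StronglyMeasurable.aestronglyMeasurable ?_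
    refine StronglyMeasurable.integral_prod_right (f := fun v s => k (t + v) - k (t + v - s)) ?_
    exact Measurable.stronglyMeasurable (by fun_prop)
  · exact norm_integral_le_of_norm_le hbi (hb.mono fun s hs => hs _)
  · exact hlim.comp (tendsto_atTop_add_const_right _ v tendsto_id)

/-- Any subsequential limit `p` of `P (t + ·) - P t`, where `P` is the window integral, satisfies `p
- p * μ = δ` and `p 0 = 0`. The function `δ * x` solves the same equation since `μ` has mean `1`, so
the difference is invariant and vanishes. The limit is thus independent of the subsequence. -/
theorem tendsto_window_increment (hμ : μ ≪ volume) (hi : Integrable (fun s => s) μ)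
    (h0 : ∀ᵐ s ∂μ, 0 ≤ s) (hm : ∫ s, s ∂μ = 1) (hk : Monotone k) (ha₀ : 0 < a₀)
    (hC : ∀ t, k (t + a₀) - k t ≤ C)
    (hlim : Tendsto (fun t => ∫ s, (k t - k (t - s)) ∂μ) atTop (𝓝 1))
    {δ : ℝ} (hδ : 0 < δ) (hδa : δ ≤ a₀) (a : ℝ) :
    Tendsto (fun t => (∫ v in (0 : ℝ)..δ, k (t + a + v)) - ∫ v in (0 : ℝ)..δ, k (t + v))
      atTop (𝓝 (δ * a)) := by
  set P : ℝ → ℝ := fun t => ∫ v in (0 : ℝ)..δ, k (t + v) with hP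
  have hPL : LipschitzWith C.toNNReal P := lipschitzWith_window hk hC hδ hδa
  have hPlim : Tendsto (fun t => ∫ s, (P t - P (t - s)) ∂μ) atTop (𝓝 δ) :=
    tendsto_integral_window_sub hi h0 hk ha₀ hC hlim hδ
  refine tendsto_of_subseq_tendsto fun t ht => ?_
  obtain ⟨φ, hφ, p, hpL, hp⟩ := exists_subseq_tendsto_of_lipschitzWith (C := C.toNNReal) (B := 0)
    (f := fun n x => P (t n + x) - P (t n))
    (fun n => LipschitzWith.of_dist_le_mul fun z z' => by
      simpa [dist_add_left] using hPL.dist_le_mul (t n + z) (t n + z')) (fun n => by simp)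
  refine ⟨φ, ?_⟩
  have htφ : Tendsto (fun n => t (φ n)) atTop atTop := ht.comp hφ.tendsto_atTop
  have hp0 : p 0 = 0 := tendsto_nhds_unique (hp 0) (by simp)
  have hPd : ∀ x y, |P x - P y| ≤ C.toNNReal * |x - y| := fun x y => by
    simpa [Real.dist_eq] using hPL.dist_le_mul x y
  have hpd : ∀ x y, |p x - p y| ≤ C.toNNReal * |x - y| := fun x y => by
    simpa [Real.dist_eq] using hpL.dist_le_mul x y
  have hPc := hPL.continuous
  have hpc := hpL.continuous
  have heq : ∀ x, ∫ s, (p x - p (x - s)) ∂μ = δ := fun x => by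
    refine tendsto_nhds_unique (tendsto_integral_of_dominated_convergence
      (fun s => C.toNNReal * ‖s‖)
      (F := fun n s => P (t (φ n) + x) - P (t (φ n) + (x - s)))
      (fun n => by fun_prop) (hi.norm.const_mul _)
      (fun n => Eventually.of_forall fun s => ?_)
      (Eventually.of_forall fun s => ?_)) ?_
    · simpa using hPd (t (φ n) + x) (t (φ n) + (x - s))
    · simpa using (hp x).sub (hp (x - s))
    · have := hPlim.comp (tendsto_atTop_add_const_right _ x htφ)
      simpa [Function.comp_def, add_sub_assoc] using this
  have hpi : ∀ x, Integrable (fun s => p x - p (x - s)) μ := fun x => by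
    refine (hi.norm.const_mul (C.toNNReal : ℝ)).mono' (by fun_prop)
      (Eventually.of_forall fun s => ?_)
    simpa using hpd x (x - s)
  have hq := eq_zero_of_convolution_invariant hμ hi hm (q := fun x => p x - δ * x)
    (C := C.toNNReal + δ.toNNReal)
    (hpL.sub (LipschitzWith.of_dist_le_mul fun x y => by
      rw [Real.dist_eq, Real.dist_eq, ← mul_sub, abs_mul, abs_of_pos hδ,
        Real.coe_toNNReal _ hδ.le]))
    (by simp [hp0]) (fun x => by
      have e : ∀ s, p x - δ * x - (p (x - s) - δ * (x - s)) = (p x - p (x - s)) - δ * s :=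
        fun s => by ring
      simp_rw [e]
      rw [integral_sub (hpi x) (hi.const_mul δ), heq, integral_const_mul, hm]
      ring) a
  have : p a = δ * a := by linarith
  rw [← this]
  exact hp a

/-- **Blackwell's renewal theorem**, for solutions of a renewal equation. -/
theorem tendsto_increment (hμ : μ ≪ volume) (hi : Integrable (fun s => s) μ)
    (h0 : ∀ᵐ s ∂μ, 0 ≤ s) (hm : ∫ s, s ∂μ = 1) (hk : Monotone k) (ha₀ : 0 < a₀)
    (hC : ∀ t, k (t + a₀) - k t ≤ C)
    (hlim : Tendsto (fun t => ∫ s, (k t - k (t - s)) ∂μ) atTop (𝓝 1)) (a : ℝ) :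
    Tendsto (fun t => k (t + a) - k t) atTop (𝓝 a) := by
  have hii : ∀ t a b, IntervalIntegrable (fun v => k (t + v)) volume a b := fun t a b =>
    (hk.comp fun x y h => by gcongr : Monotone fun v => k (t + v)).intervalIntegrable
  refine tendsto_order.2 ⟨fun b hb => ?_, fun b hb => ?_⟩
  all_goals
    -- By monotonicity `δ * k t ≤ ∫ v in 0..δ, k (t + v) ≤ δ * k (t + δ)`. Undoing the smoothing
    -- therefore costs a shift of `a` by `δ`, which is affordable when `δ < |b - a|`.
    obtain ⟨δ, hδ, hδa, hδb⟩ : ∃ δ, 0 < δ ∧ δ ≤ a₀ ∧ δ < |b - a| :=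
      ⟨min a₀ (|b - a| / 2), lt_min ha₀ (half_pos (abs_pos.2 (sub_ne_zero.2 (by
        first | exact hb.ne | exact hb.ne')))), min_le_left _ _,
        (min_le_right _ _).trans_lt (half_lt_self (abs_pos.2 (sub_ne_zero.2 (by
        first | exact hb.ne | exact hb.ne'))))⟩
    have hup : ∀ t, ∫ v in (0 : ℝ)..δ, k (t + v) ≤ δ * k (t + δ) := fun t => by
      have := intervalIntegral.integral_mono_on hδ.le (hii t 0 δ)
        (intervalIntegrable_const (c := k (t + δ))) (fun v hv => hk (by linarith [hv.2]))
      simpa using this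
    have hlo : ∀ t, δ * k t ≤ ∫ v in (0 : ℝ)..δ, k (t + v) := fun t => by
      have := intervalIntegral.integral_mono_on hδ.le
        (intervalIntegrable_const (c := k t)) (hii t 0 δ) (fun v hv => hk (by linarith [hv.1]))
      simpa using this
  · rw [abs_of_neg (by linarith)] at hδb
    have h1 := tendsto_window_increment hμ hi h0 hm hk ha₀ hC hlim hδ hδa (a - δ)
    have h2 := (tendsto_order.1 h1).1 (δ * b) (by gcongr; linarith)
    filter_upwards [h2] with t ht
    have h3 := hup (t + (a - δ))
    have h4 := hlo t
    rw [show t + (a - δ) + δ = t + a by ring] at h3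
    have : δ * b < δ * (k (t + a) - k t) := by linarith
    exact lt_of_mul_lt_mul_left this hδ.le
  · rw [abs_of_pos (by linarith)] at hδb
    have h1 := (tendsto_window_increment hμ hi h0 hm hk ha₀ hC hlim hδ hδa (a + δ)).comp
      (tendsto_atTop_add_const_right _ (-δ) tendsto_id)
    have h2 := (tendsto_order.1 h1).2 (δ * b) (by gcongr; linarith)
    filter_upwards [h2] with t ht
    simp only [Function.comp, id] at ht
    have h3 := hlo (t + a)
    have h4 := hup (t + -δ)
    rw [show t + -δ + (a + δ) = t + a by ring] at ht
    rw [show t + -δ + δ = t by ring] at h4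
    have : δ * (k (t + a) - k t) < δ * b := by linarith
    exact lt_of_mul_lt_mul_left this hδ.le

end Blackwell

/-! ### Uniqueness for the renewal inequality. -/

/-- A bounded nonnegative function which is dominated on `[0,T]` by its convolution with an
absolutely continuous probability measure on `[0,∞)` vanishes there. -/
theorem eq_zero_of_le_convolution {μ : Measure ℝ} [IsProbabilityMeasure μ] (hμ : μ ≪ volume)
    (h0 : ∀ᵐ s ∂μ, 0 ≤ s) {Q : ℝ → ℝ} {T B : ℝ}
    (hQ0 : ∀ t, 0 ≤ Q t) (hQB : ∀ t, t ≤ T → Q t ≤ B) (hQneg : ∀ t, t < 0 → Q t = 0)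
    (hQ : ∀ t, 0 ≤ t → t ≤ T → Q t ≤ ∫ s, Q (t - s) ∂μ) {t : ℝ} (ht : t ≤ T) : Q t = 0 := by
  -- With the weight `exp (-t)`, convolution becomes a contraction for the supremum norm, with
  -- factor `ρ = ∫ exp (-s) dμ`.
  set A : Set ℝ := (fun t => Real.exp (-t) * Q t) '' Iic T with hA
  have hR : ∀ t, t ≤ T → Real.exp (-t) * Q t ≤ B := fun t ht => by
    rcases lt_or_ge t 0 with h | h
    · rw [hQneg t h, mul_zero]; exact (hQ0 t).trans (hQB t ht)
    · calc _ ≤ 1 * Q t := by gcongr; exact hQ0 t; simpa using h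
        _ ≤ B := by rw [one_mul]; exact hQB t ht
  have hbdd : BddAbove A := ⟨B, by rintro _ ⟨t, ht, rfl⟩; exact hR t ht⟩
  set S := sSup A with hS
  have hle : ∀ t, t ≤ T → Real.exp (-t) * Q t ≤ S := fun t ht => le_csSup hbdd ⟨t, ht, rfl⟩
  have hS0 : 0 ≤ S := (by have := hQ0 T; positivity : 0 ≤ Real.exp (-T) * Q T).trans (hle T le_rfl)
  set ρ := ∫ s, Real.exp (-s) ∂μ with hρ
  have hei : Integrable (fun s => Real.exp (-s)) μ :=
    Integrable.of_bound (by fun_prop) 1 (h0.mono fun s hs => by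
      rw [Real.norm_of_nonneg (Real.exp_pos _).le]; simpa using hs)
  -- Equality would force `μ` to sit at `0`, but an absolutely continuous measure has no atom.
  have hρ1 : ρ < 1 := by
    by_contra hge
    have hnn : ∀ᵐ s ∂μ, 0 ≤ 1 - Real.exp (-s) := h0.mono fun s hs => by simpa using hs
    have h1 : ∫ s, (1 - Real.exp (-s)) ∂μ = 0 := by
      refine le_antisymm ?_ (integral_nonneg_of_ae hnn)
      rw [integral_sub (integrable_const _) hei]
      simp only [integral_const, probReal_univ, smul_eq_mul, mul_one]
      linarith
    have h2 := (integral_eq_zero_iff_of_nonneg_ae hnn ((integrable_const 1).sub hei)).1 h1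
    have h3 : ∀ᵐ s ∂μ, s ≠ 0 := hμ.ae_le (compl_mem_ae_iff.2 (measure_singleton 0))
    have h4 : ∀ᵐ s ∂μ, False := by
      filter_upwards [h0, h2, h3] with s a b c
      have : Real.exp (-s) < 1 := by
        rw [Real.exp_lt_one_iff]; exact neg_lt_zero.2 (lt_of_le_of_ne a c.symm)
      simp only [Pi.zero_apply] at b
      linarith
    simp at h4
    exact IsProbabilityMeasure.ne_zero μ h4
  have hkey : ∀ t, t ≤ T → Real.exp (-t) * Q t ≤ ρ * S := by
    intro t ht
    rcases lt_or_ge t 0 with h | h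
    · rw [hQneg t h, mul_zero]
      exact mul_nonneg (integral_nonneg fun s => (Real.exp_pos _).le) hS0
    calc Real.exp (-t) * Q t ≤ Real.exp (-t) * ∫ s, Q (t - s) ∂μ := by gcongr; exact hQ t h ht
      _ = ∫ s, Real.exp (-s) * (Real.exp (-(t - s)) * Q (t - s)) ∂μ := by
          rw [← integral_const_mul]
          congr 1; ext s
          rw [← mul_assoc, ← Real.exp_add]; congr 2; ring
      _ ≤ ∫ s, Real.exp (-s) * S ∂μ := by
          refine integral_mono_of_nonneg (Eventually.of_forall fun s => ?_) (hei.mul_const _)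
            (h0.mono fun s hs => ?_)
          · have := hQ0 (t - s); simp only [Pi.zero_apply]; positivity
          · simp only
            gcongr
            exact hle _ (by linarith)
      _ = ρ * S := integral_mul_const _ _
  have hSle : S ≤ ρ * S := csSup_le ⟨_, T, mem_Iic.2 le_rfl, rfl⟩ (by
    rintro _ ⟨t, ht, rfl⟩; exact hkey t ht)
  have hSz : S = 0 := by nlinarith
  have h1 := hle t ht
  rw [hSz] at h1
  have h2 := Real.exp_pos (-t)
  have h3 := hQ0 t
  nlinarith

/-! ### The service law, its survival function and its hazard rate on the whole line. -/

section

/-- The law on `[0,∞)` with density `g`. -/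
noncomputable def serviceLaw (g : ℝ → ℝ) : Measure ℝ :=
  (volume.restrict (Ici 0)).withDensity fun x => ENNReal.ofReal (g x)

/-- The survival function `1 - G`, extended by `1` to the negative half-line. -/
noncomputable def survival (g : ℝ → ℝ) (x : ℝ) : ℝ := (serviceLaw g).real (Ioi x)

/-- The hazard rate, in a version which is measurable on the line. -/
noncomputable def hazard (g : ℝ → ℝ) (x : ℝ) : ℝ := g x / survival g x

namespace IsServiceDensity

variable {g : ℝ → ℝ} (hg : IsServiceDensity g)

theorem serviceLaw_absolutelyContinuous (g : ℝ → ℝ) : serviceLaw g ≪ volume :=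
  (withDensity_absolutelyContinuous _ _).trans Measure.absolutelyContinuous_restrict

theorem ae_nonneg (g : ℝ → ℝ) : ∀ᵐ s ∂(serviceLaw g), 0 ≤ s :=
  (withDensity_absolutelyContinuous _ _).ae_le
    ((ae_restrict_iff' measurableSet_Ici).2 (ae_of_all _ fun _ hx => hx))

theorem survival_nonneg (g : ℝ → ℝ) (x : ℝ) : 0 ≤ survival g x := measureReal_nonneg

theorem measurableSet_ageSet (g : ℝ → ℝ) : MeasurableSet (ageSet g) :=
  measurableSet_Ici.inter (measurable_coe_real_ereal measurableSet_Iio)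

include hg

theorem lintegral_serviceLaw {f : ℝ → ENNReal} (hf : Measurable f) :
    ∫⁻ x, f x ∂(serviceLaw g) = ∫⁻ x in Ici 0, ENNReal.ofReal (g x) * f x :=
  lintegral_withDensity_eq_lintegral_mul _ hg.measurable.ennreal_ofReal hf

theorem integral_serviceLaw (f : ℝ → ℝ) :
    ∫ x, f x ∂(serviceLaw g) = ∫ x in Ici 0, g x * f x := by
  rw [serviceLaw, integral_withDensity_eq_integral_toReal_smul hg.measurable.ennreal_ofReal
    (ae_of_all _ fun _ => ENNReal.ofReal_lt_top)]
  refine setIntegral_congr_fun measurableSet_Ici fun x hx => ?_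
  simp [ENNReal.toReal_ofReal (hg.nonneg x hx)]

theorem integrable_serviceLaw_iff {f : ℝ → ℝ} :
    Integrable f (serviceLaw g) ↔ IntegrableOn (fun x => g x * f x) (Ici 0) := by
  rw [serviceLaw, integrable_withDensity_iff_integrable_smul' hg.measurable.ennreal_ofReal
    (ae_of_all _ fun _ => ENNReal.ofReal_lt_top)]
  refine integrable_congr ((ae_restrict_iff' measurableSet_Ici).2 (ae_of_all _ fun x hx => ?_))
  simp [ENNReal.toReal_ofReal (hg.nonneg x hx)]

theorem serviceLaw_apply {x : ℝ} (hx : 0 ≤ x) :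
    serviceLaw g (Ioi x) = ENNReal.ofReal (1 - serviceCDF g x) := by
  have hs : (Ioi x) ∩ Ici 0 = Ioi x := inter_eq_left.2 fun y hy => hx.trans (le_of_lt hy)
  rw [hg.one_sub_cdf hx, serviceLaw, withDensity_apply _ measurableSet_Ioi,
    Measure.restrict_restrict measurableSet_Ioi, hs]
  refine (ofReal_integral_eq_lintegral_ofReal
    (hg.integrable.mono_set fun y hy => hx.trans (le_of_lt hy)) ?_).symm
  exact (ae_restrict_iff' measurableSet_Ioi).2
    (ae_of_all _ fun y hy => hg.nonneg y (hx.trans (le_of_lt hy)))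

theorem isProbabilityMeasure : IsProbabilityMeasure (serviceLaw g) := by
  constructor
  have h1 : ∫⁻ x, (1 : ENNReal) ∂(serviceLaw g) = 1 := by
    rw [hg.lintegral_serviceLaw measurable_const]
    simp only [mul_one]
    rw [← ofReal_integral_eq_lintegral_ofReal hg.integrable
      ((ae_restrict_iff' measurableSet_Ici).2 (ae_of_all _ fun y hy => hg.nonneg y hy)),
      hg.total_mass, ENNReal.ofReal_one]
  simpa using h1

theorem integrable_id_serviceLaw : Integrable (fun s => s) (serviceLaw g) := by
  rw [hg.integrable_serviceLaw_iff]
  exact hg.integrable_mean.congr_fun (fun x _ => mul_comm _ _) measurableSet_Ici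

theorem integral_id_serviceLaw : ∫ s, s ∂(serviceLaw g) = 1 := by
  rw [hg.integral_serviceLaw, ← hg.mean_one]
  simp_rw [mul_comm]

theorem survival_eq {x : ℝ} (hx : 0 ≤ x) : survival g x = 1 - serviceCDF g x := by
  rw [survival, Measure.real, hg.serviceLaw_apply hx, ENNReal.toReal_ofReal]
  rw [hg.one_sub_cdf hx]
  exact setIntegral_nonneg measurableSet_Ioi fun y hy => hg.nonneg y (hx.trans (le_of_lt hy))

theorem survival_of_nonpos {x : ℝ} (hx : x ≤ 0) : survival g x = 1 := by
  have := hg.isProbabilityMeasure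
  rcases hx.eq_or_lt with rfl | hx
  · rw [hg.survival_eq le_rfl, serviceCDF, intervalIntegral.integral_same, sub_zero]
  · have h1 : Ioi x ∈ ae (serviceLaw g) := by
      filter_upwards [ae_nonneg g] with s hs
      exact lt_of_lt_of_le hx hs
    rw [survival, Measure.real, (mem_ae_iff_prob_eq_one measurableSet_Ioi).1 h1,
      ENNReal.toReal_one]

theorem survival_antitone : Antitone (survival g) := fun x y hxy => by
  have := hg.isProbabilityMeasure
  exact measureReal_mono (Ioi_subset_Ioi hxy)

theorem survival_le_one (x : ℝ) : survival g x ≤ 1 := by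
  have := hg.isProbabilityMeasure
  exact measureReal_le_one

theorem continuous_survival : Continuous (survival g) := by
  have hm : Integrable ((Ici (0 : ℝ)).indicator g) :=
    (integrable_indicator_iff measurableSet_Ici).2 hg.integrable
  have h : survival g = fun x => 1 - ∫ y in (0 : ℝ)..x, (Ici (0 : ℝ)).indicator g y := by
    ext x
    rcases le_total 0 x with hx | hx
    · rw [hg.survival_eq hx, serviceCDF]
      congr 1
      refine intervalIntegral.integral_congr fun y hy => ?_
      rw [uIcc_of_le hx] at hy
      simp [hy.1]
    · rw [hg.survival_of_nonpos hx, intervalIntegral.integral_symm,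
        intervalIntegral.integral_of_le hx, setIntegral_indicator measurableSet_Ici]
      have : (Ioc x 0 ∩ Ici 0 : Set ℝ) ⊆ {0} := fun y hy => le_antisymm hy.1.2 hy.2
      rw [setIntegral_measure_zero _ (measure_mono_null this (measure_singleton 0))]
      simp
  rw [h]
  exact continuous_const.sub (intervalIntegral.continuous_primitive (fun _ _ => hm.intervalIntegrable) 0)

/-- Continuity of `survival g` supplies the strict inequality: positivity at `x` persists slightly
to the right of `x`, and this exhibits a larger point below the endpoint. -/
theorem lt_endpoint_iff (x : ℝ) : (x : EReal) < serviceEndpoint g ↔ 0 < survival g x := by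
  constructor
  · intro h
    obtain ⟨_, ⟨y, ⟨hy0, hy1⟩, rfl⟩, hxy⟩ := lt_sSup_iff.1 h
    have h1 : 0 < survival g y := by rw [hg.survival_eq hy0]; linarith
    exact h1.trans_le (hg.survival_antitone (EReal.coe_lt_coe_iff.1 hxy).le)
  · intro h
    have h1 : ∀ᶠ y in 𝓝[>] x, 0 < survival g y :=
      (hg.continuous_survival.continuousAt.eventually (lt_mem_nhds h)).filter_mono
        nhdsWithin_le_nhds
    obtain ⟨y, hy1, hy2⟩ := (h1.and self_mem_nhdsWithin).exists
    refine lt_sSup_iff.2 ⟨((max y 0 : ℝ) : EReal), ⟨_, ⟨le_max_right _ _, ?_⟩, rfl⟩,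
      EReal.coe_lt_coe_iff.2 (lt_max_of_lt_left hy2)⟩
    have h2 : 0 < survival g (max y 0) := by
      rcases le_total y 0 with h | h
      · rw [max_eq_right h, hg.survival_of_nonpos le_rfl]; exact one_pos
      · rwa [max_eq_left h]
    rw [hg.survival_eq (le_max_right _ _)] at h2
    linarith

theorem mem_ageSet_iff (x : ℝ) : x ∈ ageSet g ↔ 0 ≤ x ∧ 0 < survival g x := by
  rw [ageSet, mem_ofPred_eq, hg.lt_endpoint_iff]

theorem hazard_eq {x : ℝ} (hx : 0 ≤ x) : hazardRate g x = hazard g x := by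
  rw [hazardRate, hazard, hg.survival_eq hx]

theorem measurable_hazard : Measurable (hazard g) :=
  hg.measurable.div hg.continuous_survival.measurable

theorem hazard_nonneg {x : ℝ} (hx : 0 ≤ x) : 0 ≤ hazard g x :=
  div_nonneg (hg.nonneg x hx) (survival_nonneg g x)

/-- The mass that the density puts on an interval. -/
theorem lintegral_Ioc_density {x t : ℝ} (hx : 0 ≤ x) (ht : 0 ≤ t) :
    ∫⁻ s in Ioc 0 t, ENNReal.ofReal (g (x + s)) =
      ENNReal.ofReal (survival g x - survival g (x + t)) := by
  have := hg.isProbabilityMeasure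
  have h1 : ∫⁻ s in Ioc 0 t, ENNReal.ofReal (g (x + s)) =
      ∫⁻ s in Ioc x (x + t), ENNReal.ofReal (g s) := by
    have hp : MeasurePreserving (fun s : ℝ => x + s) volume volume :=
      measurePreserving_add_left volume x
    have := hp.setLIntegral_comp_preimage_emb (measurableEmbedding_addLeft x)
      (fun s => ENNReal.ofReal (g s)) (Ioc x (x + t))
    rw [← this]
    congr 2
    simp
  have h2 : serviceLaw g (Ioc x (x + t)) = ∫⁻ s in Ioc x (x + t), ENNReal.ofReal (g s) := by
    have hs : Ioc x (x + t) ∩ Ici 0 = Ioc x (x + t) := inter_eq_left.2 fun y hy => hx.trans hy.1.le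
    rw [serviceLaw, withDensity_apply _ measurableSet_Ioc,
      Measure.restrict_restrict measurableSet_Ioc, hs]
  rw [h1, ← h2, survival, survival, ← measureReal_sdiff (Ioi_subset_Ioi (by linarith))
    measurableSet_Ioi, ofReal_measureReal]
  congr 1
  ext y
  simp

end IsServiceDensity

end

/-! ### Comparison of measures by test functions, and measurability of right-continuous curves. -/

section

open scoped Manifold in
/-- Two finite measures on the line can be compared on an open set by testing against
nonnegative `C¹` functions with compact support in this set. -/
theorem Measure.apply_le_of_forall_integral_le {μ ρ : Measure ℝ} [IsFiniteMeasure μ]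
    [IsFiniteMeasure ρ] {O : Set ℝ} (hO : IsOpen O)
    (h : ∀ F : ℝ → ℝ, ContDiff ℝ 1 F → HasCompactSupport F → tsupport F ⊆ O → (∀ x, 0 ≤ F x) →
      ∫ x, F x ∂μ ≤ ∫ x, F x ∂ρ) {E : Set ℝ} (hE : E ⊆ O) : μ E ≤ ρ E := by
  -- On open sets inner regularity reduces the comparison to a compact `K ⊆ U`, separated from the
  -- complement of `U` by a smooth bump; outer regularity of `ρ` then passes to arbitrary sets.
  have hopen : ∀ U, IsOpen U → U ⊆ O → μ U ≤ ρ U := by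
    intro U hU hUO
    rw [hU.measure_eq_iSup_isCompact]
    refine iSup₂_le fun K hKU => iSup_le fun hK => ?_
    obtain ⟨L, hL, hKL, hLU⟩ := exists_compact_between hK hU hKU
    obtain ⟨f, hf1, hf0, hf⟩ := exists_contMDiffMap_one_nhds_of_subset_interior
      (n := 1) 𝓘(ℝ, ℝ) hK.isClosed hKL
    have hfd : ContDiff ℝ 1 f := by simpa using f.contMDiff.contDiff
    have hfs : HasCompactSupport f := HasCompactSupport.intro hL fun x hx => hf0 x hx
    have hft : tsupport f ⊆ L :=
      closure_minimal (fun x hx => by_contra fun hxL => hx (hf0 x hxL)) hL.isClosed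
    have hint := h f hfd hfs (hft.trans (hLU.trans hUO)) fun x => (hf x).1
    have hfi : ∀ (m : Measure ℝ) [IsFiniteMeasure m], Integrable f m := fun m _ =>
      Integrable.of_bound hfd.continuous.aestronglyMeasurable 1
        (Eventually.of_forall fun x => by
          rw [Real.norm_of_nonneg (hf x).1]; exact (hf x).2)
    have h1 : μ.real K ≤ ∫ x, f x ∂μ := by
      rw [← integral_indicator_one hK.measurableSet]
      refine integral_mono ((integrable_indicator_iff hK.measurableSet).2
        (integrable_const _).integrableOn) (hfi μ) fun x => ?_
      by_cases hx : x ∈ K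
      · simp [hx, (Filter.Eventually.self_of_nhdsSet hf1 x hx)]
      · simpa [hx] using (hf x).1
    have h2 : ∫ x, f x ∂ρ ≤ ρ.real U := by
      rw [← integral_indicator_one hU.measurableSet]
      refine integral_mono (hfi ρ) ((integrable_indicator_iff hU.measurableSet).2
        (integrable_const _).integrableOn) fun x => ?_
      by_cases hx : x ∈ U
      · simpa [hx] using (hf x).2
      · have : x ∉ L := fun hxL => hx (hLU hxL)
        simp [hx, hf0 x this]
    exact (ENNReal.toReal_le_toReal (by finiteness) (by finiteness)).1 (h1.trans (hint.trans h2))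
  rw [E.measure_eq_iInf_isOpen ρ]
  refine le_iInf₂ fun U hEU => le_iInf fun hU => ?_
  calc μ E ≤ μ (U ∩ O) := measure_mono (subset_inter hEU hE)
    _ ≤ ρ (U ∩ O) := hopen _ (hU.inter hO) inter_subset_right
    _ ≤ ρ U := measure_mono inter_subset_left

/-- A right-continuous function on the line is Borel measurable. -/
theorem measurable_of_rightContinuous {β : Type*} [TopologicalSpace β]
    [TopologicalSpace.PseudoMetrizableSpace β] [MeasurableSpace β] [BorelSpace β] {f : ℝ → β}
    (hf : ∀ t, ContinuousWithinAt f (Ici t) t) : Measurable f := by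
  -- The approximating step functions evaluate `f` at the next grid point to the right, so
  -- right-continuity is enough for convergence.
  refine measurable_of_tendsto_metrizable
    (f := fun (n : ℕ) t => f ((⌈((n : ℝ) + 1) * t⌉ : ℝ) / ((n : ℝ) + 1))) (fun n => ?_) ?_
  · exact (measurable_from_top (f := fun m : ℤ => f ((m : ℝ) / ((n : ℝ) + 1)))).comp
      (Int.measurable_ceil.comp (measurable_const.mul measurable_id))
  · rw [tendsto_pi_nhds]
    intro t
    refine (hf t).tendsto.comp (tendsto_nhdsWithin_iff.2 ⟨?_, Eventually.of_forall fun n => ?_⟩)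
    · have h1 : Tendsto (fun n : ℕ => t + 1 / ((n : ℝ) + 1)) atTop (𝓝 (t + 0)) :=
        tendsto_const_nhds.add tendsto_one_div_add_atTop_nhds_zero_nat
      rw [add_zero] at h1
      refine tendsto_of_tendsto_of_tendsto_of_le_of_le tendsto_const_nhds h1
        (fun n => ?_) fun n => ?_
      · simp only
        rw [le_div_iff₀ (by positivity), mul_comm]
        exact Int.le_ceil _
      · simp only
        rw [div_le_iff₀ (by positivity)]
        have := (Int.ceil_lt_add_one (((n : ℝ) + 1) * t)).le
        have h2 : ((n : ℝ) + 1) ≠ 0 := by positivity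
        have e : (t + 1 / ((n : ℝ) + 1)) * ((n : ℝ) + 1) = ((n : ℝ) + 1) * t + 1 := by
          field_simp
        rw [e]; exact this
    · rw [mem_Ici, le_div_iff₀ (by positivity), mul_comm]
      exact Int.le_ceil _

/-- A weakly right-continuous curve of finite measures is a measurable family. -/
theorem FiniteMeasure.measurable_of_rightContinuous {Ω : Type*} [PseudoEMetricSpace Ω]
    [MeasurableSpace Ω] [BorelSpace Ω] {ν : ℝ → FiniteMeasure Ω}
    (hν : ∀ t, ContinuousWithinAt ν (Ici t) t) : Measurable fun t => (ν t : Measure Ω) := by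
  have hF : ∀ F : Set Ω, IsClosed F → Measurable fun t => (ν t : Measure Ω) F := by
    intro F hF
    have hpos : ∀ n : ℕ, (0 : ℝ) < 1 / ((n : ℝ) + 1) := fun n => by positivity
    refine measurable_of_tendsto_metrizable (f := fun (n : ℕ) t =>
      ∫⁻ ω, (thickenedIndicator (hpos n) F ω : ENNReal) ∂(ν t : Measure Ω)) (fun n => ?_) ?_
    · refine _root_.measurable_of_rightContinuous fun t => ?_
      exact FiniteMeasure.tendsto_iff_forall_lintegral_tendsto.1 (hν t) _
    · rw [tendsto_pi_nhds]
      exact fun t => tendsto_lintegral_thickenedIndicator_of_isClosed _ hF hpos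
        tendsto_one_div_add_atTop_nhds_zero_nat
  -- Closed sets form a generating π-system, and the mass of each is a limit of integrals of bounded
  -- continuous functions, which are right-continuous in time.
  refine Measurable.measure_of_isPiSystem (S := {F | IsClosed F}) ?_ isPiSystem_isClosed
    (fun F h => hF F h) (hF _ isClosed_univ)
  rw [‹BorelSpace Ω›.measurable_eq, borel_eq_generateFrom_isClosed]

end

/-! ### The transport equation along characteristics. -/

section Transport

variable {g : ℝ → ℝ}

/-- The age distribution at time `s ∨ 0`, as a measure on the line. -/
noncomputable def lineMeasure (ν : ℝ → FiniteMeasure (AgeSpace g)) (s : ℝ) : Measure ℝ :=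
  (ν (max s 0) : Measure (AgeSpace g)).map fun x : AgeSpace g => (x : ℝ)

theorem measurableEmbedding_ageSpace (g : ℝ → ℝ) :
    MeasurableEmbedding (fun x : AgeSpace g => (x : ℝ)) :=
  MeasurableEmbedding.subtype_coe (IsServiceDensity.measurableSet_ageSet g)

theorem integral_lineMeasure (ν : ℝ → FiniteMeasure (AgeSpace g)) {s : ℝ} (hs : 0 ≤ s)
    (f : ℝ → ℝ) : ∫ x, f x ∂(lineMeasure ν s) = ∫ x : AgeSpace g, f x ∂(ν s : Measure _) := by
  rw [lineMeasure, max_eq_left hs, (measurableEmbedding_ageSpace g).integral_map]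

theorem lintegral_lineMeasure (ν : ℝ → FiniteMeasure (AgeSpace g)) {s : ℝ} (hs : 0 ≤ s)
    (f : ℝ → ENNReal) :
    ∫⁻ x, f x ∂(lineMeasure ν s) = ∫⁻ x : AgeSpace g, f x ∂(ν s : Measure _) := by
  rw [lineMeasure, max_eq_left hs, (measurableEmbedding_ageSpace g).lintegral_map]

theorem ae_mem_ageSet (ν : ℝ → FiniteMeasure (AgeSpace g)) (s : ℝ) :
    ∀ᵐ x ∂(lineMeasure ν s), x ∈ ageSet g := by
  rw [lineMeasure, (measurableEmbedding_ageSpace g).ae_map_iff]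
  exact Eventually.of_forall fun x => x.2

instance (ν : ℝ → FiniteMeasure (AgeSpace g)) (s : ℝ) : IsFiniteMeasure (lineMeasure ν s) := by
  unfold lineMeasure; infer_instance

theorem measurable_lineMeasure {ν : ℝ → FiniteMeasure (AgeSpace g)} (hν : IsCadlag ν) :
    Measurable (lineMeasure ν) := by
  have h1 : Measurable fun s => (ν (max s 0) : Measure (AgeSpace g)) := by
    refine FiniteMeasure.measurable_of_rightContinuous (ν := fun s => ν (max s 0)) fun t => ?_
    refine ContinuousWithinAt.comp (t := Ici (max t 0)) (hν.1 _ (le_max_right _ _))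
      (by fun_prop) fun s hs => ?_
    exact max_le_max_right 0 (mem_Ici.1 hs)
  exact (Measure.measurable_map _ (measurableEmbedding_ageSpace g).measurable).comp h1

/-- The age distributions as a kernel from times to ages. -/
noncomputable def lineKernel {ν : ℝ → FiniteMeasure (AgeSpace g)} (hν : IsCadlag ν) :
    ProbabilityTheory.Kernel ℝ ℝ :=
  ⟨lineMeasure ν, measurable_lineMeasure hν⟩

theorem lineMeasure_univ_le {ν : ℝ → FiniteMeasure (AgeSpace g)}
    (hm : ∀ t, 0 ≤ t → ((ν t).mass : ℝ) ≤ 1) (s : ℝ) : lineMeasure ν s univ ≤ 1 := by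
  rw [lineMeasure, (measurableEmbedding_ageSpace g).map_apply, preimage_univ,
    ← FiniteMeasure.ennreal_mass]
  exact_mod_cast hm _ (le_max_right _ _)

open scoped ProbabilityTheory in
/-- The age distributions integrated over the time interval `(0,t]`. -/
noncomputable def occupation {ν : ℝ → FiniteMeasure (AgeSpace g)} (hν : IsCadlag ν) (t : ℝ) :
    Measure (ℝ × ℝ) :=
  (volume.restrict (Ioc 0 t)) ⊗ₘ lineKernel hν

/-- The weight `w` may be unbounded, but `F (x - s) ≠ 0` with `s ∈ [0,t]` confines `x` to a compact
set. -/
theorem exists_bound_shift {F w : ℝ → ℝ} (hF : Continuous F) (hFs : HasCompactSupport F)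
    (hw : Continuous w) (t : ℝ) :
    ∃ C, 0 ≤ C ∧ ∀ s ∈ Icc 0 t, ∀ x, |F (x - s) * w x| ≤ C := by
  obtain ⟨C, hC⟩ := ((show IsCompact (tsupport F) from hFs).prod (isCompact_Icc (a := 0) (b := t))).exists_bound_of_continuousOn
    (f := fun p : ℝ × ℝ => F p.1 * w (p.1 + p.2)) (by fun_prop)
  refine ⟨max C 0, le_max_right _ _, fun s hs x => ?_⟩
  by_cases hx : x - s ∈ tsupport F
  · have := hC (x - s, s) ⟨hx, hs⟩
    simp only [sub_add_cancel, Real.norm_eq_abs] at this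
    exact this.trans (le_max_left _ _)
  · rw [image_eq_zero_of_notMem_tsupport hx]
    simp

/-- Take `b` to be the largest point of the support; since `survival g` is antitone, positivity at
`b + t` keeps all ages reached up to time `t` away from `M`. For an empty support `b = -t` serves,
as `survival g 0 = 1`. -/
theorem IsServiceDensity.exists_upper_bound (hg : IsServiceDensity g) {F : ℝ → ℝ}
    (hFs : HasCompactSupport F) {t : ℝ} (hFt : tsupport F ⊆ {z | 0 < survival g (z + t)}) :
    ∃ b, (∀ z ∈ tsupport F, z ≤ b) ∧ 0 < survival g (b + t) := by
  rcases (tsupport F).eq_empty_or_nonempty with h | h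
  · exact ⟨-t, by simp [h], by rw [neg_add_cancel, hg.survival_of_nonpos le_rfl]; exact one_pos⟩
  · obtain ⟨b, hb, hb'⟩ := (show IsCompact (tsupport F) from hFs).exists_isGreatest h
    exact ⟨b, hb', hFt hb⟩

variable {E : ℝ → ℝ} {X₀ : ℝ} {ν₀ : FiniteMeasure (AgeSpace g)} {X : ℝ → ℝ}
  {ν : ℝ → FiniteMeasure (AgeSpace g)}

namespace SolvesFluidEquations

theorem isFiniteKernel (hs : SolvesFluidEquations g E X₀ ν₀ X ν) :
    ProbabilityTheory.IsFiniteKernel (lineKernel hs.ν_cadlag) :=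
  ⟨⟨1, ENNReal.one_lt_top, fun s => lineMeasure_univ_le hs.mass_le_one s⟩⟩

theorem isFiniteMeasure_occupation (hs : SolvesFluidEquations g E X₀ ν₀ X ν) (t : ℝ) :
    IsFiniteMeasure (occupation hs.ν_cadlag t) := by
  have := hs.isFiniteKernel
  unfold occupation; infer_instance

theorem lintegral_occupation (hs : SolvesFluidEquations g E X₀ ν₀ X ν) (t : ℝ)
    {f : ℝ × ℝ → ENNReal} (hf : Measurable f) :
    ∫⁻ p, f p ∂(occupation hs.ν_cadlag t) =
      ∫⁻ s in Ioc 0 t, ∫⁻ x, f (s, x) ∂(lineMeasure ν s) := by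
  have := hs.isFiniteKernel
  exact Measure.lintegral_compProd hf

theorem integral_occupation (hs : SolvesFluidEquations g E X₀ ν₀ X ν) {t : ℝ} (ht : 0 ≤ t)
    {f : ℝ × ℝ → ℝ} (hf : Integrable f (occupation hs.ν_cadlag t)) :
    ∫ p, f p ∂(occupation hs.ν_cadlag t) =
      ∫ s in (0 : ℝ)..t, ∫ x, f (s, x) ∂(lineMeasure ν s) := by
  have := hs.isFiniteKernel
  rw [intervalIntegral.integral_of_le ht]
  exact Measure.integral_compProd hf

theorem ae_occupation (hs : SolvesFluidEquations g E X₀ ν₀ X ν) (t : ℝ) :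
    ∀ᵐ p ∂(occupation hs.ν_cadlag t), p.1 ∈ Ioc 0 t ∧ p.2 ∈ ageSet g := by
  have := hs.isFiniteKernel
  have hm : MeasurableSet {p : ℝ × ℝ | p.1 ∈ Ioc 0 t ∧ p.2 ∈ ageSet g} :=
    measurableSet_Ioc.prod (IsServiceDensity.measurableSet_ageSet g)
  rw [occupation, Measure.ae_compProd_iff hm]
  refine (ae_restrict_iff' measurableSet_Ioc).2 (Eventually.of_forall fun s h => ?_)
  filter_upwards [ae_mem_ageSet ν s] with x hx
  exact ⟨h, hx⟩

theorem lintegral_hazard_occupation (hg : IsServiceDensity g)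
    (hs : SolvesFluidEquations g E X₀ ν₀ X ν) {t : ℝ} :
    ∫⁻ p, ENNReal.ofReal (hazard g p.2) ∂(occupation hs.ν_cadlag t) =
      ∫⁻ s in Ioc 0 t, ∫⁻ x : AgeSpace g, ENNReal.ofReal (hazardRate g x) ∂(ν s : Measure _) := by
  rw [hs.lintegral_occupation t (f := fun p => ENNReal.ofReal (hazard g p.2))
    (hg.measurable_hazard.comp measurable_snd).ennreal_ofReal]
  refine setLIntegral_congr_fun measurableSet_Ioc fun s h => ?_
  simp only
  rw [lintegral_lineMeasure ν h.1.le (fun x => ENNReal.ofReal (hazard g x))]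
  refine lintegral_congr fun x => ?_
  rw [hg.hazard_eq x.2.1]

theorem integrable_hazard (hg : IsServiceDensity g) (hs : SolvesFluidEquations g E X₀ ν₀ X ν)
    {t : ℝ} (ht : 0 ≤ t) :
    Integrable (fun p : ℝ × ℝ => hazard g p.2) (occupation hs.ν_cadlag t) := by
  refine ⟨(hg.measurable_hazard.comp measurable_snd).aestronglyMeasurable, ?_⟩
  rw [hasFiniteIntegral_iff_ofReal
    ((hs.ae_occupation t).mono fun p hp => hg.hazard_nonneg hp.2.1),
    hs.lintegral_hazard_occupation hg]
  exact (lintegral_mono_set Ioc_subset_Icc_self).trans_lt (hs.departures_finite t ht)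

theorem integrable_occupation_mul (hs : SolvesFluidEquations g E X₀ ν₀ X ν) {F w : ℝ → ℝ}
    (hF : Continuous F) (hFs : HasCompactSupport F) (hw : Continuous w) (t : ℝ) :
    Integrable (fun p : ℝ × ℝ => F (p.2 - p.1) * w p.2) (occupation hs.ν_cadlag t) := by
  have := hs.isFiniteMeasure_occupation t
  obtain ⟨C, -, hC⟩ := exists_bound_shift hF hFs hw t
  refine Integrable.of_bound (by fun_prop) C ((hs.ae_occupation t).mono fun p hp => ?_)
  exact hC _ (Ioc_subset_Icc_self hp.1) _

theorem integrable_occupation_hazard_mul (hg : IsServiceDensity g)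
    (hs : SolvesFluidEquations g E X₀ ν₀ X ν) {F w : ℝ → ℝ}
    (hF : Continuous F) (hFs : HasCompactSupport F) (hw : Continuous w) {t : ℝ} (ht : 0 ≤ t) :
    Integrable (fun p : ℝ × ℝ => hazard g p.2 * (F (p.2 - p.1) * w p.2))
      (occupation hs.ν_cadlag t) := by
  obtain ⟨C, -, hC⟩ := exists_bound_shift hF hFs hw t
  refine (hs.integrable_hazard hg ht).mul_bdd (c := C) (by fun_prop)
    ((hs.ae_occupation t).mono fun p hp => ?_)
  exact hC _ (Ioc_subset_Icc_self hp.1) _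

/-- The transport equation for test functions in product form along the characteristics. -/
theorem transport_mul (hg : IsServiceDensity g) (hs : SolvesFluidEquations g E X₀ ν₀ X ν)
    {F w : ℝ → ℝ} (hF : ContDiff ℝ 1 F) (hFs : HasCompactSupport F) (hw : ContDiff ℝ 1 w)
    {t : ℝ} (ht : 0 ≤ t) (hFt : tsupport F ⊆ {z | 0 < survival g (z + t)}) :
    ∫ x, F (x - t) * w x ∂(lineMeasure ν t) = ∫ x, F x * w x ∂(lineMeasure ν 0)
      + ∫ p, F (p.2 - p.1) * (deriv w p.2 - hazard g p.2 * w p.2) ∂(occupation hs.ν_cadlag t)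
      + w 0 * ∫ s in Ioc 0 t, F (-s) ∂(stieltjesMeasure (fluidEntries g ν)) := by
  obtain ⟨b, hb, hbt⟩ := hg.exists_upper_bound hFs hFt
  obtain ⟨ε, hε, hbε⟩ : ∃ ε, 0 < ε ∧ 0 < survival g (b + t + ε) := by
    have h1 : ∀ᶠ y in 𝓝[>] (b + t), 0 < survival g y :=
      (hg.continuous_survival.continuousAt.eventually (lt_mem_nhds hbt)).filter_mono
        nhdsWithin_le_nhds
    obtain ⟨y, hy1, hy2⟩ := (h1.and self_mem_nhdsWithin).exists
    exact ⟨y - (b + t), sub_pos.2 hy2, by rwa [add_sub_cancel]⟩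
  -- The function `F (x - s) * w x` is not compactly supported in the plane, so it is cut off in
  -- time. The bump is `1` near `[0,t]` and supported in `[-ε, t + ε]`, with `ε` chosen so that
  -- characteristics issuing from the support of `F` stay below `M` up to time `t + ε`.
  let χ : ContDiffBump (t / 2 : ℝ) := ⟨t / 2 + ε / 2, t / 2 + ε, by positivity, by linarith⟩
  have hχ1 : ∀ s ∈ Icc 0 t, ∀ᶠ r in 𝓝 s, χ r = 1 := by
    intro s h
    have hs' : s ∈ Metric.ball (t / 2) (t / 2 + ε / 2) := by
      rw [Metric.mem_ball, Real.dist_eq, abs_lt]; constructor <;> linarith [h.1, h.2]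
    filter_upwards [Metric.isOpen_ball.mem_nhds hs'] with r hr
    exact χ.one_of_mem_closedBall (Metric.ball_subset_closedBall hr)
  have hχs : ∀ s ∈ Icc 0 t, χ s = 1 := fun s h => (hχ1 s h).self_of_nhds
  have hχc : ContDiff ℝ 1 χ := χ.contDiff
  have hχt : tsupport χ = Icc (-ε) (t + ε) := by
    rw [χ.tsupport_eq, Real.closedBall_eq_Icc]
    congr 1 <;> simp only [χ] <;> ring
  -- `F (x - s)` is constant along characteristics, so on `[0,t]` the terms with `deriv F` in `φ_s +
  -- φ_x` cancel and only `F (x - s) * deriv w x` remains.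
  set φ : ℝ × ℝ → ℝ := fun p => F (p.1 - p.2) * w p.1 * χ p.2 with hφ
  set A : Set (ℝ × ℝ) := {p | p.1 - p.2 ∈ tsupport F ∧ p.2 ∈ tsupport χ} with hA
  have hAc : IsClosed A := ((isClosed_tsupport F).preimage (by fun_prop)).inter
    ((isClosed_tsupport χ).preimage (by fun_prop))
  have hA0 : ∀ p ∉ A, φ p = 0 := by
    intro p hp
    by_cases h1 : p.1 - p.2 ∈ tsupport F
    · have h2 : p.2 ∉ tsupport χ := fun h => hp ⟨h1, h⟩
      simp only [hφ, image_eq_zero_of_notMem_tsupport h2, mul_zero]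
    · simp only [hφ, image_eq_zero_of_notMem_tsupport h1, zero_mul]
  have hAK : IsCompact A := by
    have h1 : IsCompact (tsupport F ×ˢ tsupport χ) :=
      IsCompact.prod hFs (hχt ▸ isCompact_Icc)
    refine (h1.image (f := fun p : ℝ × ℝ => (p.1 + p.2, p.2)) (by fun_prop)).of_isClosed_subset
      hAc fun p hp => ⟨(p.1 - p.2, p.2), ⟨hp.1, hp.2⟩, by simp⟩
  have hφt : IsTestFunction g φ := by
    refine ⟨?_, HasCompactSupport.intro hAK hA0, fun p hp => ?_⟩
    · exact ((hF.comp (contDiff_fst.sub contDiff_snd)).mul (hw.comp contDiff_fst)).mul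
        (hχc.comp contDiff_snd)
    · have hsub : tsupport φ ⊆ A :=
        closure_minimal (fun x hx => by_contra fun hxA => hx (hA0 x hxA)) hAc
      have hpA := hsub hp
      rw [hg.lt_endpoint_iff]
      have h1 := hb _ hpA.1
      have h2 : p.2 ≤ t + ε := by
        have := hpA.2; rw [hχt] at this; exact this.2
      exact hbε.trans_le (hg.survival_antitone (by linarith))
  have hFd : Differentiable ℝ F := hF.differentiable one_ne_zero
  have hwd : Differentiable ℝ w := hw.differentiable one_ne_zero
  have hF' : Continuous (deriv F) := hF.continuous_deriv le_rfl
  have hw' : Continuous (deriv w) := hw.continuous_deriv le_rfl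
  have hds : ∀ s ∈ Icc 0 t, ∀ x, deriv (fun r => φ (x, r)) s = -(deriv F (x - s) * w x) := by
    intro s h x
    have h1 : (fun r => φ (x, r)) =ᶠ[𝓝 s] fun r => F (x - r) * w x := by
      filter_upwards [hχ1 s h] with r hr
      simp [hφ, hr]
    rw [h1.deriv_eq]
    have h2 : HasDerivAt (fun r => F (x - r)) (deriv F (x - s) * (-1)) s :=
      (hFd (x - s)).hasDerivAt.comp s (by simpa using (hasDerivAt_id s).const_sub x)
    rw [(h2.mul_const (w x)).deriv]
    ring
  have hdx : ∀ s ∈ Icc 0 t, ∀ x, deriv (fun y => φ (y, s)) x =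
      deriv F (x - s) * w x + F (x - s) * deriv w x := by
    intro s h x
    have h1 : (fun y => φ (y, s)) = fun y => F (y - s) * w y := by
      ext y; simp [hφ, hχs s h]
    rw [h1]
    have h2 : HasDerivAt (fun y => F (y - s)) (deriv F (x - s) * 1) x :=
      (hFd (x - s)).hasDerivAt.comp x (by simpa using (hasDerivAt_id x).sub_const s)
    rw [(h2.fun_mul (hwd x).hasDerivAt).deriv]
    ring
  have i1 := hs.integrable_occupation_mul hF' hFs.deriv hw.continuous t
  have i2 := hs.integrable_occupation_mul hF.continuous hFs hw' t
  have i3 := hs.integrable_occupation_hazard_mul hg hF.continuous hFs hw.continuous ht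
  have key := hs.transport φ hφt t ht
  have e0 : ∫ x : AgeSpace g, φ (x, t) ∂(ν t : Measure _) =
      ∫ x, F (x - t) * w x ∂(lineMeasure ν t) := by
    rw [integral_lineMeasure ν ht]
    simp [hφ, hχs t ⟨ht, le_rfl⟩]
  have e1 : ∫ x : AgeSpace g, φ (x, 0) ∂(ν₀ : Measure _) =
      ∫ x, F x * w x ∂(lineMeasure ν 0) := by
    rw [integral_lineMeasure ν le_rfl, hs.ν_init]
    simp [hφ, hχs 0 ⟨le_rfl, ht⟩]
  have e2 : (∫ s in (0 : ℝ)..t, ∫ x : AgeSpace g, deriv (fun r => φ (x, r)) s ∂(ν s : Measure _)) =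
      -∫ p, deriv F (p.2 - p.1) * w p.2 ∂(occupation hs.ν_cadlag t) := by
    rw [← integral_neg, hs.integral_occupation ht
      (f := fun p => -(deriv F (p.2 - p.1) * w p.2)) i1.neg]
    refine intervalIntegral.integral_congr fun s h => ?_
    rw [uIcc_of_le ht] at h
    simp only
    rw [integral_lineMeasure ν h.1 (fun x => -(deriv F (x - s) * w x))]
    simp_rw [hds s h]
  have e3 : (∫ s in (0 : ℝ)..t, ∫ x : AgeSpace g, deriv (fun y => φ (y, s)) x ∂(ν s : Measure _)) =
      ∫ p, (deriv F (p.2 - p.1) * w p.2 + F (p.2 - p.1) * deriv w p.2)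
        ∂(occupation hs.ν_cadlag t) := by
    rw [hs.integral_occupation ht
      (f := fun p => deriv F (p.2 - p.1) * w p.2 + F (p.2 - p.1) * deriv w p.2) (i1.add i2)]
    refine intervalIntegral.integral_congr fun s h => ?_
    rw [uIcc_of_le ht] at h
    simp only
    rw [integral_lineMeasure ν h.1 (fun x => deriv F (x - s) * w x + F (x - s) * deriv w x)]
    simp_rw [hdx s h]
  have e4 : (∫ s in (0 : ℝ)..t, ∫ x : AgeSpace g, hazardRate g x * φ (x, s) ∂(ν s : Measure _)) =
      ∫ p, hazard g p.2 * (F (p.2 - p.1) * w p.2) ∂(occupation hs.ν_cadlag t) := by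
    rw [hs.integral_occupation ht i3]
    refine intervalIntegral.integral_congr fun s h => ?_
    rw [uIcc_of_le ht] at h
    simp only
    rw [integral_lineMeasure ν h.1 (fun x => hazard g x * (F (x - s) * w x))]
    refine integral_congr_ae (Eventually.of_forall fun x => ?_)
    simp [hφ, hχs s h, hg.hazard_eq x.2.1]
  have e5 : (∫ s in Ioc 0 t, φ (0, s) ∂(stieltjesMeasure (fluidEntries g ν))) =
      w 0 * ∫ s in Ioc 0 t, F (-s) ∂(stieltjesMeasure (fluidEntries g ν)) := by
    rw [← integral_const_mul]
    refine setIntegral_congr_fun measurableSet_Ioc fun s h => ?_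
    simp [hφ, hχs s (Ioc_subset_Icc_self h), mul_comm]
  rw [e0, e1, e2, e3, e4, e5, integral_add i1 i2] at key
  rw [key]
  have e6 : ∫ p, F (p.2 - p.1) * (deriv w p.2 - hazard g p.2 * w p.2) ∂(occupation hs.ν_cadlag t) =
      (∫ p, F (p.2 - p.1) * deriv w p.2 ∂(occupation hs.ν_cadlag t)) -
      ∫ p, hazard g p.2 * (F (p.2 - p.1) * w p.2) ∂(occupation hs.ν_cadlag t) := by
    rw [← integral_sub i2 i3]
    congr 1; ext p; ring
  rw [e6]
  ring

end SolvesFluidEquations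

end Transport

/-! ### Domination along characteristics, and smooth approximation of the weight `1 / (1 - G)`. -/

section

instance (K : ℝ → ℝ) : IsLocallyFiniteMeasure (stieltjesMeasure K) := by
  unfold stieltjesMeasure
  split_ifs <;> infer_instance

variable {g : ℝ → ℝ} {E : ℝ → ℝ} {X₀ : ℝ} {ν₀ : FiniteMeasure (AgeSpace g)} {X : ℝ → ℝ}
  {ν : ℝ → FiniteMeasure (AgeSpace g)}

/-- The entries into service in `(0,t]`, at minus their entry time. -/
noncomputable def entryMeasure (κ : Measure ℝ) (t : ℝ) : Measure ℝ :=
  (κ.restrict (Ioc 0 t)).map fun s => -s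

instance (κ : Measure ℝ) [IsLocallyFiniteMeasure κ] (t : ℝ) : IsFiniteMeasure (entryMeasure κ t) := by
  have : IsFiniteMeasure (κ.restrict (Ioc 0 t)) :=
    ⟨by rw [Measure.restrict_apply_univ]; exact measure_Ioc_lt_top⟩
  unfold entryMeasure; infer_instance

theorem isOpen_survival_pos (hg : IsServiceDensity g) (c t : ℝ) :
    IsOpen {z | c < survival g (z + t)} := by
  have := hg.continuous_survival
  exact isOpen_lt continuous_const (by fun_prop)

theorem Continuous.integrable_of_hasCompactSupport' {F : ℝ → ℝ} (hF : Continuous F)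
    (hFs : HasCompactSupport F) (m : Measure ℝ) [IsFiniteMeasure m] : Integrable F m := by
  obtain ⟨C, hC⟩ := hF.bounded_above_of_compact_support hFs
  exact Integrable.of_bound hF.aestronglyMeasurable C (Eventually.of_forall hC)

theorem integral_add_entryMeasure {F : ℝ → ℝ} (hF : Continuous F) (hFs : HasCompactSupport F)
    (m κ : Measure ℝ) [IsFiniteMeasure m] [IsLocallyFiniteMeasure κ] (t : ℝ) :
    ∫ x, F x ∂(m + entryMeasure κ t) = ∫ x, F x ∂m + ∫ s in Ioc 0 t, F (-s) ∂κ := by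
  rw [integral_add_measure (hF.integrable_of_hasCompactSupport' hFs _)
    (hF.integrable_of_hasCompactSupport' hFs _), entryMeasure,
    integral_map (by fun_prop) hF.aestronglyMeasurable]

namespace SolvesFluidEquations

/-- Along the characteristics, the ages are dominated by the initial ages and the entries. -/
theorem map_sub_le (hg : IsServiceDensity g) (hs : SolvesFluidEquations g E X₀ ν₀ X ν)
    {s t : ℝ} (h0 : 0 ≤ s) (hst : s ≤ t) :
    ((lineMeasure ν s).map fun x => x - s).restrict {z | 0 < survival g (z + t)} ≤
      lineMeasure ν 0 + entryMeasure (stieltjesMeasure (fluidEntries g ν)) t := by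
  refine Measure.le_iff.2 fun A hA => ?_
  rw [Measure.restrict_apply hA]
  set O := {z | 0 < survival g (z + t)} with hO
  set κ := stieltjesMeasure (fluidEntries g ν) with hκ
  have h1 : ((lineMeasure ν s).map fun x => x - s) (A ∩ O) ≤
      (lineMeasure ν 0 + entryMeasure κ s) (A ∩ O) := by
    refine Measure.apply_le_of_forall_integral_le (isOpen_survival_pos hg 0 s) ?_
      (inter_subset_right.trans fun z (hz : 0 < survival g (z + t)) =>
        hz.trans_le (hg.survival_antitone (by linarith)))
    intro F hF hFs hFt hF0
    rw [integral_map (by fun_prop) hF.continuous.aestronglyMeasurable,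
      integral_add_entryMeasure hF.continuous hFs]
    have key := hs.transport_mul hg hF hFs (w := fun _ => 1) contDiff_const h0 hFt
    simp only [mul_one, deriv_const, one_mul, zero_sub] at key
    rw [key]
    -- With the weight `w = 1` the hazard term only removes mass, and dropping it gives the
    -- domination.
    have h2 : ∫ p, F (p.2 - p.1) * -hazard g p.2 ∂(occupation hs.ν_cadlag s) ≤ 0 := by
      refine integral_nonpos_of_ae ((hs.ae_occupation s).mono fun p hp => ?_)
      have h3 := hg.hazard_nonneg hp.2.1
      have h4 := hF0 (p.2 - p.1)
      simp only [Pi.zero_apply]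
      nlinarith
    linarith
  refine h1.trans ?_
  have h2 : entryMeasure κ s ≤ entryMeasure κ t :=
    Measure.map_mono (Measure.restrict_mono (Ioc_subset_Ioc_right hst) le_rfl) (by fun_prop)
  calc _ ≤ (lineMeasure ν 0 + entryMeasure κ t) (A ∩ O) := by
        rw [Measure.add_apply, Measure.add_apply]
        gcongr
    _ ≤ _ := measure_mono inter_subset_left

/-- Moved back along characteristics, every `ν_s` is dominated by one fixed finite measure
(`map_sub_le`). Integrating over time first turns `ψ (z + s)` into at most the Lebesgue integral of
`ψ`. So an error that is small in `L¹` contributes little, even though a single `ν_s` may be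
singular. -/
theorem lintegral_occupation_mul_le (hg : IsServiceDensity g)
    (hs : SolvesFluidEquations g E X₀ ν₀ X ν) {t : ℝ} {F ψ : ℝ → ENNReal} (hF : Measurable F)
    (hFt : ∀ z, F z ≠ 0 → 0 < survival g (z + t)) {C : ENNReal} (hFC : ∀ z, F z ≤ C)
    (hψ : Measurable ψ) :
    ∫⁻ p, F (p.2 - p.1) * ψ p.2 ∂(occupation hs.ν_cadlag t) ≤
      C * ((lineMeasure ν 0 + entryMeasure (stieltjesMeasure (fluidEntries g ν)) t) univ *
        ∫⁻ x, ψ x) := by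
  set ρ := lineMeasure ν 0 + entryMeasure (stieltjesMeasure (fluidEntries g ν)) t with hρ
  set O := {z | 0 < survival g (z + t)} with hO
  have hOm : MeasurableSet O := (isOpen_survival_pos hg 0 t).measurableSet
  rw [hs.lintegral_occupation t (f := fun p => F (p.2 - p.1) * ψ p.2) (by fun_prop)]
  calc ∫⁻ s in Ioc 0 t, ∫⁻ x, F (x - s) * ψ x ∂(lineMeasure ν s)
      ≤ ∫⁻ s in Ioc 0 t, ∫⁻ z, C * ψ (z + s) ∂ρ := by
        refine setLIntegral_mono' measurableSet_Ioc fun s h => ?_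
        have e1 : ∫⁻ x, F (x - s) * ψ x ∂(lineMeasure ν s) =
            ∫⁻ z, F z * ψ (z + s) ∂((lineMeasure ν s).map fun x => x - s) := by
          rw [lintegral_map (by fun_prop) (by fun_prop)]
          simp
        have e2 : ∫⁻ z, F z * ψ (z + s) ∂((lineMeasure ν s).map fun x => x - s) =
            ∫⁻ z in O, F z * ψ (z + s) ∂((lineMeasure ν s).map fun x => x - s) := by
          rw [← lintegral_indicator hOm]
          congr 1; ext z
          by_cases hz : z ∈ O
          · simp [hz]
          · have : F z = 0 := by_contra fun h => hz (hFt z h)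
            simp [hz, this]
        rw [e1, e2]
        refine (lintegral_mono' (hs.map_sub_le hg h.1.le h.2) le_rfl).trans ?_
        exact lintegral_mono fun z => mul_le_mul_left (hFC z) _
    _ = ∫⁻ z, (∫⁻ s in Ioc 0 t, C * ψ (z + s)) ∂ρ := by
        rw [lintegral_lintegral_swap]
        exact Measurable.aemeasurable (by fun_prop)
    _ ≤ ∫⁻ z, (C * ∫⁻ x, ψ x) ∂ρ := by
        refine lintegral_mono fun z => ?_
        rw [lintegral_const_mul _ (by fun_prop)]
        refine mul_le_mul' le_rfl ?_
        refine (setLIntegral_le_lintegral _ _).trans ?_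
        rw [lintegral_add_left_eq_self (μ := volume) (fun x => ψ x) z]
    _ = _ := by rw [lintegral_const]; ring

end SolvesFluidEquations

/-- Approximation of `1 / (1 - G)` on `(-∞,b]` by continuously differentiable functions. -/
theorem IsServiceDensity.exists_approx (hg : IsServiceDensity g) {b ε : ℝ}
    (hb : 0 < survival g b) (hε : 0 < ε) (hεb : ε ≤ survival g b / 2) :
    ∃ w g₂ : ℝ → ℝ, ContDiff ℝ 1 w ∧ w 0 = 1 ∧ Measurable g₂ ∧ (∫⁻ x, ENNReal.ofReal |g₂ x| ≤ 1) ∧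
      ∃ d : ℝ → ℝ, Measurable d ∧ (∫⁻ x, ENNReal.ofReal |d x| ≤ ENNReal.ofReal ε) ∧
      (∀ x, x ≤ b → |w x - 1 / survival g x| ≤ 2 / survival g b ^ 2 * ε) ∧
      ∀ x, 0 ≤ x → x ≤ b → |deriv w x - hazard g x * w x| ≤
        (2 / survival g b) ^ 2 * |d x| + (2 / survival g b) * (2 / survival g b ^ 2 * ε) * |g₂ x| := by
  set c := survival g b with hc
  set g₁ : ℝ → ℝ := (Icc 0 b).indicator g with hg₁
  have hg₁m : Measurable g₁ := hg.measurable.indicator measurableSet_Icc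
  have hg₁i : Integrable g₁ := (integrable_indicator_iff measurableSet_Icc).2
    (hg.integrable.mono_set Icc_subset_Ici_self)
  -- Replacing the density on `[0,b]` by an `L¹`-close continuous function makes the primitive `C¹`.
  -- The weight is the inverse of the resulting approximate survival function `s₂`.
  obtain ⟨f, hfs, hf, hfc, hfi⟩ := hg₁i.exists_hasCompactSupport_integral_sub_le hε
  have hs₁ : ∀ x, 1 - ∫ y in (0 : ℝ)..x, g₁ y = survival g (min x b) := by
    intro x
    rcases lt_or_ge b 0 with hb0 | hb0
    · have : g₁ = fun _ => 0 := by simp [hg₁, Icc_eq_empty (not_le.2 hb0)]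
      rw [this, hg.survival_of_nonpos ((min_le_right _ _).trans hb0.le)]
      simp
    rcases le_total x 0 with hx | hx
    · rw [hg.survival_of_nonpos ((min_le_left _ _).trans hx), intervalIntegral.integral_symm,
        intervalIntegral.integral_of_le hx, hg₁, setIntegral_indicator measurableSet_Icc]
      have : (Ioc x 0 ∩ Icc 0 b : Set ℝ) ⊆ {0} := fun y hy => le_antisymm hy.1.2 hy.2.1
      rw [setIntegral_measure_zero _ (measure_mono_null this (measure_singleton 0))]
      simp
    · rw [hg.survival_eq (le_min hx hb0), serviceCDF, intervalIntegral.integral_of_le hx,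
        intervalIntegral.integral_of_le (le_min hx hb0), hg₁,
        setIntegral_indicator measurableSet_Icc]
      congr 3
      ext y
      simp only [mem_inter_iff, mem_Ioc, mem_Icc, le_min_iff]
      constructor
      · rintro ⟨⟨h1, h2⟩, -, h3⟩; exact ⟨h1, h2, h3⟩
      · rintro ⟨h1, h2, h3⟩; exact ⟨⟨h1, h2⟩, h1.le, h3⟩
  set s₂ : ℝ → ℝ := fun x => 1 - ∫ y in (0 : ℝ)..x, f y with hs₂
  have hdiff : ∀ x, |s₂ x - survival g (min x b)| ≤ ε := by
    intro x
    rw [← hs₁, hs₂]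
    have e : (1 - ∫ y in (0 : ℝ)..x, f y) - (1 - ∫ y in (0 : ℝ)..x, g₁ y) =
        ∫ y in (0 : ℝ)..x, (g₁ y - f y) := by
      rw [intervalIntegral.integral_sub hg₁i.intervalIntegrable hfi.intervalIntegrable]; ring
    rw [e, ← Real.norm_eq_abs]
    refine (intervalIntegral.norm_integral_le_integral_norm_uIoc).trans ?_
    exact (setIntegral_le_integral (hg₁i.sub hfi).norm
      (Eventually.of_forall fun _ => norm_nonneg _)).trans hf
  have hmin : ∀ x, c ≤ survival g (min x b) := fun x => hg.survival_antitone (min_le_right _ _)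
  -- The requirement that `ε` be at most `c / 2` is what keeps `s₂` bounded away from zero.
  have hs₂c : ∀ x, c / 2 ≤ s₂ x := fun x => by
    have h1 := abs_le.1 (hdiff x)
    have h2 := hmin x
    linarith [h1.1]
  have hs₂p : ∀ x, 0 < s₂ x := fun x => (half_pos hb).trans_le (hs₂c x)
  have hder : ∀ x, HasDerivAt s₂ (-f x) x := fun x => by
    have := (hfc.integral_hasStrictDerivAt 0 x).hasDerivAt
    simpa using this.const_sub 1
  have hwder : ∀ x, HasDerivAt (fun x => 1 / s₂ x) (f x / s₂ x ^ 2) x := fun x => by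
    have := (hder x).inv (hs₂p x).ne'
    simp only [neg_neg] at this
    simp only [one_div]
    exact this
  have hs₂cont : Continuous s₂ := continuous_iff_continuousAt.2 fun x => (hder x).continuousAt
  have hwC : ∀ x, |1 / s₂ x| ≤ 2 / c := fun x => by
    rw [abs_of_pos (one_div_pos.2 (hs₂p x)), div_le_div_iff₀ (hs₂p x) hb]
    linarith [hs₂c x]
  have hww : ∀ x, x ≤ b → |1 / s₂ x - 1 / survival g x| ≤ 2 / c ^ 2 * ε := by
    intro x hx
    have h1 := hdiff x
    have h2 := hmin x
    rw [min_eq_left hx] at h1 h2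
    have hp : 0 < survival g x := hb.trans_le h2
    rw [div_sub_div _ _ (hs₂p x).ne' hp.ne', abs_div, abs_of_pos (mul_pos (hs₂p x) hp),
      div_le_iff₀ (mul_pos (hs₂p x) hp), one_mul, mul_one, abs_sub_comm]
    refine h1.trans ?_
    have h3 : c / 2 * c ≤ s₂ x * survival g x := mul_le_mul (hs₂c x) h2 hb.le (hs₂p x).le
    calc ε = 2 / c ^ 2 * ε * (c / 2 * c) := by field_simp
      _ ≤ _ := by gcongr
  refine ⟨fun x => 1 / s₂ x, g₁, ?_, by simp [hs₂], hg₁m, ?_, fun x => f x - g₁ x,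
    hfc.measurable.sub hg₁m, ?_, hww, ?_⟩
  · refine contDiff_one_iff_deriv.2 ⟨fun x => (hwder x).differentiableAt, ?_⟩
    have : deriv (fun x => 1 / s₂ x) = fun x => f x / s₂ x ^ 2 := funext fun x => (hwder x).deriv
    rw [this]
    exact hfc.div₀ (hs₂cont.pow 2) fun x => (pow_pos (hs₂p x) 2).ne'
  · have := hg.isProbabilityMeasure
    have h1 : ∫⁻ x, ENNReal.ofReal |g₁ x| ≤ ∫⁻ x in Ici 0, ENNReal.ofReal (g x) := by
      rw [← lintegral_indicator measurableSet_Ici]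
      refine lintegral_mono fun x => ?_
      by_cases hx : x ∈ Icc 0 b
      · simp [hg₁, hx.1, hx.2, abs_of_nonneg (hg.nonneg x hx.1)]
      · simp [hg₁, indicator_of_notMem hx]
    refine h1.trans ?_
    have h2 := hg.lintegral_serviceLaw (f := fun _ => 1) measurable_const
    simp only [mul_one] at h2
    rw [← h2]
    simp
  · have hi := (hg₁i.sub hfi).norm
    simp only [Pi.sub_apply] at hi
    have h1 : ∀ x, |f x - g₁ x| = ‖g₁ x - f x‖ := fun x => by
      rw [Real.norm_eq_abs, abs_sub_comm]
    simp_rw [h1]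
    rw [← ofReal_integral_eq_lintegral_ofReal hi (Eventually.of_forall fun _ => norm_nonneg _)]
    exact ENNReal.ofReal_le_ofReal hf
  · intro x hx0 hxb
    have e1 : g₁ x = g x := indicator_of_mem (show x ∈ Icc 0 b from ⟨hx0, hxb⟩) g
    rw [(hwder x).deriv, hazard, ← e1]
    -- Splitting `w' - h w` as `w * ((f - g) * w + g * (w - 1/S))` separates an `L¹`-small factor
    -- from a uniformly small one.
    have e2 : f x / s₂ x ^ 2 - g₁ x / survival g x * (1 / s₂ x) =
        (1 / s₂ x) * ((f x - g₁ x) * (1 / s₂ x) + g₁ x * (1 / s₂ x - 1 / survival g x)) := by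
      have := (hs₂p x).ne'
      have h2 : survival g x ≠ 0 :=
        (hb.trans_le (hg.survival_antitone hxb)).ne'
      field_simp
      ring
    rw [e2, abs_mul]
    calc _ ≤ 2 / c * (|f x - g₁ x| * (2 / c) + |g₁ x| * (2 / c ^ 2 * ε)) := by
          have hc2 : 0 ≤ 2 / c := by positivity
          refine mul_le_mul (hwC x) ((abs_add_le _ _).trans ?_) (abs_nonneg _) hc2
          rw [abs_mul, abs_mul]
          gcongr
          · exact hwC x
          · exact hww x hxb
      _ = _ := by ring

end

/-! ### The explicit representation of the age distribution. -/

section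

variable {g : ℝ → ℝ} {E : ℝ → ℝ} {X₀ : ℝ} {ν₀ : FiniteMeasure (AgeSpace g)} {X : ℝ → ℝ}
  {ν : ℝ → FiniteMeasure (AgeSpace g)}

theorem abs_le_of_forall_small {a C c : ℝ} (hc : 0 < c)
    (h : ∀ ε, 0 < ε → ε ≤ c → |a| ≤ C * ε) : a = 0 := by
  rw [← abs_nonpos_iff]
  have h1 : Tendsto (fun ε => C * ε) (𝓝[>] 0) (𝓝 0) := by
    have : Tendsto (fun ε => C * ε) (𝓝 0) (𝓝 (C * 0)) := tendsto_id.const_mul C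
    rw [mul_zero] at this
    exact this.mono_left nhdsWithin_le_nhds
  refine ge_of_tendsto h1 ?_
  filter_upwards [Ioc_mem_nhdsGT hc] with ε hε
  exact h ε hε.1 hε.2

/-- The difference of two integrals against a sub-probability measure. -/
theorem abs_integral_sub_integral_le {m : Measure ℝ} [IsFiniteMeasure m] (hm : m univ ≤ 1)
    {f₁ f₂ : ℝ → ℝ} {B δ : ℝ} (hδ : 0 ≤ δ) (h₁ : Measurable f₁) (h₂ : Measurable f₂)
    (hB : ∀ x, |f₁ x| ≤ B) (h : ∀ x, |f₁ x - f₂ x| ≤ δ) :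
    |∫ x, f₁ x ∂m - ∫ x, f₂ x ∂m| ≤ δ := by
  have i₁ : Integrable f₁ m := Integrable.of_bound h₁.aestronglyMeasurable B
    (Eventually.of_forall hB)
  have i₂ : Integrable f₂ m := by
    refine Integrable.of_bound h₂.aestronglyMeasurable (B + δ) (Eventually.of_forall fun x => ?_)
    have h3 := abs_le.1 (hB x)
    have h4 := abs_le.1 (h x)
    rw [Real.norm_eq_abs, abs_le]
    constructor <;> linarith
  rw [← integral_sub i₁ i₂, ← Real.norm_eq_abs]
  refine (norm_integral_le_of_norm_le_const (C := δ) (Eventually.of_forall h)).trans ?_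
  have : m.real univ ≤ 1 := ENNReal.toReal_le_of_le_ofReal one_pos.le (by simpa using hm)
  nlinarith

namespace SolvesFluidEquations

/-- This is `transport_mul` with the ideal weight `w = 1/S`, for which `w' = h w` cancels the
interior term and `w 0 = 1`. Since `1/S` need not be `C¹`, the approximations of `exists_approx` are
used and `ε` tends to zero. -/
theorem integral_div_survival (hg : IsServiceDensity g)
    (hs : SolvesFluidEquations g E X₀ ν₀ X ν) {F : ℝ → ℝ} (hF : ContDiff ℝ 1 F)
    (hFs : HasCompactSupport F) {t : ℝ} (ht : 0 ≤ t)
    (hFt : tsupport F ⊆ {z | 0 < survival g (z + t)}) :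
    ∫ x, F (x - t) * (1 / survival g x) ∂(lineMeasure ν t) =
      ∫ x, F x * (1 / survival g x) ∂(lineMeasure ν 0)
      + ∫ s in Ioc 0 t, F (-s) ∂(stieltjesMeasure (fluidEntries g ν)) := by
  obtain ⟨b, hb, hbt⟩ := hg.exists_upper_bound hFs hFt
  obtain ⟨C, hC⟩ := hF.continuous.bounded_above_of_compact_support hFs
  simp only [Real.norm_eq_abs] at hC
  have hC0 : 0 ≤ C := (abs_nonneg _).trans (hC 0)
  set c := survival g (b + t) with hc
  set κ := stieltjesMeasure (fluidEntries g ν) with hκ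
  set ρ := lineMeasure ν 0 + entryMeasure κ t with hρ
  have hsm : Measurable (survival g) := hg.continuous_survival.measurable
  have hFm := hF.continuous.measurable
  have hFz : ∀ z, F z ≠ 0 → z ≤ b := fun z hz => hb z (subset_tsupport _ hz)
  rw [← sub_eq_zero]
  -- The first summand is the cost of replacing the weight at times `t` and `0`; the second bounds
  -- the interior term through `lintegral_occupation_mul_le`.
  refine abs_le_of_forall_small (C := 2 * (C * (2 / c ^ 2)) + C * (ρ.real univ *
    ((2 / c) ^ 2 + (2 / c) * (2 / c ^ 2)))) (half_pos hbt) fun ε hε hεc => ?_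
  obtain ⟨w, g₂, hw, hw0, hg₂, hg₂i, d, hd, hdi, hwa, hwd⟩ := hg.exists_approx hbt hε hεc
  have key := hs.transport_mul hg hF hFs hw ht hFt
  rw [hw0, one_mul] at key
  have hcomp : ∀ r, 0 ≤ r → r ≤ t → |∫ x, F (x - r) * w x ∂(lineMeasure ν r) -
      ∫ x, F (x - r) * (1 / survival g x) ∂(lineMeasure ν r)| ≤ C * (2 / c ^ 2) * ε := by
    intro r hr hrt
    obtain ⟨B, -, hB⟩ := exists_bound_shift hF.continuous hFs hw.continuous r
    have hwm := hw.continuous.measurable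
    refine abs_integral_sub_integral_le (lineMeasure_univ_le hs.mass_le_one r)
      (B := B) (by positivity)
      (by fun_prop) (by fun_prop) (hB r ⟨hr, le_rfl⟩) fun x => ?_
    rw [← mul_sub, abs_mul, mul_assoc]
    by_cases hx : F (x - r) = 0
    · rw [hx]; simp; positivity
    · refine mul_le_mul (hC _) (hwa x ?_) (abs_nonneg _) hC0
      have := hFz _ hx
      linarith
  have h1 := hcomp t ht le_rfl
  have h2 := hcomp 0 le_rfl ht
  simp only [sub_zero] at h2
  have h3 : |∫ p, F (p.2 - p.1) * (deriv w p.2 - hazard g p.2 * w p.2)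
      ∂(occupation hs.ν_cadlag t)| ≤ C * (ρ.real univ *
    ((2 / c) ^ 2 + (2 / c) * (2 / c ^ 2))) * ε := by
    set ψ : ℝ → ENNReal := fun x => ENNReal.ofReal ((2 / c) ^ 2) * ENNReal.ofReal |d x| +
      ENNReal.ofReal ((2 / c) * (2 / c ^ 2 * ε)) * ENNReal.ofReal |g₂ x| with hψ
    have hψm : Measurable ψ := by fun_prop
    have hψi : ∫⁻ x, ψ x ≤ ENNReal.ofReal (((2 / c) ^ 2 + (2 / c) * (2 / c ^ 2)) * ε) := by
      rw [hψ, lintegral_add_left (by fun_prop), lintegral_const_mul _ (by fun_prop),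
        lintegral_const_mul _ (by fun_prop)]
      calc _ ≤ ENNReal.ofReal ((2 / c) ^ 2) * ENNReal.ofReal ε +
            ENNReal.ofReal ((2 / c) * (2 / c ^ 2 * ε)) * 1 := by gcongr
        _ = _ := by
          rw [mul_one, ← ENNReal.ofReal_mul (by positivity), ← ENNReal.ofReal_add
            (by positivity) (by positivity)]
          congr 1; ring
    have h4 : ∫⁻ p, ENNReal.ofReal |F (p.2 - p.1)| * ψ p.2 ∂(occupation hs.ν_cadlag t) ≤
        ENNReal.ofReal C * (ρ univ * ∫⁻ x, ψ x) :=
      hs.lintegral_occupation_mul_le hg (F := fun z => ENNReal.ofReal |F z|) (by fun_prop)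
        (fun z hz => hFt (subset_tsupport _ fun h0 => hz (by simp [h0])))
        (fun z => ENNReal.ofReal_le_ofReal (hC z)) hψm
    have h5 : ∫⁻ p, ENNReal.ofReal ‖F (p.2 - p.1) * (deriv w p.2 - hazard g p.2 * w p.2)‖
        ∂(occupation hs.ν_cadlag t) ≤ ENNReal.ofReal (C * (ρ.real univ *
          ((2 / c) ^ 2 + (2 / c) * (2 / c ^ 2))) * ε) := by
      refine (lintegral_mono_ae ((hs.ae_occupation t).mono fun p hp => ?_)).trans (h4.trans ?_)
      · rw [norm_mul, ENNReal.ofReal_mul (norm_nonneg _)]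
        by_cases hx : F (p.2 - p.1) = 0
        · simp [hx]
        · refine mul_le_mul' le_rfl ?_
          have hpb : p.2 ≤ b + t := by
            have := hFz _ hx
            have := hp.1.2
            linarith
          refine (ENNReal.ofReal_le_ofReal (hwd p.2 hp.2.1 hpb)).trans ?_
          rw [hψ, ENNReal.ofReal_add (by positivity) (by positivity),
            ENNReal.ofReal_mul (by positivity), ENNReal.ofReal_mul (by positivity)]
      · calc _ ≤ ENNReal.ofReal C * (ρ univ *
              ENNReal.ofReal (((2 / c) ^ 2 + (2 / c) * (2 / c ^ 2)) * ε)) := by gcongr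
          _ = _ := by
            have : ρ univ = ENNReal.ofReal (ρ.real univ) := (ofReal_measureReal).symm
            rw [this, ← ENNReal.ofReal_mul (by positivity), ← ENNReal.ofReal_mul (by positivity)]
            congr 1; ring
    rw [← Real.norm_eq_abs]
    refine (norm_integral_le_lintegral_norm _).trans ?_
    exact ENNReal.toReal_le_of_le_ofReal (by positivity) h5
  have e : ∫ x, F (x - t) * (1 / survival g x) ∂(lineMeasure ν t) -
      (∫ x, F x * (1 / survival g x) ∂(lineMeasure ν 0) + ∫ s in Ioc 0 t, F (-s) ∂κ) =
      -(∫ x, F (x - t) * w x ∂(lineMeasure ν t) -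
        ∫ x, F (x - t) * (1 / survival g x) ∂(lineMeasure ν t)) +
      (∫ x, F x * w x ∂(lineMeasure ν 0) - ∫ x, F x * (1 / survival g x) ∂(lineMeasure ν 0)) +
      ∫ p, F (p.2 - p.1) * (deriv w p.2 - hazard g p.2 * w p.2) ∂(occupation hs.ν_cadlag t) := by
    rw [key]; ring
  rw [e]
  refine (abs_add_le _ _).trans ?_
  have h6 := abs_add_le (-(∫ x, F (x - t) * w x ∂(lineMeasure ν t) -
        ∫ x, F (x - t) * (1 / survival g x) ∂(lineMeasure ν t)))
      (∫ x, F x * w x ∂(lineMeasure ν 0) - ∫ x, F x * (1 / survival g x) ∂(lineMeasure ν 0))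
  rw [abs_neg] at h6
  linarith

/-- The weighted ages at time `t`, moved back along the characteristics, are the weighted initial
ages together with the entries. -/
theorem map_withDensity_eq (hg : IsServiceDensity g) (hs : SolvesFluidEquations g E X₀ ν₀ X ν)
    {t : ℝ} (ht : 0 ≤ t) :
    (((lineMeasure ν t).withDensity fun x => ENNReal.ofReal (1 / survival g x)).map
      fun x => x - t).restrict {z | 0 < survival g (z + t)} =
    ((lineMeasure ν 0).withDensity (fun x => ENNReal.ofReal (1 / survival g x)) +
      entryMeasure (stieltjesMeasure (fluidEntries g ν)) t).restrict
        {z | 0 < survival g (z + t)} := by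
  set κ := stieltjesMeasure (fluidEntries g ν) with hκ
  have hsm : Measurable (survival g) := hg.continuous_survival.measurable
  -- The weight `1/S` is unbounded near `M`, so the weighted measures may be infinite. On each set
  -- of the exhaustion the weight is bounded, and test functions determine the measures.
  have hunion : {z | 0 < survival g (z + t)} =
      ⋃ n : ℕ, {z | 1 / ((n : ℝ) + 1) < survival g (z + t)} := by
    ext z
    simp only [mem_iUnion]
    constructor
    · intro h; exact exists_nat_one_div_lt (show 0 < survival g (z + t) from h)
    · rintro ⟨n, hn⟩; exact lt_trans (by positivity : (0 : ℝ) < 1 / ((n : ℝ) + 1)) hn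
  rw [hunion, Measure.restrict_iUnion_congr]
  intro n
  set δ : ℝ := 1 / ((n : ℝ) + 1) with hδ
  have hδ0 : 0 < δ := by positivity
  set O := {z | δ < survival g (z + t)} with hO
  have hOo : IsOpen O := isOpen_survival_pos hg δ t
  -- A globally bounded replacement for `1/S`, equal to it wherever `S` exceeds `δ`.
  set u : ℝ → ℝ := fun x => 1 / max (survival g x) δ with hu
  have hum : Measurable u := by fun_prop
  have hu0 : ∀ x, 0 ≤ u x := fun x => by
    simp only [hu]; exact one_div_nonneg.2 (hδ0.le.trans (le_max_right _ _))
  have huδ : ∀ x, u x ≤ 1 / δ := fun x => one_div_le_one_div_of_le hδ0 (le_max_right _ _)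
  have hfin : ∀ (m : Measure ℝ) [IsFiniteMeasure m],
      IsFiniteMeasure (m.withDensity fun x => ENNReal.ofReal (u x)) := fun m _ => by
    refine isFiniteMeasure_withDensity ?_
    refine ne_of_lt ((lintegral_mono (g := fun _ => ENNReal.ofReal (1 / δ))
      fun x => ENNReal.ofReal_le_ofReal (huδ x)).trans_lt ?_)
    rw [lintegral_const]
    finiteness
  have := hfin (lineMeasure ν t)
  have := hfin (lineMeasure ν 0)
  have hueq : ∀ x, δ < survival g x → u x = 1 / survival g x := fun x hx => by
    simp only [hu, max_eq_left hx.le]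
  have hO0 : ∀ x ∈ O, δ < survival g x := fun x hx =>
    lt_of_lt_of_le hx (hg.survival_antitone (by linarith))
  set A₁ := ((lineMeasure ν t).withDensity fun x => ENNReal.ofReal (u x)).map fun x => x - t
    with hA₁
  set A₂ := (lineMeasure ν 0).withDensity (fun x => ENNReal.ofReal (u x)) + entryMeasure κ t
    with hA₂
  have heqF : ∀ F : ℝ → ℝ, ContDiff ℝ 1 F → HasCompactSupport F → tsupport F ⊆ O →
      ∫ x, F x ∂A₁ = ∫ x, F x ∂A₂ := by
    intro F hF hFs hFO
    have key := hs.integral_div_survival hg hF hFs ht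
      (hFO.trans fun z hz => hδ0.trans hz)
    rw [hA₁, hA₂, integral_map (by fun_prop) hF.continuous.aestronglyMeasurable,
      integral_add_entryMeasure hF.continuous hFs,
      integral_withDensity_eq_integral_toReal_smul (by fun_prop)
        (Eventually.of_forall fun _ => ENNReal.ofReal_lt_top),
      integral_withDensity_eq_integral_toReal_smul (by fun_prop)
        (Eventually.of_forall fun _ => ENNReal.ofReal_lt_top)]
    have e1 : ∀ x, (ENNReal.ofReal (u x)).toReal • F (x - t) = F (x - t) * (1 / survival g x) := by
      intro x
      rw [ENNReal.toReal_ofReal (hu0 x), smul_eq_mul, mul_comm]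
      by_cases hx : F (x - t) = 0
      · simp [hx]
      · have h1 : x - t ∈ O := hFO (subset_tsupport _ hx)
        have h2 : δ < survival g (x - t + t) := h1
        rw [sub_add_cancel] at h2
        rw [hueq x h2]
    have e2 : ∀ x, (ENNReal.ofReal (u x)).toReal • F x = F x * (1 / survival g x) := by
      intro x
      rw [ENNReal.toReal_ofReal (hu0 x), smul_eq_mul, mul_comm]
      by_cases hx : F x = 0
      · simp [hx]
      · rw [hueq x (hO0 x (hFO (subset_tsupport _ hx)))]
    simp_rw [e1, e2]
    exact key
  have hA : ∀ A ⊆ O, A₁ A = A₂ A := fun A hAO => le_antisymm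
    (Measure.apply_le_of_forall_integral_le hOo (fun F hF hFs hFO _ => (heqF F hF hFs hFO).le) hAO)
    (Measure.apply_le_of_forall_integral_le hOo (fun F hF hFs hFO _ => (heqF F hF hFs hFO).ge) hAO)
  ext A hAm
  rw [Measure.restrict_apply hAm, Measure.restrict_apply hAm]
  have hAOm : MeasurableSet (A ∩ O) := hAm.inter hOo.measurableSet
  have h1 := hA (A ∩ O) inter_subset_right
  rw [hA₁, hA₂, Measure.map_apply (by fun_prop) hAOm, Measure.add_apply,
    withDensity_apply _ (hAOm.preimage (by fun_prop)), withDensity_apply _ hAOm] at h1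
  rw [Measure.map_apply (by fun_prop) hAOm, Measure.add_apply,
    withDensity_apply _ (hAOm.preimage (by fun_prop)), withDensity_apply _ hAOm]
  have e1 : ∫⁻ x in (fun x => x - t) ⁻¹' (A ∩ O), ENNReal.ofReal (1 / survival g x)
      ∂(lineMeasure ν t) =
      ∫⁻ x in (fun x => x - t) ⁻¹' (A ∩ O), ENNReal.ofReal (u x) ∂(lineMeasure ν t) := by
    refine setLIntegral_congr_fun (hAOm.preimage (by fun_prop)) fun x hx => ?_
    have h2 : δ < survival g (x - t + t) := hx.2
    rw [sub_add_cancel] at h2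
    rw [hueq x h2]
  have e2 : ∫⁻ x in A ∩ O, ENNReal.ofReal (1 / survival g x) ∂(lineMeasure ν 0) =
      ∫⁻ x in A ∩ O, ENNReal.ofReal (u x) ∂(lineMeasure ν 0) := by
    refine setLIntegral_congr_fun hAOm fun x hx => ?_
    rw [hueq x (hO0 x hx.2)]
  rw [e1, e2, h1]

/-- The explicit representation of the age distribution in terms of the initial ages and the
entries into service. -/
theorem lintegral_eq (hg : IsServiceDensity g) (hs : SolvesFluidEquations g E X₀ ν₀ X ν)
    {t : ℝ} (ht : 0 ≤ t) {f : ℝ → ENNReal} (hf : Measurable f) :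
    ∫⁻ x, f x ∂(lineMeasure ν t) =
      ∫⁻ x, f (x + t) * ENNReal.ofReal (survival g (x + t) / survival g x) ∂(lineMeasure ν 0)
      + ∫⁻ s in Ioc 0 t, f (t - s) * ENNReal.ofReal (survival g (t - s))
        ∂(stieltjesMeasure (fluidEntries g ν)) := by
  have hsm : Measurable (survival g) := hg.continuous_survival.measurable
  set O := {z | 0 < survival g (z + t)} with hO
  have hOm : MeasurableSet O := (isOpen_survival_pos hg 0 t).measurableSet
  -- The factor `S (z + t)` undoes the weight at time `t`, and it vanishes off `O`, so the
  -- restriction to `O` loses nothing.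
  set Φ : ℝ → ENNReal := fun z => f (z + t) * ENNReal.ofReal (survival g (z + t)) with hΦ
  have hΦm : Measurable Φ := by fun_prop
  have hΦ0 : ∀ m : Measure ℝ, ∫⁻ z in O, Φ z ∂m = ∫⁻ z, Φ z ∂m := fun m => by
    rw [← lintegral_indicator hOm]
    congr 1; ext z
    by_cases hz : z ∈ O
    · simp [hz]
    · have : survival g (z + t) ≤ 0 := not_lt.1 hz
      simp [hz, hΦ, ENNReal.ofReal_of_nonpos this]
  have key := congrArg (fun m : Measure ℝ => ∫⁻ z, Φ z ∂m) (hs.map_withDensity_eq hg ht)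
  rw [hΦ0, hΦ0, lintegral_add_measure, lintegral_map hΦm (by fun_prop), entryMeasure,
    lintegral_map hΦm (by fun_prop), lintegral_withDensity_eq_lintegral_mul _ (by fun_prop)
      (by fun_prop), lintegral_withDensity_eq_lintegral_mul _ (by fun_prop) hΦm] at key
  have e1 : ∫⁻ x, ((fun x => ENNReal.ofReal (1 / survival g x)) * fun x => Φ (x - t)) x
      ∂(lineMeasure ν t) = ∫⁻ x, f x ∂(lineMeasure ν t) := by
    refine lintegral_congr_ae ((ae_mem_ageSet ν t).mono fun x hx => ?_)
    have hp := ((hg.mem_ageSet_iff x).1 hx).2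
    simp only [Pi.mul_apply, hΦ, sub_add_cancel]
    rw [mul_left_comm, ← ENNReal.ofReal_mul (by positivity), one_div_mul_cancel hp.ne',
      ENNReal.ofReal_one, mul_one]
  have e2 : ∫⁻ x, ((fun x => ENNReal.ofReal (1 / survival g x)) * Φ) x ∂(lineMeasure ν 0) =
      ∫⁻ x, f (x + t) * ENNReal.ofReal (survival g (x + t) / survival g x)
        ∂(lineMeasure ν 0) := by
    refine lintegral_congr fun x => ?_
    simp only [Pi.mul_apply, hΦ]
    rw [mul_left_comm, ← ENNReal.ofReal_mul (by
      exact one_div_nonneg.2 (IsServiceDensity.survival_nonneg g x)), one_div_mul_eq_div]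
  rw [e1, e2] at key
  rw [key]
  congr 1
  refine lintegral_congr fun s => ?_
  simp only [hΦ]
  rw [neg_add_eq_sub]

end SolvesFluidEquations

end

/-! ### Renewal equations for the mass, the departures and the entries. -/

section

variable {g : ℝ → ℝ}

namespace IsServiceDensity

/-- The zero set lies in `[y₀, ∞)`, where `y₀` is its least point. The open half-line has mass
`survival g y₀ = 0`, and the law has no atom at `y₀`. -/
theorem serviceLaw_survival_eq_zero (hg : IsServiceDensity g) :
    serviceLaw g {y | survival g y = 0} = 0 := by
  have := hg.isProbabilityMeasure
  rcases {y | survival g y = 0}.eq_empty_or_nonempty with h | h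
  · rw [h, measure_empty]
  have hcl : IsClosed {y | survival g y = 0} :=
    isClosed_eq hg.continuous_survival continuous_const
  have hbd : BddBelow {y | survival g y = 0} := ⟨0, fun y hy => by
    by_contra hlt
    have h1 : survival g y = 0 := hy
    rw [hg.survival_of_nonpos (not_le.1 hlt).le] at h1
    exact one_ne_zero h1⟩
  set y₀ := sInf {y | survival g y = 0} with hy₀
  have hmem : survival g y₀ = 0 := hcl.csInf_mem h hbd
  have hsub : {y | survival g y = 0} ⊆ {y₀} ∪ Ioi y₀ := fun y hy => by
    rcases (csInf_le hbd hy).eq_or_lt with h | h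
    · exact Or.inl h.symm
    · exact Or.inr h
  refine measure_mono_null hsub (measure_union_null ?_ ?_)
  · exact serviceLaw_absolutelyContinuous g (measure_singleton _)
  · exact (measureReal_eq_zero_iff).1 hmem

/-- Where `S` vanishes the product is zero whatever `g` is; this is harmless because `g` vanishes
almost everywhere there. -/
theorem ae_hazard_mul_survival (hg : IsServiceDensity g) :
    ∀ᵐ y, 0 ≤ y → ENNReal.ofReal (hazard g y) * ENNReal.ofReal (survival g y) =
      ENNReal.ofReal (g y) := by
  have hm : MeasurableSet {y | survival g y = 0} :=
    (isClosed_eq hg.continuous_survival continuous_const).measurableSet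
  have h0 := hg.serviceLaw_survival_eq_zero
  rw [serviceLaw, withDensity_apply _ hm, Measure.restrict_restrict hm,
    lintegral_eq_zero_iff hg.measurable.ennreal_ofReal, EventuallyEq,
    ae_restrict_iff' (hm.inter measurableSet_Ici)] at h0
  filter_upwards [h0] with y hy hy0
  by_cases hs : survival g y = 0
  · rw [hs, ENNReal.ofReal_zero, mul_zero, hy ⟨hs, hy0⟩, Pi.zero_apply]
  · rw [← ENNReal.ofReal_mul (hg.hazard_nonneg hy0), hazard, div_mul_cancel₀ _ hs]

theorem lintegral_hazard_mul_survival (hg : IsServiceDensity g) {x t : ℝ} (hx : 0 ≤ x)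
    (ht : 0 ≤ t) :
    ∫⁻ s in Ioc 0 t, ENNReal.ofReal (hazard g (x + s)) * ENNReal.ofReal (survival g (x + s)) =
      ENNReal.ofReal (survival g x - survival g (x + t)) := by
  rw [← hg.lintegral_Ioc_density hx ht]
  have h1 : ∀ᵐ s, 0 ≤ x + s → ENNReal.ofReal (hazard g (x + s)) *
      ENNReal.ofReal (survival g (x + s)) = ENNReal.ofReal (g (x + s)) :=
    (measurePreserving_add_left volume x).quasiMeasurePreserving.ae hg.ae_hazard_mul_survival
  refine lintegral_congr_ae ((ae_restrict_iff' measurableSet_Ioc).2 ?_)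
  filter_upwards [h1] with s hs h
  exact hs (by linarith [h.1])

theorem serviceLaw_Iic (hg : IsServiceDensity g) (x : ℝ) :
    serviceLaw g (Iic x) = ENNReal.ofReal (1 - survival g x) := by
  have := hg.isProbabilityMeasure
  rw [survival, ← probReal_compl_eq_one_sub measurableSet_Ioi, compl_Ioi, ofReal_measureReal]

theorem ratio_mem (hg : IsServiceDensity g) {t : ℝ} (ht : 0 ≤ t) (x : ℝ) :
    0 ≤ survival g (x + t) / survival g x ∧ survival g (x + t) / survival g x ≤ 1 :=
  ⟨div_nonneg (survival_nonneg g _) (survival_nonneg g _),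
    div_le_one_of_le₀ (hg.survival_antitone (by linarith)) (survival_nonneg g _)⟩

/-- The convolution of a locally finite measure with the service law. -/
theorem lintegral_one_sub_survival (hg : IsServiceDensity g) (κ : Measure ℝ)
    [IsLocallyFiniteMeasure κ] (t : ℝ) :
    ∫⁻ s in Ioc 0 t, ENNReal.ofReal (1 - survival g (t - s)) ∂κ =
      ∫⁻ u, κ (Ioc 0 (t - u)) ∂(serviceLaw g) := by
  have := hg.isProbabilityMeasure
  have hA : MeasurableSet {p : ℝ × ℝ | p.2 ≤ t - p.1} :=
    measurableSet_le measurable_snd (measurable_const.sub measurable_fst)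
  have e1 : ∀ s, ENNReal.ofReal (1 - survival g (t - s)) =
      ∫⁻ u, {p : ℝ × ℝ | p.2 ≤ t - p.1}.indicator (fun _ => 1) (s, u) ∂(serviceLaw g) := by
    intro s
    rw [← hg.serviceLaw_Iic, ← lintegral_indicator_one measurableSet_Iic]
    rfl
  simp_rw [e1]
  rw [lintegral_lintegral_swap]
  · refine lintegral_congr_ae ((ae_nonneg g).mono fun u hu => ?_)
    have e2 : ∀ s, {p : ℝ × ℝ | p.2 ≤ t - p.1}.indicator (fun _ => (1 : ENNReal)) (s, u) =
        (Iic (t - u)).indicator (fun _ => 1) s := by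
      intro s
      have : (s, u) ∈ {p : ℝ × ℝ | p.2 ≤ t - p.1} ↔ s ∈ Iic (t - u) := by
        simp only [mem_ofPred_eq, mem_Iic]; constructor <;> intro h <;> linarith
      by_cases h : s ∈ Iic (t - u)
      · rw [indicator_of_mem h, indicator_of_mem (this.2 h)]
      · rw [indicator_of_notMem h, indicator_of_notMem (mt this.1 h)]
    simp_rw [e2]
    rw [lintegral_indicator measurableSet_Iic, lintegral_one,
      Measure.restrict_apply_univ, Measure.restrict_apply measurableSet_Iic]
    congr 1
    ext s
    simp only [mem_inter_iff, mem_Iic, mem_Ioc]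
    constructor
    · rintro ⟨h1, h2, h3⟩; exact ⟨h2, h1⟩
    · rintro ⟨h1, h2⟩; exact ⟨h2, h1, by linarith⟩
  · exact ((measurable_const.indicator hA)).aemeasurable

end IsServiceDensity

/-- The part of the initial customers still in service at time `t`. -/
noncomputable def survivors (g : ℝ → ℝ) (m : Measure ℝ) (t : ℝ) : ℝ :=
  ∫ x, survival g (x + t) / survival g x ∂m

theorem lintegral_survivors (hg : IsServiceDensity g) (m : Measure ℝ) [IsFiniteMeasure m]
    {t : ℝ} (ht : 0 ≤ t) :
    ∫⁻ x, ENNReal.ofReal (survival g (x + t) / survival g x) ∂m =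
      ENNReal.ofReal (survivors g m t) := by
  have hsm : Measurable (survival g) := hg.continuous_survival.measurable
  rw [survivors, ofReal_integral_eq_lintegral_ofReal]
  · refine Integrable.of_bound (Measurable.aestronglyMeasurable (by fun_prop)) 1
      (Eventually.of_forall fun x => ?_)
    rw [Real.norm_of_nonneg (hg.ratio_mem ht x).1]
    exact (hg.ratio_mem ht x).2
  · exact Eventually.of_forall fun x => (hg.ratio_mem ht x).1

variable {E : ℝ → ℝ} {X₀ : ℝ} {ν₀ : FiniteMeasure (AgeSpace g)} {X : ℝ → ℝ}
  {ν : ℝ → FiniteMeasure (AgeSpace g)}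

theorem lineMeasure_univ (ν : ℝ → FiniteMeasure (AgeSpace g)) {t : ℝ} (ht : 0 ≤ t) :
    lineMeasure ν t univ = ENNReal.ofReal ((ν t).mass : ℝ) := by
  rw [lineMeasure, (measurableEmbedding_ageSpace g).map_apply, preimage_univ, max_eq_left ht,
    ← FiniteMeasure.ennreal_mass]
  simp

/-- The cumulative entries into service, as the distribution function of a measure. -/
noncomputable def entries (ν : ℝ → FiniteMeasure (AgeSpace g)) (t : ℝ) : ℝ :=
  (stieltjesMeasure (fluidEntries g ν)).real (Ioc 0 t)

theorem entries_nonneg (ν : ℝ → FiniteMeasure (AgeSpace g)) (t : ℝ) : 0 ≤ entries ν t :=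
  measureReal_nonneg

theorem entries_of_nonpos (ν : ℝ → FiniteMeasure (AgeSpace g)) {t : ℝ} (ht : t ≤ 0) :
    entries ν t = 0 := by
  rw [entries, Ioc_eq_empty (not_lt.2 ht)]; simp

theorem entries_mono (ν : ℝ → FiniteMeasure (AgeSpace g)) : Monotone (entries ν) :=
  fun _ _ h => measureReal_mono (Ioc_subset_Ioc_right h) measure_Ioc_lt_top.ne

theorem ofReal_entries (ν : ℝ → FiniteMeasure (AgeSpace g)) (t : ℝ) :
    ENNReal.ofReal (entries ν t) = stieltjesMeasure (fluidEntries g ν) (Ioc 0 t) :=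
  ofReal_measureReal measure_Ioc_lt_top.ne

theorem integrable_entries_sub (hg : IsServiceDensity g) (ν : ℝ → FiniteMeasure (AgeSpace g))
    (t : ℝ) : Integrable (fun u => entries ν (t - u)) (serviceLaw g) := by
  have := hg.isProbabilityMeasure
  have hm := (entries_mono ν).measurable
  refine Integrable.of_bound (Measurable.aestronglyMeasurable (by fun_prop)) (entries ν t)
    ((IsServiceDensity.ae_nonneg g).mono fun u hu => ?_)
  rw [Real.norm_of_nonneg (entries_nonneg ν _)]
  exact entries_mono ν (by linarith)

namespace SolvesFluidEquations

theorem mass_decomposition (hg : IsServiceDensity g) (hs : SolvesFluidEquations g E X₀ ν₀ X ν)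
    {t : ℝ} (ht : 0 ≤ t) :
    ENNReal.ofReal ((ν t).mass : ℝ) = ENNReal.ofReal (survivors g (lineMeasure ν 0) t) +
      ∫⁻ s in Ioc 0 t, ENNReal.ofReal (survival g (t - s))
        ∂(stieltjesMeasure (fluidEntries g ν)) := by
  rw [← lineMeasure_univ ν ht, ← lintegral_one, hs.lintegral_eq hg ht measurable_const,
    ← lintegral_survivors hg _ ht]
  simp

/-- Insert `f = h` in `lintegral_eq` and integrate over time. After Fubini, `h * S = g` integrates
along each characteristic to the probability that service ends by time `t`. -/
theorem lintegral_hazard_decomposition (hg : IsServiceDensity g)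
    (hs : SolvesFluidEquations g E X₀ ν₀ X ν) {t : ℝ} (ht : 0 ≤ t) :
    ∫⁻ p, ENNReal.ofReal (hazard g p.2) ∂(occupation hs.ν_cadlag t) =
      ∫⁻ x, ENNReal.ofReal (1 - survival g (x + t) / survival g x) ∂(lineMeasure ν 0) +
      ∫⁻ s in Ioc 0 t, ENNReal.ofReal (1 - survival g (t - s))
        ∂(stieltjesMeasure (fluidEntries g ν)) := by
  set κ := stieltjesMeasure (fluidEntries g ν) with hκ
  have hsm : Measurable (survival g) := hg.continuous_survival.measurable
  have hhm := hg.measurable_hazard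
  -- Extending `h * S` by zero to negative ages lets the entry time run over the fixed interval
  -- `(0,t]` instead of `(0,s]`, so that Fubini applies on a rectangle.
  set γ : ℝ → ENNReal := (Ici (0 : ℝ)).indicator fun y =>
    ENNReal.ofReal (hazard g y) * ENNReal.ofReal (survival g y) with hγ
  have hγm : Measurable γ := Measurable.indicator (by fun_prop) measurableSet_Ici
  rw [hs.lintegral_occupation t (f := fun p => ENNReal.ofReal (hazard g p.2)) (by fun_prop)]
  have e1 : ∫⁻ s in Ioc 0 t, ∫⁻ x, ENNReal.ofReal (hazard g x) ∂(lineMeasure ν s) =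
      ∫⁻ s in Ioc 0 t, (∫⁻ x, γ (x + s) * ENNReal.ofReal (1 / survival g x) ∂(lineMeasure ν 0) +
        ∫⁻ u in Ioc 0 t, γ (s - u) ∂κ) := by
    refine setLIntegral_congr_fun measurableSet_Ioc fun s h => ?_
    rw [hs.lintegral_eq hg h.1.le (f := fun x => ENNReal.ofReal (hazard g x)) (by fun_prop)]
    congr 1
    · refine lintegral_congr_ae ((ae_mem_ageSet ν 0).mono fun x hx => ?_)
      have hxs : x + s ∈ Ici (0 : ℝ) := add_nonneg hx.1 h.1.le
      simp only [hγ, indicator_of_mem hxs]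
      rw [mul_assoc, ← ENNReal.ofReal_mul (IsServiceDensity.survival_nonneg g _),
        mul_one_div]
    · have hsub : Ioc 0 s = Ioc 0 t ∩ Iic s := by
        ext u; simp only [mem_Ioc, mem_inter_iff, mem_Iic]
        constructor
        · rintro ⟨h1, h2⟩; exact ⟨⟨h1, h2.trans h.2⟩, h2⟩
        · rintro ⟨⟨h1, _⟩, h2⟩; exact ⟨h1, h2⟩
      rw [hsub, inter_comm, ← Measure.restrict_restrict measurableSet_Iic,
        ← lintegral_indicator measurableSet_Iic]
      refine lintegral_congr fun u => ?_
      by_cases hu : u ≤ s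
      · have : s - u ∈ Ici (0 : ℝ) := sub_nonneg.2 hu
        rw [indicator_of_mem (show u ∈ Iic s from hu), hγ, indicator_of_mem this]
      · have : s - u ∉ Ici (0 : ℝ) := fun h => hu (sub_nonneg.1 h)
        rw [indicator_of_notMem (show u ∉ Iic s from hu), hγ, indicator_of_notMem this]
  rw [e1, lintegral_add_left]
  · congr 1
    · rw [lintegral_lintegral_swap (Measurable.aemeasurable (by fun_prop))]
      refine lintegral_congr_ae ((ae_mem_ageSet ν 0).mono fun x hx => ?_)
      have hp := ((hg.mem_ageSet_iff x).1 hx).2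
      simp only
      rw [lintegral_mul_const _ (by fun_prop)]
      have e2 : ∫⁻ s in Ioc 0 t, γ (x + s) =
          ENNReal.ofReal (survival g x - survival g (x + t)) := by
        rw [← hg.lintegral_hazard_mul_survival hx.1 ht]
        refine setLIntegral_congr_fun measurableSet_Ioc fun s h => ?_
        exact indicator_of_mem (show x + s ∈ Ici (0 : ℝ) from add_nonneg hx.1 h.1.le) _
      rw [e2, ← ENNReal.ofReal_mul (sub_nonneg.2 (hg.survival_antitone (by linarith))),
        mul_one_div, sub_div, div_self hp.ne']
    · rw [lintegral_lintegral_swap (Measurable.aemeasurable (by fun_prop))]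
      refine setLIntegral_congr_fun measurableSet_Ioc fun u hu => ?_
      have e3 := hg.lintegral_hazard_mul_survival le_rfl (sub_nonneg.2 hu.2)
      rw [hg.survival_of_nonpos le_rfl] at e3
      simp only [zero_add] at e3
      rw [← e3]
      -- The function `γ` lives on the closed half-line, so the two sides differ only at `s = u`, a
      -- null set.
      have e4 : ∫⁻ s in Ioc 0 t, γ (s - u) = ∫⁻ s in Ioc u t, γ (s - u) := by
        rw [← lintegral_indicator measurableSet_Ioc, ← lintegral_indicator measurableSet_Ioc]
        refine lintegral_congr_ae ?_
        filter_upwards [compl_mem_ae_iff.2 (measure_singleton (μ := volume) u)] with s hsu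
        by_cases h1 : s ∈ Ioc u t
        · have : s ∈ Ioc 0 t := ⟨hu.1.trans h1.1, h1.2⟩
          rw [indicator_of_mem h1, indicator_of_mem this]
        · rw [indicator_of_notMem h1]
          by_cases h2 : s ∈ Ioc 0 t
          · rw [indicator_of_mem h2]
            refine indicator_of_notMem (fun h3 => h1 ⟨lt_of_le_of_ne (sub_nonneg.1 h3) ?_, h2.2⟩) _
            exact fun h => hsu h.symm
          · rw [indicator_of_notMem h2]
      rw [e4]
      have hp : MeasurePreserving (fun s : ℝ => s - u) volume volume :=
        measurePreserving_sub_right volume u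
      have e5 := hp.setLIntegral_comp_preimage_emb (measurableEmbedding_subRight u)
        γ (Ioc 0 (t - u))
      have e6 : (fun s : ℝ => s - u) ⁻¹' Ioc 0 (t - u) = Ioc u t := by
        ext s; simp
      rw [e6] at e5
      rw [e5]
      refine setLIntegral_congr_fun measurableSet_Ioc fun s h => ?_
      exact indicator_of_mem (show s ∈ Ici (0 : ℝ) from h.1.le) _
  · exact Measurable.lintegral_prod_right' (f := fun p : ℝ × ℝ =>
      γ (p.2 + p.1) * ENNReal.ofReal (1 / survival g p.2)) (by fun_prop)

theorem ofReal_fluidDepartures (hg : IsServiceDensity g)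
    (hs : SolvesFluidEquations g E X₀ ν₀ X ν) {t : ℝ} (ht : 0 ≤ t) :
    0 ≤ fluidDepartures g ν t ∧ ENNReal.ofReal (fluidDepartures g ν t) =
      ∫⁻ p, ENNReal.ofReal (hazard g p.2) ∂(occupation hs.ν_cadlag t) := by
  have hnn : ∀ᵐ p ∂(occupation hs.ν_cadlag t), 0 ≤ hazard g p.2 :=
    (hs.ae_occupation t).mono fun p hp => hg.hazard_nonneg hp.2.1
  have e : fluidDepartures g ν t = ∫ p, hazard g p.2 ∂(occupation hs.ν_cadlag t) := by
    rw [hs.integral_occupation ht (hs.integrable_hazard hg ht), fluidDepartures]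
    refine intervalIntegral.integral_congr fun s h => ?_
    rw [uIcc_of_le ht] at h
    simp only
    rw [integral_lineMeasure ν h.1 (hazard g)]
    refine integral_congr_ae (Eventually.of_forall fun x => ?_)
    simp only
    rw [hg.hazard_eq x.2.1]
  rw [e]
  exact ⟨integral_nonneg_of_ae hnn,
    ofReal_integral_eq_lintegral_ofReal (hs.integrable_hazard hg ht) hnn⟩

theorem integral_entries_sub (hg : IsServiceDensity g) (ν : ℝ → FiniteMeasure (AgeSpace g))
    (t : ℝ) : ENNReal.ofReal (∫ u, entries ν (t - u) ∂(serviceLaw g)) =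
      ∫⁻ s in Ioc 0 t, ENNReal.ofReal (1 - survival g (t - s))
        ∂(stieltjesMeasure (fluidEntries g ν)) := by
  rw [hg.lintegral_one_sub_survival, ofReal_integral_eq_lintegral_ofReal
    (integrable_entries_sub hg ν t) (Eventually.of_forall fun _ => entries_nonneg ν _)]
  simp_rw [ofReal_entries]

theorem survivors_le (hg : IsServiceDensity g) (ν : ℝ → FiniteMeasure (AgeSpace g)) {t : ℝ}
    (ht : 0 ≤ t) : 0 ≤ survivors g (lineMeasure ν 0) t ∧
      ENNReal.ofReal (survivors g (lineMeasure ν 0) t) +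
        ∫⁻ x, ENNReal.ofReal (1 - survival g (x + t) / survival g x) ∂(lineMeasure ν 0) =
          ENNReal.ofReal ((ν 0).mass : ℝ) := by
  have hsm : Measurable (survival g) := hg.continuous_survival.measurable
  refine ⟨integral_nonneg fun x => (hg.ratio_mem ht x).1, ?_⟩
  rw [← lintegral_survivors hg _ ht, ← lintegral_add_left (by fun_prop),
    ← lineMeasure_univ ν le_rfl, ← lintegral_one]
  refine lintegral_congr fun x => ?_
  obtain ⟨h1, h2⟩ := hg.ratio_mem ht x
  rw [← ENNReal.ofReal_add h1 (by linarith), add_sub_cancel, ENNReal.ofReal_one]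

/-- The cumulative departures in terms of the cumulative entries. -/
theorem fluidDepartures_eq (hg : IsServiceDensity g) (hs : SolvesFluidEquations g E X₀ ν₀ X ν)
    {t : ℝ} (ht : 0 ≤ t) :
    fluidDepartures g ν t = ((ν 0).mass : ℝ) - survivors g (lineMeasure ν 0) t +
      ∫ u, entries ν (t - u) ∂(serviceLaw g) := by
  obtain ⟨h1, h2⟩ := survivors_le hg ν ht
  obtain ⟨h3, h4⟩ := hs.ofReal_fluidDepartures hg ht
  have h5 : 0 ≤ ∫ u, entries ν (t - u) ∂(serviceLaw g) :=
    integral_nonneg fun _ => entries_nonneg ν _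
  rw [hs.lintegral_hazard_decomposition hg ht, ← integral_entries_sub hg] at h4
  have h6 : ENNReal.ofReal (survivors g (lineMeasure ν 0) t + fluidDepartures g ν t) =
      ENNReal.ofReal (((ν 0).mass : ℝ) + ∫ u, entries ν (t - u) ∂(serviceLaw g)) := by
    rw [ENNReal.ofReal_add h1 h3, h4, ← add_assoc, h2, ENNReal.ofReal_add (by positivity) h5]
  rw [ENNReal.ofReal_eq_ofReal_iff (by positivity) (by positivity)] at h6
  linarith

/-- The mass in service in terms of the cumulative entries. -/
theorem mass_eq (hg : IsServiceDensity g) (hs : SolvesFluidEquations g E X₀ ν₀ X ν)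
    {t : ℝ} (ht : 0 ≤ t) :
    ((ν t).mass : ℝ) = survivors g (lineMeasure ν 0) t + entries ν t -
      ∫ u, entries ν (t - u) ∂(serviceLaw g) := by
  have hsm : Measurable (survival g) := hg.continuous_survival.measurable
  obtain ⟨h1, -⟩ := survivors_le hg ν ht
  have h5 : 0 ≤ ∫ u, entries ν (t - u) ∂(serviceLaw g) :=
    integral_nonneg fun _ => entries_nonneg ν _
  have h2 := hs.mass_decomposition hg ht
  have h6 : ENNReal.ofReal (((ν t).mass : ℝ) + ∫ u, entries ν (t - u) ∂(serviceLaw g)) =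
      ENNReal.ofReal (survivors g (lineMeasure ν 0) t + entries ν t) := by
    rw [ENNReal.ofReal_add (by positivity) h5, h2, integral_entries_sub hg, add_assoc,
      ← lintegral_add_left (by fun_prop), ENNReal.ofReal_add h1 (entries_nonneg ν t),
      ofReal_entries]
    congr 1
    rw [← setLIntegral_one]
    refine lintegral_congr fun s => ?_
    rw [← ENNReal.ofReal_add (IsServiceDensity.survival_nonneg g _)
      (sub_nonneg.2 (hg.survival_le_one _)), add_sub_cancel, ENNReal.ofReal_one]
  rw [ENNReal.ofReal_eq_ofReal_iff (by positivity) (add_nonneg h1 (entries_nonneg ν t))] at h6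
  linarith

/-- Adding the balances for mass and departures, the survivors and the convolution cancel. In
particular `K` is nondecreasing a posteriori: the default value `0` of `stieltjesMeasure` would give
`K = 0`, which is itself monotone. So monotonicity never had to be assumed. -/
theorem fluidEntries_eq (hg : IsServiceDensity g) (hs : SolvesFluidEquations g E X₀ ν₀ X ν)
    {t : ℝ} (ht : 0 ≤ t) : fluidEntries g ν t = entries ν t := by
  rw [fluidEntries, hs.fluidDepartures_eq hg ht, hs.mass_eq hg ht]
  ring

/-- The entries into service over a bounded period are uniformly bounded. -/
theorem survival_mul_entries_le (hg : IsServiceDensity g)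
    (hs : SolvesFluidEquations g E X₀ ν₀ X ν) {a : ℝ} (ha : 0 ≤ a) (t : ℝ) :
    survival g a * (entries ν (t + a) - entries ν t) ≤ 1 := by
  set κ := stieltjesMeasure (fluidEntries g ν) with hκ
  have hsm : Measurable (survival g) := hg.continuous_survival.measurable
  rcases le_total (t + a) 0 with h | h
  · rw [entries_of_nonpos ν h, entries_of_nonpos ν (by linarith)]
    simp
  have hnn : 0 ≤ entries ν (t + a) - entries ν t := sub_nonneg.2 (entries_mono ν (by linarith))
  have e1 : ENNReal.ofReal (entries ν (t + a) - entries ν t) = κ (Ioc 0 (t + a) \ Ioc 0 t) := by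
    rw [entries, entries, ← measureReal_sdiff (Ioc_subset_Ioc_right (by linarith))
      measurableSet_Ioc measure_Ioc_lt_top.ne, ofReal_measureReal
      (ne_top_of_le_ne_top measure_Ioc_lt_top.ne (measure_mono sdiff_subset))]
  have h2 : ENNReal.ofReal (survival g a * (entries ν (t + a) - entries ν t)) ≤
      ENNReal.ofReal 1 := by
    rw [ENNReal.ofReal_mul (IsServiceDensity.survival_nonneg g _), e1]
    calc _ = ∫⁻ s in Ioc 0 (t + a) \ Ioc 0 t, ENNReal.ofReal (survival g a) ∂κ := by
          rw [setLIntegral_const]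
      -- Fluid that entered during `(t, t + a]` has age at most `a` at time `t + a`, so at least the
      -- fraction `S a` of it is still in service, where the capacity is `1`.
      _ ≤ ∫⁻ s in Ioc 0 (t + a) \ Ioc 0 t, ENNReal.ofReal (survival g (t + a - s)) ∂κ := by
          refine setLIntegral_mono (by fun_prop) fun s hs' => ?_
          refine ENNReal.ofReal_le_ofReal (hg.survival_antitone ?_)
          have : t < s := by
            by_contra hc
            exact hs'.2 ⟨hs'.1.1, not_lt.1 hc⟩
          linarith
      _ ≤ ∫⁻ s in Ioc 0 (t + a), ENNReal.ofReal (survival g (t + a - s)) ∂κ :=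
          lintegral_mono_set sdiff_subset
      _ ≤ ENNReal.ofReal ((ν (t + a)).mass : ℝ) := by
          rw [hs.mass_decomposition hg h]; exact le_add_self
      _ ≤ ENNReal.ofReal 1 := ENNReal.ofReal_le_ofReal (hs.mass_le_one _ h)
  exact (ENNReal.ofReal_le_ofReal_iff one_pos.le).1 h2

end SolvesFluidEquations

end

/-! ### The queue, the mass for an empty start, and the long-run entry rate. -/

section

variable {g : ℝ → ℝ}

/-- The distribution function of the equilibrium law with density `1 - G`. -/
noncomputable def meanSurvival (g : ℝ → ℝ) (t : ℝ) : ℝ := ∫ s in (0 : ℝ)..t, survival g s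

namespace IsServiceDensity

/-- Layer-cake formula: the integral of the survival function is the mean. -/
theorem lintegral_survival (hg : IsServiceDensity g) :
    ∫⁻ x in Ioi 0, ENNReal.ofReal (survival g x) = 1 := by
  have := hg.isProbabilityMeasure
  have h1 := lintegral_eq_lintegral_meas_lt (serviceLaw g) (f := fun s => s) (ae_nonneg g)
    aemeasurable_id
  rw [← ofReal_integral_eq_lintegral_ofReal hg.integrable_id_serviceLaw (ae_nonneg g),
    hg.integral_id_serviceLaw, ENNReal.ofReal_one] at h1
  rw [h1]
  refine lintegral_congr fun x => ?_
  rw [survival, ofReal_measureReal]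
  rfl

theorem integrableOn_survival (hg : IsServiceDensity g) : IntegrableOn (survival g) (Ioi 0) := by
  refine ⟨hg.continuous_survival.aestronglyMeasurable, ?_⟩
  rw [hasFiniteIntegral_iff_ofReal (Eventually.of_forall (survival_nonneg g)),
    hg.lintegral_survival]
  exact ENNReal.one_lt_top

theorem integral_survival (hg : IsServiceDensity g) : ∫ x in Ioi 0, survival g x = 1 := by
  rw [integral_eq_lintegral_of_nonneg_ae (Eventually.of_forall (survival_nonneg g))
    hg.continuous_survival.aestronglyMeasurable, hg.lintegral_survival, ENNReal.toReal_one]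

theorem tendsto_meanSurvival (hg : IsServiceDensity g) :
    Tendsto (meanSurvival g) atTop (𝓝 1) := by
  rw [← hg.integral_survival]
  exact intervalIntegral_tendsto_integral_Ioi 0 hg.integrableOn_survival tendsto_id

theorem meanSurvival_mono (hg : IsServiceDensity g) : Monotone (meanSurvival g) := by
  intro x y hxy
  have hi : ∀ a b, IntervalIntegrable (survival g) volume a b :=
    fun a b => hg.continuous_survival.intervalIntegrable a b
  have h := intervalIntegral.integral_nonneg hxy (fun u _ => survival_nonneg g u)
    (μ := volume)
  have := intervalIntegral.integral_add_adjacent_intervals (hi 0 x) (hi x y)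
  simp only [meanSurvival]
  linarith

theorem meanSurvival_le_one (hg : IsServiceDensity g) (t : ℝ) : meanSurvival g t ≤ 1 :=
  hg.meanSurvival_mono.ge_of_tendsto hg.tendsto_meanSurvival t

/-- Since `S` is antitone, `t * S t ≤ ∫₀ᵗ S ≤ 1`. -/
theorem tendsto_survival (hg : IsServiceDensity g) : Tendsto (survival g) atTop (𝓝 0) := by
  refine squeeze_zero' (Eventually.of_forall (survival_nonneg g)) ?_
    (tendsto_inv_atTop_zero (𝕜 := ℝ))
  filter_upwards [eventually_gt_atTop 0] with t ht
  have h1 := intervalIntegral.integral_mono_on ht.le (intervalIntegrable_const (c := survival g t))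
    (hg.continuous_survival.intervalIntegrable (μ := volume) 0 t)
    (fun s hs => hg.survival_antitone hs.2)
  have h2 := hg.meanSurvival_le_one t
  simp only [meanSurvival] at h2
  simp only [intervalIntegral.integral_const, sub_zero, smul_eq_mul] at h1
  rw [← one_div, le_div_iff₀ ht]
  linarith

theorem tendsto_survivors (hg : IsServiceDensity g) (m : Measure ℝ) [IsFiniteMeasure m] :
    Tendsto (survivors g m) atTop (𝓝 0) := by
  have hsm : Measurable (survival g) := hg.continuous_survival.measurable
  rw [← integral_zero ℝ ℝ (μ := m)]
  refine tendsto_integral_filter_of_dominated_convergence (fun _ => 1)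
    (Eventually.of_forall fun t => Measurable.aestronglyMeasurable (by fun_prop)) ?_
    (integrable_const _) (Eventually.of_forall fun x => ?_)
  · filter_upwards [eventually_ge_atTop 0] with t ht
    refine Eventually.of_forall fun x => ?_
    rw [Real.norm_of_nonneg (hg.ratio_mem ht x).1]
    exact (hg.ratio_mem ht x).2
  · have := (hg.tendsto_survival.comp (tendsto_atTop_add_const_left _ x tendsto_id)).div_const
      (survival g x)
    simpa using this

/-- This is `lintegral_one_sub_survival` for Lebesgue measure: it computes the convolution of the
arrival process with the service law, up to the factor `λ`. -/
theorem integral_posPart_sub (hg : IsServiceDensity g) {t : ℝ} (ht : 0 ≤ t) :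
    ∫ u, max (t - u) 0 ∂(serviceLaw g) = t - meanSurvival g t := by
  have hsc := hg.continuous_survival
  have h1 := hg.lintegral_one_sub_survival volume t
  have h2 : ∫⁻ s in Ioc 0 t, ENNReal.ofReal (1 - survival g (t - s)) =
      ENNReal.ofReal (t - meanSurvival g t) := by
    rw [← ofReal_integral_eq_lintegral_ofReal]
    · have hi : IntervalIntegrable (fun s => survival g (t - s)) volume 0 t :=
        Continuous.intervalIntegrable (by fun_prop) _ _
      rw [← intervalIntegral.integral_of_le ht, intervalIntegral.integral_sub (by simp) hi,
        intervalIntegral.integral_comp_sub_left (survival g)]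
      simp [meanSurvival]
    · exact (Continuous.integrableOn_Icc (by fun_prop)).mono_set Ioc_subset_Icc_self
    · exact Eventually.of_forall fun s => sub_nonneg.2 (hg.survival_le_one _)
  rw [integral_eq_lintegral_of_nonneg_ae (Eventually.of_forall fun u => (le_max_right _ _ : (0 : ℝ) ≤ max (t - u) 0))
    (by fun_prop)]
  have h3 : ∀ u, ENNReal.ofReal (max (t - u) 0) = volume (Ioc 0 (t - u)) := fun u => by
    rw [Real.volume_Ioc, sub_zero, ENNReal.ofReal_max]; simp
  simp_rw [h3]
  rw [← h1, h2, ENNReal.toReal_ofReal]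
  have : meanSurvival g t ≤ ∫ s in (0 : ℝ)..t, (1 : ℝ) :=
    intervalIntegral.integral_mono_on ht (hsc.intervalIntegrable _ _) (by simp)
      fun s _ => hg.survival_le_one s
  simpa using this

end IsServiceDensity

/-- The fluid queue length `[X - 1]⁺`, in terms of the cumulative entries. -/
noncomputable def queueLength (lam X₀ : ℝ) (ν : ℝ → FiniteMeasure (AgeSpace g)) (t : ℝ) : ℝ :=
  lam * max t 0 + (Ici 0).indicator (fun _ => max (X₀ - 1) 0) t - entries ν t

namespace SolvesFluidEquations

variable {lam : ℝ} {X₀ : ℝ} {ν₀ : FiniteMeasure (AgeSpace g)} {X : ℝ → ℝ}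
  {ν : ℝ → FiniteMeasure (AgeSpace g)}

theorem mass_eq_min {E : ℝ → ℝ} (hs : SolvesFluidEquations g E X₀ ν₀ X ν) {t : ℝ} (ht : 0 ≤ t) :
    ((ν t).mass : ℝ) = min (X t) 1 := by
  have := hs.nonidling t ht
  rcases le_total (X t) 1 with h | h
  · rw [max_eq_left (by linarith)] at this
    rw [min_eq_left h]; linarith
  · rw [max_eq_right (by linarith)] at this
    rw [min_eq_right h]; linarith

/-- The non-idling condition makes the mass `min X 1`, so what has arrived but not entered service
is exactly `X - min X 1`. -/
theorem queueLength_eq (hg : IsServiceDensity g)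
    (hs : SolvesFluidEquations g (fun t => lam * t) X₀ ν₀ X ν) {t : ℝ} (ht : 0 ≤ t) :
    queueLength lam X₀ ν t = max (X t - 1) 0 := by
  have h1 := hs.fluidEntries_eq hg ht
  have h2 := hs.balance t ht
  have h3 := hs.mass_eq_min ht
  have h4 := hs.mass_eq_min le_rfl
  have hsub : ∀ y : ℝ, y - min y 1 = max (y - 1) 0 := fun y => by
    rcases le_total y 1 with h | h
    · rw [min_eq_left h, max_eq_right (by linarith), sub_self]
    · rw [min_eq_right h, max_eq_left (by linarith)]
  rw [hs.X_init] at h4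
  simp only [fluidEntries] at h1
  rw [queueLength, max_eq_left ht, indicator_of_mem (show t ∈ Ici (0 : ℝ) from ht), ← h1,
    ← hsub, ← hsub]
  linarith

theorem queueLength_of_neg {t : ℝ} (ht : t < 0) : queueLength lam X₀ ν t = 0 := by
  rw [queueLength, max_eq_right ht.le, indicator_of_notMem (show t ∉ Ici (0 : ℝ) from not_le.2 ht),
    entries_of_nonpos ν ht.le]
  simp

theorem queueLength_nonneg (hg : IsServiceDensity g)
    (hs : SolvesFluidEquations g (fun t => lam * t) X₀ ν₀ X ν) (t : ℝ) :
    0 ≤ queueLength lam X₀ ν t := by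
  rcases lt_or_ge t 0 with h | h
  · rw [queueLength_of_neg h]
  · rw [hs.queueLength_eq hg h]; exact le_max_right _ _

/-- The renewal equation for the number of customers. -/
theorem X_eq (hg : IsServiceDensity g)
    (hs : SolvesFluidEquations g (fun t => lam * t) X₀ ν₀ X ν) {t : ℝ} (ht : 0 ≤ t) :
    X t = survivors g (lineMeasure ν 0) t + max (X₀ - 1) 0 * survival g t +
      lam * meanSurvival g t + ∫ u, queueLength lam X₀ ν (t - u) ∂(serviceLaw g) := by
  have := hg.isProbabilityMeasure
  have h2 := hs.balance t ht
  have h4 := hs.mass_eq_min le_rfl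
  rw [hs.X_init] at h4
  have i1 : Integrable (fun u => lam * max (t - u) 0) (serviceLaw g) := by
    refine Integrable.const_mul ?_ _
    exact ((integrable_const t).sub hg.integrable_id_serviceLaw).sup (integrable_zero _ _ _)
  have i2 : Integrable (fun u => (Ici (0 : ℝ)).indicator (fun _ => max (X₀ - 1) 0) (t - u))
      (serviceLaw g) := by
    refine Integrable.of_bound (Measurable.aestronglyMeasurable ?_) (max (X₀ - 1) 0)
      (Eventually.of_forall fun u => ?_)
    · exact (measurable_const.indicator measurableSet_Ici).comp (measurable_const.sub measurable_id)
    · rw [Real.norm_of_nonneg (indicator_nonneg (fun _ _ => le_max_right _ _) _)]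
      exact indicator_le_self' (fun _ _ => le_max_right _ _) _
  have e2 : ∫ u, (Ici (0 : ℝ)).indicator (fun _ => max (X₀ - 1) 0) (t - u) ∂(serviceLaw g) =
      max (X₀ - 1) 0 * (1 - survival g t) := by
    have e3 : ∀ u, (Ici (0 : ℝ)).indicator (fun _ => max (X₀ - 1) 0) (t - u) =
        (Iic t).indicator (fun _ => max (X₀ - 1) 0) u := fun u => by
      by_cases h : u ≤ t
      · rw [indicator_of_mem (show t - u ∈ Ici (0 : ℝ) from sub_nonneg.2 h),
          indicator_of_mem (show u ∈ Iic t from h)]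
      · rw [indicator_of_notMem (show t - u ∉ Ici (0 : ℝ) from fun h' => h (sub_nonneg.1 h')),
          indicator_of_notMem (show u ∉ Iic t from h)]
    simp_rw [e3]
    rw [integral_indicator measurableSet_Iic, setIntegral_const, Measure.real, hg.serviceLaw_Iic,
      ENNReal.toReal_ofReal (sub_nonneg.2 (hg.survival_le_one _)), smul_eq_mul, mul_comm]
  -- Convolving the definition of the queue expresses the convolved entries through the convolved
  -- queue. Subtracted from `λ t + [X₀-1]⁺`, the arrivals leave `λ ∫₀ᵗ S` and the initial queue
  -- leaves `[X₀-1]⁺ S`.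
  have e : ∫ u, queueLength lam X₀ ν (t - u) ∂(serviceLaw g) =
      lam * (t - meanSurvival g t) + max (X₀ - 1) 0 * (1 - survival g t) -
        ∫ u, entries ν (t - u) ∂(serviceLaw g) := by
    simp only [queueLength]
    have i3 : Integrable (fun u => lam * max (t - u) 0 +
        (Ici (0 : ℝ)).indicator (fun _ => max (X₀ - 1) 0) (t - u)) (serviceLaw g) := i1.add i2
    rw [integral_sub i3 (integrable_entries_sub hg ν t), integral_add i1 i2,
      integral_const_mul, hg.integral_posPart_sub ht, e2]
  have hsub : X₀ - min X₀ 1 = max (X₀ - 1) 0 := by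
    rcases le_total X₀ 1 with h | h
    · rw [min_eq_left h, max_eq_right (by linarith), sub_self]
    · rw [min_eq_right h, max_eq_left (by linarith)]
  rw [h2, hs.fluidDepartures_eq hg ht, e, h4]
  linear_combination hsub

/-- All other terms of the renewal equation `X_eq` are nonnegative. -/
theorem lam_mul_meanSurvival_le (hg : IsServiceDensity g)
    (hs : SolvesFluidEquations g (fun t => lam * t) X₀ ν₀ X ν) {t : ℝ} (ht : 0 ≤ t) :
    lam * meanSurvival g t ≤ X t := by
  rw [hs.X_eq hg ht]
  have h1 := (survivors_le hg ν ht).1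
  have h2 : 0 ≤ max (X₀ - 1) 0 * survival g t :=
    mul_nonneg (le_max_right _ _) (IsServiceDensity.survival_nonneg g t)
  have h3 : 0 ≤ ∫ u, queueLength lam X₀ ν (t - u) ∂(serviceLaw g) :=
    integral_nonneg fun u => hs.queueLength_nonneg hg _
  linarith

theorem mass_zero (hs : SolvesFluidEquations g (fun t => lam * t) 0 ν₀ X ν) :
    lineMeasure ν 0 = 0 := by
  rw [← Measure.measure_univ_eq_zero, lineMeasure_univ ν le_rfl, hs.mass_eq_min le_rfl, hs.X_init]
  simp

/-- Starting from an empty system, there is no queue as long as the equilibrium distribution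
function, scaled by the arrival rate, does not exceed the capacity. -/
theorem queueLength_eq_zero (hg : IsServiceDensity g) (hlam : 0 < lam)
    (hs : SolvesFluidEquations g (fun t => lam * t) 0 ν₀ X ν) {t : ℝ}
    (hI : lam * meanSurvival g t ≤ 1) : queueLength lam 0 ν t = 0 := by
  have := hg.isProbabilityMeasure
  have hbd : ∀ s, s ≤ t → queueLength lam 0 ν s ≤ lam * max t 0 := fun s h => by
    simp only [queueLength]
    have h1 := entries_nonneg ν s
    have h2 : (Ici (0 : ℝ)).indicator (fun _ => max ((0 : ℝ) - 1) 0) s = 0 := by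
      simp [indicator]
    have h3 : lam * max s 0 ≤ lam * max t 0 := by gcongr
    linarith
  refine eq_zero_of_le_convolution (IsServiceDensity.serviceLaw_absolutelyContinuous g)
    (IsServiceDensity.ae_nonneg g) (hs.queueLength_nonneg hg) hbd
    (fun s h => queueLength_of_neg h) (fun s h0 hst => ?_) le_rfl
  -- Up to time `t` the arrival term of `X_eq` is at most the capacity `1`, so `Q = [X-1]⁺` is at
  -- most the convolution of `Q`, and the renewal inequality forces `Q = 0`.
  rw [hs.queueLength_eq hg h0, hs.X_eq hg h0, hs.mass_zero]
  have h1 : lam * meanSurvival g s ≤ lam * meanSurvival g t := by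
    gcongr; exact hg.meanSurvival_mono hst
  have h3 : 0 ≤ ∫ u, queueLength lam 0 ν (s - u) ∂(serviceLaw g) :=
    integral_nonneg fun u => hs.queueLength_nonneg hg _
  have h4 : max ((0 : ℝ) - 1) 0 = 0 := by norm_num
  rw [h4]
  simp only [survivors, integral_zero_measure]
  exact max_le (by linarith) h3

theorem X_eq_of_le (hg : IsServiceDensity g) (hlam : 0 < lam)
    (hs : SolvesFluidEquations g (fun t => lam * t) 0 ν₀ X ν) {t : ℝ} (ht : 0 ≤ t)
    (hI : lam * meanSurvival g t ≤ 1) : X t = lam * meanSurvival g t := by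
  rw [hs.X_eq hg ht, hs.mass_zero]
  have h4 : max ((0 : ℝ) - 1) 0 = 0 := by norm_num
  have h5 : ∫ u, queueLength lam 0 ν (t - u) ∂(serviceLaw g) = 0 := by
    refine integral_eq_zero_of_ae ((IsServiceDensity.ae_nonneg g).mono fun u hu => ?_)
    refine hs.queueLength_eq_zero hg hlam (le_trans ?_ hI)
    gcongr
    exact hg.meanSurvival_mono (by linarith)
  rw [h5, h4]
  simp [survivors]

/-- While `λ I ≤ 1`, for `I = meanSurvival g`, one has `X = λ I`. Afterwards `X ≥ λ I ≥ 1`, and both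
minima equal `1`. -/
theorem mass_eq_of_empty (hg : IsServiceDensity g) (hlam : 0 < lam)
    (hs : SolvesFluidEquations g (fun t => lam * t) 0 ν₀ X ν) {t : ℝ} (ht : 0 ≤ t) :
    ((ν t).mass : ℝ) = min (lam * meanSurvival g t) 1 := by
  rw [hs.mass_eq_min ht]
  rcases le_total (lam * meanSurvival g t) 1 with h | h
  · rw [hs.X_eq_of_le hg hlam ht h]
  · rw [min_eq_right h, min_eq_right (h.trans (hs.lam_mul_meanSurvival_le hg ht))]

theorem entries_eq_of_empty (hg : IsServiceDensity g) (hlam : 0 < lam) (hlam1 : lam ≤ 1)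
    (hs : SolvesFluidEquations g (fun t => lam * t) 0 ν₀ X ν) {t : ℝ} (ht : 0 ≤ t) :
    entries ν t = lam * t := by
  have h1 : lam * meanSurvival g t ≤ 1 := by
    have := hg.meanSurvival_le_one t
    nlinarith
  have h2 := hs.queueLength_eq_zero hg hlam h1
  simp only [queueLength, max_eq_left ht, indicator] at h2
  have h4 : max ((0 : ℝ) - 1) 0 = 0 := by norm_num
  rw [h4] at h2
  simp at h2
  linarith

/-- For `λ ≥ 1` the mass `min X 1` lies between `meanSurvival g` and `1`, whatever the initial
state. -/
theorem tendsto_mass (hg : IsServiceDensity g) (hlam : 1 ≤ lam)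
    (hs : SolvesFluidEquations g (fun t => lam * t) X₀ ν₀ X ν) :
    Tendsto (fun t => ((ν t).mass : ℝ)) atTop (𝓝 1) := by
  refine tendsto_of_tendsto_of_tendsto_of_le_of_le' hg.tendsto_meanSurvival
    tendsto_const_nhds ?_ ?_
  · filter_upwards [eventually_ge_atTop 0] with t ht
    rw [hs.mass_eq_min ht]
    refine le_min ((?_ : _ ≤ _).trans (hs.lam_mul_meanSurvival_le hg ht)) (hg.meanSurvival_le_one t)
    have : 0 ≤ meanSurvival g t := by
      have := hg.meanSurvival_mono ht
      simpa [meanSurvival] using this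
    nlinarith
  · filter_upwards [eventually_ge_atTop 0] with t ht
    exact hs.mass_le_one t ht

/-- In the long run, customers enter service at rate `1`. -/
theorem tendsto_entries (hg : IsServiceDensity g) (hlam : 1 ≤ lam)
    (hs : SolvesFluidEquations g (fun t => lam * t) X₀ ν₀ X ν) (a : ℝ) :
    Tendsto (fun t => entries ν (t + a) - entries ν t) atTop (𝓝 a) := by
  have := hg.isProbabilityMeasure
  obtain ⟨a₀, ha₀, hra⟩ : ∃ a₀, 0 < a₀ ∧ 1 / 2 < survival g a₀ := by
    have h0 : (1 : ℝ) / 2 < survival g 0 := by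
      rw [hg.survival_of_nonpos le_rfl]; norm_num
    have h1 : ∀ᶠ y in 𝓝[>] (0 : ℝ), 1 / 2 < survival g y :=
      (hg.continuous_survival.continuousAt.eventually (lt_mem_nhds h0)).filter_mono
        nhdsWithin_le_nhds
    obtain ⟨y, hy1, hy2⟩ := (h1.and self_mem_nhdsWithin).exists
    exact ⟨y, hy2, hy1⟩
  -- The choice `S a₀ > 1/2` bounds the entries over a period of length `a₀` by `C = 2`. The limit
  -- hypothesis holds because `K - K * g` is the mass minus the survivors, which tends to `1 - 0`.
  refine tendsto_increment (IsServiceDensity.serviceLaw_absolutelyContinuous g)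
    hg.integrable_id_serviceLaw (IsServiceDensity.ae_nonneg g) hg.integral_id_serviceLaw
    (entries_mono ν) ha₀ (C := 2) (fun t => ?_) ?_ a
  · have h1 := hs.survival_mul_entries_le hg ha₀.le t
    have h2 : 0 ≤ entries ν (t + a₀) - entries ν t := sub_nonneg.2 (entries_mono ν (by linarith))
    nlinarith
  · have h1 := (hs.tendsto_mass hg hlam).sub (hg.tendsto_survivors (lineMeasure ν 0))
    rw [sub_zero] at h1
    refine h1.congr' ?_
    filter_upwards [eventually_ge_atTop 0] with t ht
    rw [integral_sub (integrable_const _) (integrable_entries_sub hg ν t), hs.mass_eq hg ht]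
    simp
    ring

end SolvesFluidEquations

end

/-! ### From entry increments to weak convergence. -/

section

/-- If the increments of the distribution function of `κ` converge to those of Lebesgue measure,
then the integrals of a lower semicontinuous function against `κ`, seen from the far right,
are asymptotically at least its Lebesgue integral. -/
theorem eventually_lt_lintegral_comp_sub {κ : Measure ℝ} [IsLocallyFiniteMeasure κ]
    (hκ : ∀ a, Tendsto (fun t => κ.real (Ioc 0 (t + a)) - κ.real (Ioc 0 t)) atTop (𝓝 a))
    {F : ℝ → ENNReal}
    (hlsc : ∀ x, 0 ≤ x → ∀ b < F x, ∀ᶠ y in 𝓝[Ici 0] x, b < F y) {b : ENNReal}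
    (hb : b < ∫⁻ x in Ici 0, F x) :
    ∀ᶠ t in atTop, b < ∫⁻ s in Ioc 0 t, F (t - s) ∂κ := by
  -- Infima of `F` over the cells of mesh `1 / (n + 1)`. Lower semicontinuity makes these step
  -- functions recover `F` in the limit inferior, and Fatou's lemma then selects a mesh whose lower
  -- sum still exceeds `b`.
  let a : ℕ → ℕ → ENNReal := fun n j =>
    ⨅ y ∈ Icc ((j : ℝ) / ((n : ℝ) + 1)) (((j : ℝ) + 1) / ((n : ℝ) + 1)), F y
  let q : ℕ → ℝ → ℕ := fun n x => ⌊x * ((n : ℝ) + 1)⌋₊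
  have hq : ∀ n, Measurable (q n) := fun n =>
    Nat.measurable_floor.comp (measurable_id.mul measurable_const)
  have hqx : ∀ n x, 0 ≤ x → ∀ j, q n x = j ↔
      x ∈ Ico ((j : ℝ) / ((n : ℝ) + 1)) (((j : ℝ) + 1) / ((n : ℝ) + 1)) := by
    intro n x hx j
    have hn : (0 : ℝ) < (n : ℝ) + 1 := by positivity
    rw [mem_Ico, div_le_iff₀ hn, lt_div_iff₀ hn]
    exact Nat.floor_eq_iff (by positivity)
  have haF : ∀ n x, 0 ≤ x → a n (q n x) ≤ F x := fun n x hx =>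
    iInf₂_le x (Ico_subset_Icc_self ((hqx n x hx _).1 rfl))
  have hlim : ∀ x, 0 ≤ x → F x ≤ liminf (fun n => a n (q n x)) atTop := by
    intro x hx
    refine le_of_forall_lt fun b hb => ?_
    obtain ⟨b', hb', hb''⟩ := exists_between hb
    refine hb'.trans_le (le_liminf_of_le (by isBoundedDefault) ?_)
    obtain ⟨ε, hε, hball⟩ := Metric.mem_nhdsWithin_iff.1 (hlsc x hx b' hb'')
    have h1 : ∀ᶠ n : ℕ in atTop, 1 / ((n : ℝ) + 1) < ε :=
      tendsto_one_div_add_atTop_nhds_zero_nat.eventually (gt_mem_nhds hε)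
    filter_upwards [h1] with n hn
    refine le_iInf₂ fun y hy => (hball ⟨?_, ?_⟩ : b' < F y).le
    · have h2 := (hqx n x hx _).1 rfl
      rw [Metric.mem_ball, Real.dist_eq, abs_lt]
      rw [mem_Icc, add_div] at hy
      rw [mem_Ico, add_div] at h2
      constructor <;> linarith [hy.1, hy.2, h2.1, h2.2]
    · exact le_trans (by positivity) hy.1
  obtain ⟨n, hn⟩ : ∃ n, b < ∫⁻ x in Ici 0, a n (q n x) := by
    have h1 : ∫⁻ x in Ici 0, F x ≤ liminf (fun n => ∫⁻ x in Ici 0, a n (q n x)) atTop := by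
      refine (setLIntegral_mono' measurableSet_Ici fun x hx => hlim x hx).trans ?_
      exact lintegral_liminf_le fun n => (measurable_from_top (f := a n)).comp (hq n)
    exact (eventually_lt_of_lt_liminf (hb.trans_le h1)).exists
  have hn1 : (0 : ℝ) < (n : ℝ) + 1 := by positivity
  set h : ℝ := 1 / ((n : ℝ) + 1) with hh
  have hh0 : 0 < h := by positivity
  have hsum : ∫⁻ x in Ici 0, a n (q n x) = ∑' j, a n j * ENNReal.ofReal h := by
    rw [← lintegral_map (f := a n) measurable_from_top (hq n), lintegral_countable']
    refine tsum_congr fun j => ?_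
    rw [Measure.map_apply (hq n) (measurableSet_singleton _),
      Measure.restrict_apply (hq n (measurableSet_singleton _))]
    have : q n ⁻¹' {j} ∩ Ici 0 =
        Ico ((j : ℝ) / ((n : ℝ) + 1)) (((j : ℝ) + 1) / ((n : ℝ) + 1)) := by
      ext x
      constructor
      · rintro ⟨h1, h2⟩; exact (hqx n x h2 j).1 h1
      · intro h1
        have h2 : 0 ≤ x := le_trans (by positivity) h1.1
        exact ⟨(hqx n x h2 j).2 h1, h2⟩
    rw [this, Real.volume_Ico, ← sub_div]
    simp [hh]
  -- Finitely many cells suffice for a lower bound, so no uniform control of the tail is needed.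
  rw [hsum, ENNReal.tsum_eq_iSup_nat, lt_iSup_iff] at hn
  obtain ⟨N, hN⟩ := hn
  let m : ℝ → ℕ → ENNReal := fun t j => (κ.restrict (Ioc 0 t)).map (fun s => q n (t - s)) {j}
  have hqm : ∀ t, Measurable fun s => q n (t - s) := fun t =>
    (hq n).comp (measurable_const.sub measurable_id)
  -- Seen from `t`, the cell `[jh, (j+1)h)` is the time interval `(t-(j+1)h, t-jh]`, whose `κ`-mass
  -- is an increment over length `h`.
  have hmlim : ∀ j, Tendsto (fun t => m t j) atTop (𝓝 (ENNReal.ofReal h)) := by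
    intro j
    have h1 : Tendsto (fun t => t - ((j : ℝ) + 1) * h) atTop atTop :=
      tendsto_atTop_add_const_right _ _ tendsto_id
    have h2 := (ENNReal.continuous_ofReal.tendsto h).comp ((hκ h).comp h1)
    refine h2.congr' ?_
    filter_upwards [eventually_ge_atTop (((j : ℝ) + 1) * h)] with t ht
    have e : (fun s => q n (t - s)) ⁻¹' {j} ∩ Ioc 0 t =
        Ioc 0 (t - ((j : ℝ) + 1) * h + h) \ Ioc 0 (t - ((j : ℝ) + 1) * h) := by
      ext s
      have h3 : ∀ y : ℝ, y / ((n : ℝ) + 1) = y * h := fun y => by rw [hh]; ring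
      constructor
      · rintro ⟨h1, h2⟩
        have h4 := (hqx n (t - s) (sub_nonneg.2 h2.2) j).1 h1
        rw [mem_Ico, h3, h3] at h4
        refine ⟨⟨h2.1, by linarith [h4.1]⟩, fun h5 => ?_⟩
        linarith [h4.2, h5.2]
      · rintro ⟨h1, h2⟩
        have h5 : t - ((j : ℝ) + 1) * h < s := by
          by_contra hc
          exact h2 ⟨h1.1, not_lt.1 hc⟩
        have h7 : 0 ≤ (j : ℝ) * h := by positivity
        have h6 : s ≤ t := by linarith [h1.2]
        refine ⟨(hqx n (t - s) (sub_nonneg.2 h6) j).2 ?_, h1.1, h6⟩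
        rw [mem_Ico, h3, h3]
        constructor <;> linarith [h1.2]
    simp only [Function.comp, m]
    rw [Measure.map_apply (hqm t) (measurableSet_singleton _),
      Measure.restrict_apply (hqm t (measurableSet_singleton _)), e,
      ← measureReal_sdiff (Ioc_subset_Ioc_right (by linarith)) measurableSet_Ioc
        measure_Ioc_lt_top.ne, ofReal_measureReal
        (ne_top_of_le_ne_top measure_Ioc_lt_top.ne (measure_mono sdiff_subset))]
  have hslim : Tendsto (fun t => ∑ j ∈ Finset.range N, a n j * m t j) atTop
      (𝓝 (∑ j ∈ Finset.range N, a n j * ENNReal.ofReal h)) :=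
    tendsto_finsetSum _ fun j _ => ENNReal.Tendsto.const_mul (hmlim j)
      (Or.inl (by simpa using hh0))
  filter_upwards [hslim.eventually (lt_mem_nhds hN)] with t ht
  refine ht.trans_le ?_
  calc ∑ j ∈ Finset.range N, a n j * m t j ≤ ∑' j, a n j * m t j := ENNReal.sum_le_tsum _
    _ = ∫⁻ s in Ioc 0 t, a n (q n (t - s)) ∂κ := by
        rw [← lintegral_map (f := a n) measurable_from_top (hqm t), lintegral_countable']
    _ ≤ _ := setLIntegral_mono' measurableSet_Ioc fun s hs => haF n _ (sub_nonneg.2 hs.2)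

variable {g : ℝ → ℝ}

/-- The extension by zero of a function of the age to the line. -/
noncomputable def ageExtend (f : AgeSpace g → ℝ) : ℝ → ℝ := Function.extend Subtype.val f 0

theorem ageExtend_coe (f : AgeSpace g → ℝ) (x : AgeSpace g) : ageExtend f x = f x :=
  Subtype.val_injective.extend_apply f 0 x

theorem ageExtend_of_notMem (f : AgeSpace g → ℝ) {x : ℝ} (hx : x ∉ ageSet g) :
    ageExtend f x = 0 :=
  Function.extend_apply' _ _ _ fun ⟨y, hy⟩ => hx (hy ▸ y.2)

theorem measurable_ageExtend {f : AgeSpace g → ℝ} (hf : Continuous f) :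
    Measurable (ageExtend f) :=
  (measurableEmbedding_ageSpace g).measurable_extend hf.measurable measurable_zero

theorem ageExtend_nonneg {f : AgeSpace g → ℝ} (hf : ∀ x, 0 ≤ f x) (x : ℝ) :
    0 ≤ ageExtend f x := by
  by_cases hx : x ∈ ageSet g
  · exact (ageExtend_coe f ⟨x, hx⟩).symm ▸ hf _
  · rw [ageExtend_of_notMem f hx]

theorem ageExtend_le (f : BoundedContinuousFunction (AgeSpace g) ℝ) (x : ℝ) :
    |ageExtend f x| ≤ ‖f‖ := by
  by_cases hx : x ∈ ageSet g
  · exact (ageExtend_coe f ⟨x, hx⟩).symm ▸ f.norm_coe_le_norm _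
  · rw [ageExtend_of_notMem f hx]; simp

/-- Only points with a positive value matter. They lie in `ageSet g`, which is relatively open in
`[0,∞)`, and there the extended function is continuous. At and beyond `M` the value is `0`, the
least possible one. -/
theorem survival_weight_lowerSemicontinuous (hg : IsServiceDensity g) {f : AgeSpace g → ℝ}
    (hf : Continuous f) {x : ℝ} (hx : 0 ≤ x) {b : ENNReal}
    (hb : b < ENNReal.ofReal (ageExtend f x * survival g x)) :
    ∀ᶠ y in 𝓝[Ici 0] x, b < ENNReal.ofReal (ageExtend f y * survival g y) := by
  have hpos : 0 < survival g x := by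
    refine lt_of_le_of_ne (IsServiceDensity.survival_nonneg g x) fun h => ?_
    rw [← h, mul_zero, ENNReal.ofReal_zero] at hb
    exact not_lt_zero hb
  have hmem : x ∈ ageSet g := (hg.mem_ageSet_iff x).2 ⟨hx, hpos⟩
  have h1 : ContinuousOn (ageExtend f) (ageSet g) := by
    rw [continuousOn_iff_continuous_domRestrict]
    exact hf.congr fun y => (ageExtend_coe f y).symm
  have h2 : ageSet g ∈ 𝓝[Ici 0] x := by
    have h3 : ∀ᶠ y in 𝓝[Ici 0] x, 0 < survival g y :=
      (hg.continuous_survival.continuousAt.eventually (lt_mem_nhds hpos)).filter_mono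
        nhdsWithin_le_nhds
    filter_upwards [h3, self_mem_nhdsWithin] with y hy hy0
    exact (hg.mem_ageSet_iff y).2 ⟨hy0, hy⟩
  have h4 : Tendsto (ageExtend f) (𝓝[Ici 0] x) (𝓝 (ageExtend f x)) :=
    (h1 x hmem).tendsto.mono_left (nhdsWithin_le_of_mem h2)
  have h5 := (ENNReal.continuous_ofReal.tendsto _).comp
    (h4.mul (hg.continuous_survival.continuousAt.tendsto.mono_left nhdsWithin_le_nhds))
  exact h5.eventually (lt_mem_nhds hb)

theorem lintegral_equilibriumMeasure (hg : IsServiceDensity g) {f : AgeSpace g → ℝ}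
    (hf : Continuous f) (hf0 : ∀ x, 0 ≤ f x) :
    ∫⁻ x, ENNReal.ofReal (f x) ∂(equilibriumMeasure g) =
      ∫⁻ x in Ici 0, ENNReal.ofReal (ageExtend f x * survival g x) := by
  have hsm : Measurable (survival g) := hg.continuous_survival.measurable
  have hfm := measurable_ageExtend hf
  have hm := IsServiceDensity.measurableSet_ageSet g
  have e1 : equilibriumMeasure g = (lebesgueAge g).withDensity
      fun x => ENNReal.ofReal (survival g x) := by
    rw [equilibriumMeasure]
    congr 1; ext x
    rw [hg.survival_eq x.2.1]
  have hd : Measurable fun x : AgeSpace g => ENNReal.ofReal (survival g x) :=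
    (hsm.comp measurable_subtype_coe).ennreal_ofReal
  rw [e1, lintegral_withDensity_eq_lintegral_mul _ hd hf.measurable.ennreal_ofReal]
  have e2 : ∀ x : AgeSpace g, ((fun x : AgeSpace g => ENNReal.ofReal (survival g x)) *
      fun x => ENNReal.ofReal (f x)) x = ENNReal.ofReal (ageExtend f x * survival g x) := by
    intro x
    rw [Pi.mul_apply, ageExtend_coe, ENNReal.ofReal_mul (hf0 x), mul_comm]
  simp_rw [e2]
  have e3 : ∫⁻ x : AgeSpace g, ENNReal.ofReal (ageExtend f x * survival g x) ∂(lebesgueAge g) =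
      ∫⁻ x in ageSet g, ENNReal.ofReal (ageExtend f x * survival g x) :=
    lintegral_subtype_comap hm fun x => ENNReal.ofReal (ageExtend f x * survival g x)
  rw [e3]
  rw [← lintegral_indicator hm, ← lintegral_indicator measurableSet_Ici]
  refine lintegral_congr fun x => ?_
  by_cases hx : x ∈ ageSet g
  · rw [indicator_of_mem hx, indicator_of_mem (show x ∈ Ici 0 from hx.1)]
  · rw [indicator_of_notMem hx, indicator_apply, ageExtend_of_notMem f hx, zero_mul,
      ENNReal.ofReal_zero, ite_self]

theorem equilibriumMeasure_univ (hg : IsServiceDensity g) : equilibriumMeasure g univ = 1 := by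
  have h1 := lintegral_equilibriumMeasure hg (f := fun _ => 1) continuous_const
    fun _ => zero_le_one
  simp only [ENNReal.ofReal_one, lintegral_one] at h1
  rw [h1, setLIntegral_congr (Ioi_ae_eq_Ici (μ := volume) (a := (0 : ℝ))).symm,
    ← hg.lintegral_survival]
  refine setLIntegral_congr_fun measurableSet_Ioi fun x hx => ?_
  by_cases h : x ∈ ageSet g
  · have := ageExtend_coe (fun _ : AgeSpace g => (1 : ℝ)) ⟨x, h⟩
    simp only at this
    rw [this, one_mul]
  · have h2 : survival g x = 0 := le_antisymm (not_lt.1 fun h3 => h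
      ((hg.mem_ageSet_iff x).2 ⟨le_of_lt hx, h3⟩)) (IsServiceDensity.survival_nonneg g x)
    rw [h2, mul_zero]

theorem integral_equilibriumMeasure (hg : IsServiceDensity g) (f : AgeSpace g → ℝ) :
    ∫ x, f x ∂(equilibriumMeasure g) =
      ∫ x : AgeSpace g, f x * (1 - serviceCDF g x) ∂(lebesgueAge g) := by
  have hsm : Measurable (survival g) := hg.continuous_survival.measurable
  have e1 : equilibriumMeasure g = (lebesgueAge g).withDensity
      fun x => ENNReal.ofReal (survival g x) := by
    rw [equilibriumMeasure]
    congr 1; ext x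
    rw [hg.survival_eq x.2.1]
  have hd : Measurable fun x : AgeSpace g => ENNReal.ofReal (survival g x) :=
    (hsm.comp measurable_subtype_coe).ennreal_ofReal
  rw [e1, integral_withDensity_eq_integral_toReal_smul hd
    (Eventually.of_forall fun _ => ENNReal.ofReal_lt_top)]
  refine integral_congr_ae (Eventually.of_forall fun x => ?_)
  simp only
  rw [ENNReal.toReal_ofReal (IsServiceDensity.survival_nonneg g _), hg.survival_eq x.2.1,
    smul_eq_mul, mul_comm]

/-- Weak convergence of finite measures from convergence of the masses and asymptotic lower bounds
for the integrals of nonnegative functions. -/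
theorem FiniteMeasure.tendsto_integral_of_eventually_lt {Ω : Type*} [TopologicalSpace Ω]
    [MeasurableSpace Ω] [OpensMeasurableSpace Ω] {ν : ℝ → FiniteMeasure Ω} {ρ : Measure Ω}
    [IsFiniteMeasure ρ]
    (hmass : Tendsto (fun t => ((ν t).mass : ℝ)) atTop (𝓝 (ρ.real univ)))
    (h : ∀ f : BoundedContinuousFunction Ω ℝ, (∀ x, 0 ≤ f x) → ∀ b < ∫⁻ x, ENNReal.ofReal (f x) ∂ρ,
      ∀ᶠ t in atTop, b < ∫⁻ x, ENNReal.ofReal (f x) ∂(ν t : Measure Ω))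
    (f : BoundedContinuousFunction Ω ℝ) :
    Tendsto (fun t => ∫ x, f x ∂(ν t : Measure Ω)) atTop (𝓝 (∫ x, f x ∂ρ)) := by
  have hlow : ∀ f : BoundedContinuousFunction Ω ℝ, (∀ x, 0 ≤ f x) → ∀ b < ∫ x, f x ∂ρ,
      ∀ᶠ t in atTop, b < ∫ x, f x ∂(ν t : Measure Ω) := by
    intro f hf b hb
    have hint : ∀ (m : Measure Ω) [IsFiniteMeasure m],
        ENNReal.ofReal (∫ x, f x ∂m) = ∫⁻ x, ENNReal.ofReal (f x) ∂m := fun m _ =>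
      ofReal_integral_eq_lintegral_ofReal (f.integrable m) (Eventually.of_forall hf)
    rcases lt_or_ge b 0 with hb0 | hb0
    · exact Eventually.of_forall fun t => hb0.trans_le (integral_nonneg hf)
    have h1 : ENNReal.ofReal b < ∫⁻ x, ENNReal.ofReal (f x) ∂ρ := by
      rw [← hint]
      exact (ENNReal.ofReal_lt_ofReal_iff (hb0.trans_lt hb)).2 hb
    filter_upwards [h f hf _ h1] with t ht
    rw [← hint] at ht
    exact (ENNReal.ofReal_lt_ofReal_iff_of_nonneg hb0).1 ht
  have hconst : ∀ (m : Measure Ω) [IsFiniteMeasure m] (c : ℝ), ∫ _, c ∂m = m.real univ * c :=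
    fun m _ c => by rw [integral_const, smul_eq_mul]
  have hreal : ∀ t, (ν t : Measure Ω).real univ = ((ν t).mass : ℝ) := fun t => rfl
  refine tendsto_order.2 ⟨fun b hb => ?_, fun b hb => ?_⟩
  -- Both `f + ‖f‖` and `‖f‖ - f` are nonnegative. Their asymptotic lower bounds, combined with
  -- convergence of the masses, bound the integrals of `f` from below and from above.
  · set ε := (∫ x, f x ∂ρ - b) / 2 with hε
    have hε0 : 0 < ε := by linarith
    have h1 := hlow (f + BoundedContinuousFunction.const Ω ‖f‖) (fun x => by
      have := (abs_le.1 (f.norm_coe_le_norm x)).1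
      simp only [BoundedContinuousFunction.coe_add, Pi.add_apply,
        BoundedContinuousFunction.const_apply]
      linarith) (∫ x, f x ∂ρ + ρ.real univ * ‖f‖ - ε) (by
      simp only [BoundedContinuousFunction.coe_add, Pi.add_apply,
        BoundedContinuousFunction.const_apply]
      rw [integral_add (f.integrable ρ) (integrable_const _), hconst]
      linarith)
    have h2 := (tendsto_order.1 (hmass.mul_const ‖f‖)).2 (ρ.real univ * ‖f‖ + ε) (by linarith)
    filter_upwards [h1, h2] with t h3 h4
    simp only [BoundedContinuousFunction.coe_add, Pi.add_apply,
      BoundedContinuousFunction.const_apply] at h3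
    rw [integral_add (f.integrable _) (integrable_const _), hconst, hreal] at h3
    linarith
  · set ε := (b - ∫ x, f x ∂ρ) / 2 with hε
    have hε0 : 0 < ε := by linarith
    have h1 := hlow (BoundedContinuousFunction.const Ω ‖f‖ - f) (fun x => by
      have := (abs_le.1 (f.norm_coe_le_norm x)).2
      simp only [BoundedContinuousFunction.coe_sub, Pi.sub_apply,
        BoundedContinuousFunction.const_apply]
      linarith) (ρ.real univ * ‖f‖ - ∫ x, f x ∂ρ - ε) (by
      simp only [BoundedContinuousFunction.coe_sub, Pi.sub_apply,
        BoundedContinuousFunction.const_apply]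
      rw [integral_sub (integrable_const _) (f.integrable ρ), hconst]
      linarith)
    have h2 := (tendsto_order.1 (hmass.mul_const ‖f‖)).2 (ρ.real univ * ‖f‖ + ε) (by linarith)
    filter_upwards [h1, h2] with t h3 h4
    simp only [BoundedContinuousFunction.coe_sub, Pi.sub_apply,
      BoundedContinuousFunction.const_apply] at h3
    rw [integral_sub (integrable_const _) (f.integrable _), hconst, hreal] at h3
    linarith

namespace SolvesFluidEquations

variable {lam : ℝ} {X₀ : ℝ} {ν₀ : FiniteMeasure (AgeSpace g)} {X : ℝ → ℝ}
  {ν : ℝ → FiniteMeasure (AgeSpace g)}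

theorem lintegral_ageSpace_eq {E : ℝ → ℝ} (hg : IsServiceDensity g)
    (hs : SolvesFluidEquations g E X₀ ν₀ X ν) {f : AgeSpace g → ℝ} (hf : Continuous f)
    (hf0 : ∀ x, 0 ≤ f x) {t : ℝ} (ht : 0 ≤ t) :
    ∫⁻ x, ENNReal.ofReal (f x) ∂(ν t : Measure (AgeSpace g)) =
      ∫⁻ x, ENNReal.ofReal (ageExtend f (x + t)) *
        ENNReal.ofReal (survival g (x + t) / survival g x) ∂(lineMeasure ν 0)
      + ∫⁻ s in Ioc 0 t, ENNReal.ofReal (ageExtend f (t - s) * survival g (t - s))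
        ∂(stieltjesMeasure (fluidEntries g ν)) := by
  have h1 := hs.lintegral_eq hg ht (measurable_ageExtend hf).ennreal_ofReal
  rw [lintegral_lineMeasure ν ht] at h1
  simp_rw [ageExtend_coe] at h1
  rw [h1]
  congr 1
  refine lintegral_congr fun s => ?_
  rw [ENNReal.ofReal_mul (ageExtend_nonneg hf0 _)]

/-- For the lower bound the contribution of the initial ages is simply discarded; the entries alone
produce the full limit, whose total mass `1` is the limit of the masses. -/
theorem tendsto_integral (hg : IsServiceDensity g) (hlam : 1 ≤ lam)
    (hs : SolvesFluidEquations g (fun t => lam * t) X₀ ν₀ X ν)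
    (f : BoundedContinuousFunction (AgeSpace g) ℝ) :
    Tendsto (fun t => ∫ x, f x ∂(ν t : Measure (AgeSpace g))) atTop
      (𝓝 (∫ x, f x ∂(equilibriumMeasure g))) := by
  have := hg.isFiniteMeasure_equilibrium
  refine FiniteMeasure.tendsto_integral_of_eventually_lt ?_ (fun f hf b hb => ?_) f
  · rw [Measure.real, equilibriumMeasure_univ hg, ENNReal.toReal_one]
    exact hs.tendsto_mass hg hlam
  · rw [lintegral_equilibriumMeasure hg f.continuous hf] at hb
    have h1 := eventually_lt_lintegral_comp_sub
      (κ := stieltjesMeasure (fluidEntries g ν)) (hs.tendsto_entries hg hlam)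
      (F := fun x => ENNReal.ofReal (ageExtend f x * survival g x))
      (fun x hx b hb => survival_weight_lowerSemicontinuous hg f.continuous hx hb) hb
    filter_upwards [h1, eventually_ge_atTop 0] with t h2 ht
    rw [hs.lintegral_ageSpace_eq hg f.continuous hf ht]
    exact h2.trans_le le_add_self

/-- With at most critical arrival rate and an initially empty system, customers enter service at
the arrival rate. -/
theorem stieltjesMeasure_restrict_eq (hg : IsServiceDensity g) (hlam : 0 < lam) (hlam1 : lam ≤ 1)
    (hs : SolvesFluidEquations g (fun t => lam * t) 0 ν₀ X ν) :
    (stieltjesMeasure (fluidEntries g ν)).restrict (Ioi 0) =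
      (ENNReal.ofReal lam • volume).restrict (Ioi 0) := by
  set κ := stieltjesMeasure (fluidEntries g ν) with hκ
  have h0 : ∀ t, 0 ≤ t → κ (Ioc 0 t) = ENNReal.ofReal (lam * t) := fun t ht => by
    rw [← ofReal_entries, hs.entries_eq_of_empty hg hlam hlam1 ht]
  have h1 : ∀ a b, 0 ≤ a → a ≤ b → κ (Ioc a b) = ENNReal.ofReal lam * volume (Ioc a b) := by
    intro a b ha hab
    have e : Ioc a b = Ioc 0 b \ Ioc 0 a := by
      ext s
      constructor
      · intro h; exact ⟨⟨ha.trans_lt h.1, h.2⟩, fun h' => absurd h'.2 (not_le.2 h.1)⟩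
      · rintro ⟨h, h'⟩
        exact ⟨by by_contra hc; exact h' ⟨h.1, not_lt.1 hc⟩, h.2⟩
    rw [Real.volume_Ioc, e, measure_sdiff (Ioc_subset_Ioc_right hab)
      measurableSet_Ioc.nullMeasurableSet measure_Ioc_lt_top.ne, h0 _ ha, h0 _ (ha.trans hab),
      ← ENNReal.ofReal_sub _ (by positivity), ← ENNReal.ofReal_mul hlam.le, mul_sub]
  have : IsLocallyFiniteMeasure (κ.restrict (Ioi 0)) := inferInstance
  refine Measure.ext_of_Ioc _ _ fun a b hab => ?_
  rw [Measure.restrict_apply measurableSet_Ioc, Measure.restrict_apply measurableSet_Ioc,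
    Ioc_inter_Ioi, Measure.smul_apply, smul_eq_mul]
  rcases le_total (max a 0) b with h | h
  · exact h1 _ _ (le_max_right _ _) h
  · rw [Ioc_eq_empty (not_lt.2 h)]; simp

theorem integrableOn_weight (hg : IsServiceDensity g)
    (f : BoundedContinuousFunction (AgeSpace g) ℝ) :
    IntegrableOn (fun x => ageExtend f x * survival g x) (Ioi 0) := by
  refine Integrable.bdd_mul (c := ‖f‖) hg.integrableOn_survival
    (measurable_ageExtend f.continuous).aestronglyMeasurable
    (Eventually.of_forall fun x => ageExtend_le f x)

/-- There are no initial customers and `dK = λ ds`, so the representation formula gives `ν_t` the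
density `λ S` on `[0,t]`. Monotonicity in `t` and the limit are then immediate. -/
theorem integral_eq_of_empty (hg : IsServiceDensity g) (hlam : 0 < lam) (hlam1 : lam ≤ 1)
    (hs : SolvesFluidEquations g (fun t => lam * t) 0 ν₀ X ν)
    (f : BoundedContinuousFunction (AgeSpace g) ℝ) (hf : ∀ x, 0 ≤ f x) {t : ℝ} (ht : 0 ≤ t) :
    ∫ x, f x ∂(ν t : Measure (AgeSpace g)) =
      lam * ∫ x in (0 : ℝ)..t, ageExtend f x * survival g x := by
  have hfm := measurable_ageExtend f.continuous
  have hsm : Measurable (survival g) := hg.continuous_survival.measurable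
  have hnn : ∀ x, 0 ≤ ageExtend f x * survival g x := fun x =>
    mul_nonneg (ageExtend_nonneg hf x) (IsServiceDensity.survival_nonneg g x)
  have h1 := hs.lintegral_ageSpace_eq hg f.continuous hf ht
  rw [hs.mass_zero, lintegral_zero_measure, zero_add] at h1
  have e1 : (stieltjesMeasure (fluidEntries g ν)).restrict (Ioc 0 t) =
      ENNReal.ofReal lam • volume.restrict (Ioc 0 t) := by
    have := congrArg (fun m : Measure ℝ => m.restrict (Ioc 0 t))
      (hs.stieltjesMeasure_restrict_eq hg hlam hlam1)
    simp only [Measure.restrict_restrict measurableSet_Ioc] at this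
    rwa [inter_eq_left.2 Ioc_subset_Ioi_self, Measure.restrict_smul] at this
  have hi : IntervalIntegrable (fun s => ageExtend f s * survival g s) volume 0 t := by
    rw [intervalIntegrable_iff_integrableOn_Ioc_of_le ht]
    exact (integrableOn_weight hg f).mono_set Ioc_subset_Ioi_self
  have hi' : IntegrableOn (fun s => ageExtend f (t - s) * survival g (t - s)) (Ioc 0 t) := by
    have := (hi.comp_sub_left t).symm
    simp only [sub_zero, sub_self] at this
    rwa [intervalIntegrable_iff_integrableOn_Ioc_of_le ht] at this
  have e2 : ∫⁻ s in Ioc 0 t, ENNReal.ofReal (ageExtend f (t - s) * survival g (t - s)) =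
      ENNReal.ofReal (∫ x in (0 : ℝ)..t, ageExtend f x * survival g x) := by
    rw [← ofReal_integral_eq_lintegral_ofReal hi' (Eventually.of_forall fun s => hnn _),
      ← intervalIntegral.integral_of_le ht,
      intervalIntegral.integral_comp_sub_left (fun x => ageExtend f x * survival g x)]
    simp
  rw [e1, lintegral_smul_measure, e2, smul_eq_mul, ← ENNReal.ofReal_mul hlam.le,
    ← ofReal_integral_eq_lintegral_ofReal (f.integrable _) (Eventually.of_forall hf),
    ENNReal.ofReal_eq_ofReal_iff (integral_nonneg hf)
      (mul_nonneg hlam.le (intervalIntegral.integral_nonneg ht fun x _ => hnn x))] at h1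
  exact h1

theorem integral_equilibriumMeasure_eq (hg : IsServiceDensity g)
    (f : BoundedContinuousFunction (AgeSpace g) ℝ) (hf : ∀ x, 0 ≤ f x) :
    ∫ x, f x ∂(equilibriumMeasure g) = ∫ x in Ioi 0, ageExtend f x * survival g x := by
  have hfm := measurable_ageExtend f.continuous
  have hsm : Measurable (survival g) := hg.continuous_survival.measurable
  rw [integral_eq_lintegral_of_nonneg_ae (Eventually.of_forall hf)
    f.continuous.measurable.aestronglyMeasurable,
    lintegral_equilibriumMeasure hg f.continuous hf,
    setLIntegral_congr (Ioi_ae_eq_Ici (μ := volume) (a := (0 : ℝ))).symm,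
    integral_eq_lintegral_of_nonneg_ae (Eventually.of_forall fun x =>
      mul_nonneg (ageExtend_nonneg hf x) (IsServiceDensity.survival_nonneg g x))
      (hfm.mul hsm).aestronglyMeasurable]

theorem monotoneOn_integral_of_empty (hg : IsServiceDensity g) (hlam : 0 < lam) (hlam1 : lam ≤ 1)
    (hs : SolvesFluidEquations g (fun t => lam * t) 0 ν₀ X ν)
    (f : BoundedContinuousFunction (AgeSpace g) ℝ) (hf : ∀ x, 0 ≤ f x) :
    MonotoneOn (fun t => ∫ x, f x ∂(ν t : Measure (AgeSpace g))) (Ici 0) := by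
  intro s h0 t h1 hst
  simp only
  rw [hs.integral_eq_of_empty hg hlam hlam1 f hf h0, hs.integral_eq_of_empty hg hlam hlam1 f hf h1]
  gcongr
  rw [intervalIntegral.integral_of_le h0, intervalIntegral.integral_of_le h1]
  refine setIntegral_mono_set ((integrableOn_weight hg f).mono_set Ioc_subset_Ioi_self)
    (Eventually.of_forall fun x =>
      mul_nonneg (ageExtend_nonneg hf x) (IsServiceDensity.survival_nonneg g x))
    (Ioc_subset_Ioc_right hst).eventuallyLE

theorem tendsto_integral_of_empty (hg : IsServiceDensity g) (hlam : 0 < lam) (hlam1 : lam ≤ 1)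
    (hs : SolvesFluidEquations g (fun t => lam * t) 0 ν₀ X ν)
    (f : BoundedContinuousFunction (AgeSpace g) ℝ) (hf : ∀ x, 0 ≤ f x) :
    Tendsto (fun t => ∫ x, f x ∂(ν t : Measure (AgeSpace g))) atTop
      (𝓝 (lam * ∫ x, f x ∂(equilibriumMeasure g))) := by
  rw [integral_equilibriumMeasure_eq hg f hf]
  refine ((intervalIntegral_tendsto_integral_Ioi 0 (integrableOn_weight hg f)
    tendsto_id).const_mul lam).congr' ?_
  filter_upwards [eventually_ge_atTop 0] with t ht
  exact (hs.integral_eq_of_empty hg hlam hlam1 f hf ht).symm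

end SolvesFluidEquations

end

/-! ### Conclusion. -/

theorem theorem3p3 (g : ℝ → ℝ) (hg : IsServiceDensity g) (lam : ℝ) (hlam : 0 < lam)
    (X₀ : ℝ) (ν₀ : FiniteMeasure (AgeSpace g))
    (hinput : IsFluidInput g (fun t => lam * t) X₀ ν₀)
    (X : ℝ → ℝ) (ν : ℝ → FiniteMeasure (AgeSpace g))
    (hsol : IsUniqueFluidSolution g (fun t => lam * t) X₀ ν₀ X ν) :
    (X₀ = 0 →
      (∀ t, 0 ≤ t → ((ν t).mass : ℝ) = min (X t) 1) ∧
      (lam ≤ 1 → ∀ t, 0 ≤ t → X t = ((ν t).mass : ℝ)) ∧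
      MonotoneOn (fun t => ((ν t).mass : ℝ)) (Ici 0) ∧
      Tendsto (fun t => ((ν t).mass : ℝ)) atTop (𝓝 (min lam 1)) ∧
      (lam ≤ 1 → ∀ f : BoundedContinuousFunction (AgeSpace g) ℝ, (∀ x, 0 ≤ f x) →
        MonotoneOn (fun t => ∫ x, f x ∂(ν t : Measure (AgeSpace g))) (Ici 0) ∧
        Tendsto (fun t => ∫ x, f x ∂(ν t : Measure (AgeSpace g))) atTop
          (𝓝 (lam * ∫ x, f x ∂(equilibrium g hg : Measure (AgeSpace g)))))) ∧
    (DirectlyRiemannIntegrable g → 1 ≤ lam →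
      (∀ f : BoundedContinuousFunction (AgeSpace g) ℝ,
        Tendsto (fun t => ∫ x, f x ∂(ν t : Measure (AgeSpace g))) atTop
          (𝓝 (∫ x, f x ∂(equilibrium g hg : Measure (AgeSpace g)))) ∧
        ∫ x, f x ∂(equilibrium g hg : Measure (AgeSpace g)) =
          ∫ x : AgeSpace g, f x * (1 - serviceCDF g x) ∂(lebesgueAge g)) ∧
      Tendsto ν atTop (𝓝 (equilibrium g hg))) := by
  have hs := hsol.1
  refine ⟨fun hX => ?_, fun _ hlam1 => ⟨fun f => ⟨hs.tendsto_integral hg hlam1 f,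
    integral_equilibriumMeasure hg f⟩, ?_⟩⟩
  · subst hX
    refine ⟨fun t ht => hs.mass_eq_min ht, fun h1 t ht => ?_, fun s h0 t h1 hst => ?_, ?_,
      fun h1 f hf => ⟨hs.monotoneOn_integral_of_empty hg hlam h1 f hf,
        hs.tendsto_integral_of_empty hg hlam h1 f hf⟩⟩
    · have hI : lam * meanSurvival g t ≤ 1 :=
        (mul_le_of_le_one_right hlam.le (hg.meanSurvival_le_one t)).trans h1
      rw [hs.mass_eq_of_empty hg hlam ht, hs.X_eq_of_le hg hlam ht hI, min_eq_left hI]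
    · simp only
      rw [hs.mass_eq_of_empty hg hlam h0, hs.mass_eq_of_empty hg hlam h1]
      gcongr
      exact hg.meanSurvival_mono hst
    · have h1 := (hg.tendsto_meanSurvival.const_mul lam).min (tendsto_const_nhds (x := (1 : ℝ)))
      rw [mul_one] at h1
      refine h1.congr' ?_
      filter_upwards [eventually_ge_atTop 0] with t ht
      exact (hs.mass_eq_of_empty hg hlam ht).symm
  · exact FiniteMeasure.tendsto_iff_forall_integral_tendsto.2 fun f =>
      hs.tendsto_integral hg hlam1 f
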